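/- **Setting.** Let $\bar H=\sum_{j=1}^M h_j\sigma_j$ be an $n$-qubit Hamiltonian with real $h_j$, Pauli operators (tensor products of $I,X,Y,Z$) $\sigma_j$, and $h_{tot}=\sum_j|h_j|>0$; let $E_g$ be its smallest eigenvalue, $|\Psi_g\rangle$ a normalised ground state, $|\Psi\rangle$ a normalised initial state, and $p_g=|\langle\Psi_g|\Psi\rangle|^2\ge p_b>0$. If $\bar H$ has an eigenvalue different from $E_g$, the gap $\Delta$ is the distance from $E_g$ to the next larger eigenvalue. *Leading-order-rotation (LOR) formula.* For real $t$ let $\phi(t)=\arctan(h_{tot}|t|)$. Set $U_s(t)=e^{-i\,\mathrm{sgn}(h_jt)\phi(t)\sigma_j}$, $w_s(t)=|h_jt|/\sin\phi(t)$, $\theta_s(t)=0$ for $s=j$; and $U_s(t)=\sigma_{j_k}\cdots\sigma_{j_1}$, $w_s(t)e^{i\theta_s(t)}=\frac1{k!}\prod_{a}(-ih_{j_a}t)$, $w_s\ge0$, for $s=(j_1,\dots,j_k)$ with $k\ge2$. For $S=(s_1,\dots,s_{N_t})$ put $U_S(t)=U_{s_{N_t}}(t/N_t)\cdots U_{s_1}(t/N_t)$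 and $w_S(t)e^{i\theta_S(t)}=\prod_l w_{s_l}(t/N_t)e^{i\theta_{s_l}(t/N_t)}$. Let $C_A(t)=\sum_sw_s(t)=\sqrt{1+h_{tot}^2t^2}+e^{h_{tot}|t|}-1-h_{tot}|t|$, $g(t)=\frac1\pi\frac{\beta}{\beta^2+t^2}e^{-(\beta^2+t^2)/(2\tau^2)}$ and $C_T=\int_{-T}^Tg(t)C_A(t/N_t)^{N_t}dt$. *Imaginary-time simulation* with parameters $E_0,\beta,\tau,T,N_t,N_s$. For an observable $O=\sum_ja_jO_j$ ($a_j$ real, $O_j$ Pauli operators, $a_O=\sum_j|a_j|$) draw $N_s$ independent samples: $(t,S,t',S')$ with $t,t'\in[-T,T]$ and density $C_T^{-2}g(t)g(t')w_S(t)w_{S'}(t')$; $j$ with probability $|a_j|/a_O$; and independent one-shot Hadamard-test outcomes $\mu_R,\mu_I\in\{\pm1\}$ whose means are the real and imaginary parts of $\langle\Psi|U_{S'}(t')^\dagger O_jU_S(t)|\Psi\rangle$. Let $\hat O$ be $a_OC_T^2$ times the average over the samples of $\mathrm{sgn}(a_j)e^{iE_0(t-t')}e^{i\theta_S(t)-i\theta_{S'}(t')}(\mu_R+i\mu_I)$.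 The simulation outputs $\hat O/\hat{\mathbb 1}$, where $O=\bar H$ and the denominator is the independently sampled estimator for the identity observable. *Iterative ground-state solver.* Start with $\hat E_g=0$ and $\delta E=h_{tot}$. In each of $N_i$ rounds choose $\beta,\tau,T>0$ and integers $N_t,N_s\ge1$; run the simulation with fresh samples and $E_0=\mathrm{Re}\,\hat E_g-\delta E-1/\beta$; replace $\hat E_g$ by its output and $\delta E$ by $\frac34\delta E$. With $\alpha_b=p_b/(1-p_b)$, it is required that $\frac1{2\beta}\ln\!\left(1+\frac1{e\alpha_b}\right)\le\frac{\delta E}2$ in every round. If a number $\Delta_b>0$ with $\Delta\ge\Delta_b$ is given, a round may instead satisfy $2\beta\Delta_b\ge1+\ln\!\left(1+\frac1{e\alpha_b}\right)$ and $\frac{e^{-2\beta\Delta_b}\Delta_b}{\alpha_b+e^{-2\beta\Delta_b}}\le\frac{\delta E}2$. Let $N_{t,max}$ be the largest $N_t$ and $N_{s,tot}$ the sum of the $N_s$ over all rounds. **Theorem 2.** For every $p_b>0$ there is a constant $C>0$, depending only on $p_b$, such that the following holds. (i) For all $h_{tot},\xi,\kappa>0$ there is a choice of $N_i$ and of the parameters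 $\beta,\tau,T,N_t,N_s$ of all rounds, depending only on $p_b,h_{tot},\xi,\kappa$, such that for all $n$, all $n$-qubit Hamiltonians $\bar H$ with this $h_{tot}$ and all initial states with $p_g\ge p_b$, the final output satisfies $$|\hat E_g-E_g|<h_{tot}\,\xi\quad\text{with probability greater than }1-\kappa,$$ and, if $\xi\le\frac12$ and $\kappa\le1$, $$N_{s,tot}\le C\,\frac1{\kappa\xi^2}\Big(\ln\frac1\xi\Big)^2,\qquad N_{t,max}\le C\,\frac1{\xi^2}\Big(\ln\frac1\xi\Big)^2 .$$ (ii) For all $h_{tot},\Delta_b,\xi,\kappa>0$ there is such a choice, depending only on $p_b,h_{tot},\Delta_b,\xi,\kappa$, with the same conclusions for all $n$, all such $\bar H$ whose gap above the ground-state energy satisfies $\Delta\ge\Delta_b$ and all initial states with $p_g\ge p_b$, except that the bound on the Trotter step number is replaced by $$N_{t,max}\le C\,\frac{h_{tot}^2}{\Delta_b^2}\Big(\ln\frac1\xi\Big)^4 .$$ -/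

import Mathlib

open MeasureTheory

namespace QCMC

noncomputable section

/-! ### Qubits, Pauli operators and Hamiltonians -/

/-- The four single-qubit Pauli labels. -/
inductive Pauli
  | I | X | Y | Z

/-- The single-qubit Pauli matrices. -/
def Pauli.mat : Pauli → Matrix (Fin 2) (Fin 2) ℂ
  | .I => 1
  | .X => !![0, 1; 1, 0]
  | .Y => !![0, -Complex.I; Complex.I, 0]
  | .Z => !![1, 0; 0, -1]

/-- State vectors of `n` qubits, with the Euclidean norm. -/
abbrev State (n : ℕ) := EuclideanSpace ℂ (Fin n → Fin 2)

/-- Operators on `n` qubits, as matrices in the computational basis. -/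
abbrev Op (n : ℕ) := Matrix (Fin n → Fin 2) (Fin n → Fin 2) ℂ

/-- The action of an operator on a state. -/
def act {n : ℕ} (A : Op n) (ψ : State n) : State n := Matrix.toEuclideanLin A ψ

/-- The `n`-qubit Pauli operator `p 0 ⊗ ⋯ ⊗ p (n-1)`. -/
def pauliOp {n : ℕ} (p : Fin n → Pauli) : Op n :=
  Matrix.of fun x y => ∏ q, (p q).mat (x q) (y q)

/-- A real linear combination `∑ j, a j • σ j` of `n`-qubit Pauli operators. Hamiltonians and
observables are given to the algorithm in this form. -/
structure PauliSum (n : ℕ) where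
  numTerms : ℕ
  coeff : Fin numTerms → ℝ
  label : Fin numTerms → Fin n → Pauli

namespace PauliSum

variable {n : ℕ}

/-- The `j`-th Pauli operator of the sum. -/
def term (A : PauliSum n) (j : Fin A.numTerms) : Op n := pauliOp (A.label j)

/-- The operator `∑ j, a j • σ j`. -/
def op (A : PauliSum n) : Op n := ∑ j, (A.coeff j : ℂ) • A.term j

/-- `∑ j, |a j|`; this is `h_tot` for a Hamiltonian and `a_O` for an observable `O`. -/
def norm1 (A : PauliSum n) : ℝ := ∑ j, |A.coeff j|

/-- The identity observable, as a sum of one Pauli operator. -/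
def ident (n : ℕ) : PauliSum n where
  numTerms := 1
  coeff := fun _ => 1
  label := fun _ _ => .I

/-- The set of eigenvalues (energy levels). -/
def energies (A : PauliSum n) : Set ℝ :=
  {E | Module.End.HasEigenvalue (Matrix.toEuclideanLin A.op) (E : ℂ)}

/-- `Eg` is the ground-state energy. -/
def IsGroundEnergy (A : PauliSum n) (Eg : ℝ) : Prop := IsLeast A.energies Eg

/-- `φ` is a normalised ground state. -/
def IsGroundState (A : PauliSum n) (Eg : ℝ) (φ : State n) : Prop :=
  ‖φ‖ = 1 ∧ act A.op φ = (Eg : ℂ) • φ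

/-- `Δ` is the energy gap above the ground-state energy `Eg`. -/
def IsGap (A : PauliSum n) (Eg Δ : ℝ) : Prop :=
  IsLeast {δ | ∃ E ∈ A.energies, E ≠ Eg ∧ δ = E - Eg} Δ

end PauliSum

/-! ### Zeroth-order leading-order-rotation formula -/

/-- Labels of the terms in the formula for one Trotter step with `M` Hamiltonian terms: a rotation
`s = j`, or a word `s = (j₁, …, j_{k+2})` of at least two letters. -/
inductive Step (M : ℕ)
  | rot (j : Fin M)
  | word (k : ℕ) (js : Fin (k + 2) → Fin M)

instance (M : ℕ) : MeasurableSpace (Step M) := ⊤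

variable {n : ℕ}

/-- `φ(t) = arctan (h_tot |t|)`. -/
def rotAngle (H : PauliSum n) (t : ℝ) : ℝ := Real.arctan (H.norm1 * |t|)

/-- The unitary `U_s(t)`: the rotation `exp(-i sgn(h_j t) φ(t) σ_j)`, or the Pauli product
`σ_{j_k} ⋯ σ_{j_1}`. -/
def stepOp (H : PauliSum n) (t : ℝ) : Step H.numTerms → Op n
  | .rot j => NormedSpace.exp
      ((-(Complex.I * (Real.sign (H.coeff j * t) * rotAngle H t : ℝ))) • H.term j)
  | .word _ js => (List.ofFn fun a => H.term (js a)).reverse.prod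

/-- The weight `w_s(t)`. For a rotation this is `|h_j t| / sin φ(t)`, written in a form that
extends it continuously to `t = 0`. -/
def stepWeight (H : PauliSum n) (t : ℝ) : Step H.numTerms → ℝ
  | .rot j => |H.coeff j| / H.norm1 * Real.sqrt (1 + (H.norm1 * |t|) ^ 2)
  | .word k js => (∏ a, |H.coeff (js a) * t|) / (Nat.factorial (k + 2) : ℝ)

/-- The phase factor `exp(i θ_s(t))`. It is `0` only where the weight is `0`. -/
def stepPhase (H : PauliSum n) (t : ℝ) : Step H.numTerms → ℂ
  | .rot _ => 1
  | .word _ js => ∏ a, (-Complex.I * (Real.sign (H.coeff (js a) * t) : ℝ))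

/-- `C_A(t)`, the sum of all the weights `w_s(t)`. -/
def weightSum (H : PauliSum n) (t : ℝ) : ℝ :=
  Real.sqrt (1 + (H.norm1 * |t|) ^ 2) + Real.exp (H.norm1 * |t|) - (1 + H.norm1 * |t|)

/-- A sampled evolution: a real time `t` and the terms `S = (s_1, …, s_{N_t})` chosen in the
Trotter steps, each of length `t / N_t`. -/
abbrev Path (M Nt : ℕ) := ℝ × (Fin Nt → Step M)

/-- `U_S(t) = U_{s_{N_t}}(t/N_t) ⋯ U_{s_1}(t/N_t)`. -/
def pathOp {Nt : ℕ} (H : PauliSum n) (p : Path H.numTerms Nt) : Op n :=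
  (List.ofFn fun l => stepOp H (p.1 / Nt) (p.2 l)).reverse.prod

/-- `w_S(t)`. -/
def pathWeight {Nt : ℕ} (H : PauliSum n) (p : Path H.numTerms Nt) : ℝ :=
  ∏ l, stepWeight H (p.1 / Nt) (p.2 l)

/-- `exp(i θ_S(t))`. -/
def pathPhase {Nt : ℕ} (H : PauliSum n) (p : Path H.numTerms Nt) : ℂ :=
  ∏ l, stepPhase H (p.1 / Nt) (p.2 l)

/-! ### The imaginary-time simulation -/

/-- Input of one round of the ground-state solver: the current uncertainty `δE` of the energy
estimate, the imaginary time `β`, the Gaussian width `τ`, the truncation time `T`, the Trotter step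
number `Nt` and the sample size `Ns`. -/
structure Round where
  δE : ℝ
  β : ℝ
  τ : ℝ
  T : ℝ
  Nt : ℕ
  Ns : ℕ

/-- The Lorentz–Gaussian function `g(t)`. -/
def Round.g (r : Round) (t : ℝ) : ℝ :=
  1 / Real.pi * (r.β / (r.β ^ 2 + t ^ 2)) * Real.exp (-((r.β ^ 2 + t ^ 2) / (2 * r.τ ^ 2)))

/-- `C_T`, the integral of `g(t) C_A(t / N_t) ^ N_t` over `[-T, T]`. -/
def Round.CT (r : Round) (H : PauliSum n) : ℝ :=
  ∫ t in (-r.T)..r.T, r.g t * weightSum H (t / r.Nt) ^ r.Nt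

/-- One sample: `(t, S)`, `(t', S')`, the index `j` of the measured term of the observable, and the
two single-shot outcomes `μ_R`, `μ_I` (`true` for `+1`, `false` for `-1`). -/
abbrev Sample (M Nt K : ℕ) := Path M Nt × Path M Nt × Fin K × Bool × Bool

/-- The value `±1` of a measurement outcome. -/
def outcome (b : Bool) : ℝ := if b then 1 else -1

/-- Born probability of outcome `b` when `X` is measured on the ancilla of the state
`(|0⟩ φ₀ + |1⟩ φ₁) / √2`. -/
def probX (φ₀ φ₁ : State n) (b : Bool) : ℝ :=
  ‖(1 / 2 : ℂ) • (φ₀ + (outcome b : ℂ) • φ₁)‖ ^ 2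

/-- Born probability of outcome `b` when `Y` is measured on the ancilla of the state
`(|0⟩ φ₀ + |1⟩ φ₁) / √2`. -/
def probY (φ₀ φ₁ : State n) (b : Bool) : ℝ :=
  ‖(1 / 2 : ℂ) • (φ₀ - (outcome b * Complex.I) • φ₁)‖ ^ 2

/-- Reference measure for a sampled evolution: Lebesgue measure on `[-T, T]` times counting. -/
def pathBase (M Nt : ℕ) (T : ℝ) : Measure (Path M Nt) :=
  (volume.restrict (Set.Icc (-T) T)).prod Measure.count

/-- Density of one sample: `(t, S, t', S')` has density `C_T⁻² g(t) g(t') w_S(t) w_{S'}(t')`, then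
`j` has probability `|a_j| / a_O`, and then `μ_R` and `μ_I` are the outcomes of one shot each of the
Hadamard test for `⟨ψ| U_{S'}(t')† O_j U_S(t) |ψ⟩`. -/
def sampleDensity (r : Round) (H O : PauliSum n) (ψ : State n)
    (x : Sample H.numTerms r.Nt O.numTerms) : ℝ :=
  match x with
  | (p, p', j, b, b') =>
    let φ₀ := act (pathOp H p') ψ
    let φ₁ := act (O.term j * pathOp H p) ψ
    (r.CT H ^ 2)⁻¹ * (r.g p.1 * r.g p'.1 * pathWeight H p * pathWeight H p') *
      (|O.coeff j| / O.norm1) * (probX φ₀ φ₁ b * probY φ₀ φ₁ b')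

/-- The probability law of one sample. -/
def sampleLaw (r : Round) (H O : PauliSum n) (ψ : State n) :
    Measure (Sample H.numTerms r.Nt O.numTerms) :=
  ((pathBase H.numTerms r.Nt r.T).prod ((pathBase H.numTerms r.Nt r.T).prod
    (Measure.count.prod (Measure.count.prod Measure.count)))).withDensity
      fun x => ENNReal.ofReal (sampleDensity r H O ψ x)

/-- The estimator `Ô` of the imaginary-time correlation of `O`, for a Hamiltonian `H - E₀`. -/
def correlation (r : Round) (H O : PauliSum n) (E₀ : ℝ)
    (x : Fin r.Ns → Sample H.numTerms r.Nt O.numTerms) : ℂ :=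
  (O.norm1 * r.CT H ^ 2 / r.Ns : ℝ) * ∑ l, match x l with
    | (p, p', j, b, b') =>
      (Real.sign (O.coeff j) : ℂ) * Complex.exp (Complex.I * (E₀ * (p.1 - p'.1) : ℝ)) *
        pathPhase H p * (starRingEnd ℂ) (pathPhase H p') *
        ((outcome b : ℂ) + Complex.I * (outcome b' : ℂ))

/-- The samples of one imaginary-time simulation of the energy: `Ns` samples for the numerator
(observable `H`) and `Ns` samples for the denominator (identity observable). -/
abbrev RoundData (r : Round) (H : PauliSum n) :=
  (Fin r.Ns → Sample H.numTerms r.Nt H.numTerms) ×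
    (Fin r.Ns → Sample H.numTerms r.Nt (PauliSum.ident n).numTerms)

/-- All the samples of one imaginary-time simulation are independent. -/
def roundLaw (r : Round) (H : PauliSum n) (ψ : State n) : Measure (RoundData r H) :=
  (Measure.pi fun _ => sampleLaw r H H ψ).prod
    (Measure.pi fun _ => sampleLaw r H (PauliSum.ident n) ψ)

/-- Output of one imaginary-time simulation of the energy. -/
def simulate (r : Round) (H : PauliSum n) (E₀ : ℝ) (x : RoundData r H) : ℂ :=
  correlation r H H E₀ x.1 / correlation r H (PauliSum.ident n) E₀ x.2

/-! ### The iterative ground-state solver -/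

/-- The parameters of a run of the solver: the number of rounds and the inputs of each round. -/
structure Schedule where
  numRounds : ℕ
  round : Fin numRounds → Round

/-- Upper bound on the projection error that holds without a gap, for `α = pb / (1 - pb)`:
`(1 / (2 β)) ln (1 + 1 / (e α))`. -/
def projBound (pb β : ℝ) : ℝ :=
  1 / (2 * β) * Real.log (1 + (1 - pb) / (Real.exp 1 * pb))

/-- Upper bound on the projection error for a gap at least `Δb`, for `α = pb / (1 - pb)`:
`exp(-2 β Δb) Δb / (α + exp(-2 β Δb))`. -/
def gapProjBound (pb Δb β : ℝ) : ℝ :=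
  (1 - pb) * Real.exp (-(2 * β * Δb)) * Δb / (pb + (1 - pb) * Real.exp (-(2 * β * Δb)))

/-- The condition `2 β Δb ≥ 1 + ln (1 + 1 / (e α))` under which `gapProjBound` applies. -/
def GapProjValid (pb Δb β : ℝ) : Prop :=
  1 + Real.log (1 + (1 - pb) / (Real.exp 1 * pb)) ≤ 2 * β * Δb

namespace Schedule

/-- The parameters are meaningful, and the uncertainty is `h_tot` at first and is multiplied by
`3/4` after each round. -/
def IsProper (S : Schedule) (hTot : ℝ) : Prop :=
  ∀ i, (S.round i).δE = (3 / 4 : ℝ) ^ (i : ℕ) * hTot ∧ 0 < (S.round i).β ∧ 0 < (S.round i).τ ∧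
    0 < (S.round i).T ∧ 0 < (S.round i).Nt ∧ 0 < (S.round i).Ns

/-- General case: `β` is such that the gapless bound on the projection error is at most `δE / 2`. -/
def GeneralRule (S : Schedule) (pb : ℝ) : Prop :=
  ∀ i, projBound pb (S.round i).β ≤ (S.round i).δE / 2

/-- Case of a known lower bound `Δb` on the gap: `β` is such that one of the two bounds on the
projection error is at most `δE / 2`. -/
def GapRule (S : Schedule) (pb Δb : ℝ) : Prop :=
  ∀ i, projBound pb (S.round i).β ≤ (S.round i).δE / 2 ∨
    (GapProjValid pb Δb (S.round i).β ∧ gapProjBound pb Δb (S.round i).β ≤ (S.round i).δE / 2)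

/-- The largest Trotter step number of all rounds. -/
def maxTrotter (S : Schedule) : ℕ := Finset.univ.sup fun i => (S.round i).Nt

/-- The total sample size of all rounds. -/
def totalSamples (S : Schedule) : ℕ := ∑ i, (S.round i).Ns

/-- All the random data of a run. -/
abbrev Run (S : Schedule) (H : PauliSum n) := ∀ i, RoundData (S.round i) H

/-- The law of the random data of a run with initial state `ψ`; different rounds use fresh samples.
The law of the samples does not depend on `E₀`, which only enters the classical estimator. -/
def runLaw (S : Schedule) (H : PauliSum n) (ψ : State n) : Measure (S.Run H) :=
  Measure.pi fun i => roundLaw (S.round i) H ψ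

/-- The energy estimate after `i` rounds. It starts from `0`, and each round replaces it by the
result of the imaginary-time simulation with `E₀ = Ê - δE - 1 / β`. -/
def estimate (S : Schedule) (H : PauliSum n) (ω : S.Run H) : ℕ → ℂ
  | 0 => 0
  | i + 1 =>
    if h : i < S.numRounds then
      let r := S.round ⟨i, h⟩
      simulate r H ((S.estimate H ω i).re - r.δE - 1 / r.β) (ω ⟨i, h⟩)
    else S.estimate H ω i

/-- The result of the iterative ground-state solver. -/
def result (S : Schedule) (H : PauliSum n) (ω : S.Run H) : ℂ := S.estimate H ω S.numRounds

end Schedule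

end

end QCMC

namespace QCMC
noncomputable section

/-! ### The Fourier transform of the Lorentz–Gaussian function -/

/-! The sampling formula is exact. In one step the rotations sum to 1 - iHt and the words of length
k sum to the k-th Taylor term, so the weighted sum of all sampled evolutions is e^{-iHt} for every
step number (`hasSum_stepTerm`, `hasSum_pathTerm`). Integrating against g(t) e^{iE₀t} over [-T, T]
turns ψ into A = gT(H - E₀)ψ, where gT is the truncated cosine transform of g
(`inner_evolvedState`). The estimators of numerator and denominator are unbiased for ⟨A, HA⟩ and ⟨A,
A⟩ (`integral_sampleValue`).

With τ = β the full transform of g is the convolution of e^{-|x|} with a Gaussian, evaluated at βω.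
It lies between e^{-3/2} e^{-βω} and 2 e^{-βω} for ω ≥ 0, and truncation costs at most
e^{-T²/(2β²)}. This two-sided comparison is enough, because the energy is a ratio: the excess energy
of A is at most δE/4 once (E - Eg) e^{-2β(E - Eg)} is at most a small multiple of δE at every level
(`projection_bounds`). That holds for β of order 1/δE, or, when a gap bound Δb > δE is known, for β
of order (1/Δb)(1 + ln(Δb/δE)) (`mul_exp_neg_imagTime_le`). Moreover β(Eg - E₀) stays bounded, since
E₀ is within 2δE + 1/β of Eg, so the denominator is bounded below in terms of pb alone.

For the cost, Nt ≥ (h_tot T)² keeps C_T ≤ e² (`CT_le`). Chebyshev's inequality then shows that a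
constant times (h_tot/δE)²/η samples suffice for a round to bring the error from δE to (3/4)δE with
failure probability at most η (`measureReal_simulate_le`). The energy shift of a round depends on
earlier outcomes, but the samples are fresh: Fubini freezes the other rounds and a union bound adds
the failures (`measureReal_estimate_le`). There are O(ln(1/ξ)) rounds, each with η equal to κ
divided by twice their number. This gives both powers of the logarithm in the sample count, while T²
= 2β² · O(ln(1/ξ)) gives the step counts. -/

theorem integral_exp_neg_abs_mul_cexp (s : ℝ) :
    ∫ x : ℝ, ((Real.exp (-|x|) : ℝ) : ℂ) * Complex.exp (-(Complex.I * (x * s))) =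
      2 / (1 + (s : ℂ) ^ 2) := by
  have h1 : ∀ x ∈ Set.Ioi (0 : ℝ), ((Real.exp (-|x|) : ℝ) : ℂ) *
      Complex.exp (-(Complex.I * (x * s))) = Complex.exp ((-1 - Complex.I * s) * x) := by
    intro x hx
    rw [abs_of_pos hx, Complex.ofReal_exp, ← Complex.exp_add]
    congr 1; push_cast; ring
  have h2 : ∀ x ∈ Set.Iic (0 : ℝ), ((Real.exp (-|x|) : ℝ) : ℂ) *
      Complex.exp (-(Complex.I * (x * s))) = Complex.exp ((1 - Complex.I * s) * x) := by
    intro x hx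
    rw [abs_of_nonpos hx, Complex.ofReal_exp, ← Complex.exp_add]
    congr 1; push_cast; ring
  have i1 := (integrableOn_exp_mul_complex_Ioi (a := -1 - Complex.I * s) (by simp) 0)
  have i2 := (integrableOn_exp_mul_complex_Iic (a := 1 - Complex.I * s) (by simp) 0)
  rw [← intervalIntegral.integral_Iic_add_Ioi (b := 0)
    (i2.congr_fun (fun x hx => (h2 x hx).symm) measurableSet_Iic)
    (i1.congr_fun (fun x hx => (h1 x hx).symm) measurableSet_Ioi),
    setIntegral_congr_fun measurableSet_Iic h2, setIntegral_congr_fun measurableSet_Ioi h1,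
    integral_exp_mul_complex_Ioi (by simp), integral_exp_mul_complex_Iic (by simp)]
  have ha : (1 - Complex.I * s : ℂ) ≠ 0 := by
    intro h; have := congrArg Complex.re h; simp at this
  have hb : (-1 - Complex.I * s : ℂ) ≠ 0 := by
    intro h; have := congrArg Complex.re h; simp at this
  have hc : (1 + (s : ℂ) ^ 2) ≠ 0 := by
    norm_cast; positivity
  simp only [Complex.ofReal_zero, mul_zero, Complex.exp_zero]
  field_simp
  ring_nf
  simp [Complex.I_sq]
  ring

theorem integrable_exp_neg_abs : Integrable fun x : ℝ => Real.exp (-|x|) := by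
  have i1 := integrableOn_exp_mul_Ioi (a := -1) (by norm_num) 0
  have i2 := integrableOn_exp_mul_Iic (a := 1) (by norm_num) 0
  rw [← integrableOn_univ, ← Set.Iic_union_Ioi (a := (0 : ℝ))]
  refine (i2.congr_fun (fun x hx => ?_) measurableSet_Iic).union
    (i1.congr_fun (fun x hx => ?_) measurableSet_Ioi)
  · rw [abs_of_nonpos hx]; simp
  · beta_reduce; rw [abs_of_pos hx]; simp

theorem integrable_exp_neg_sq_half : Integrable fun x : ℝ => Real.exp (-(x ^ 2 / 2)) := by
  have := integrable_exp_neg_mul_sq (b := 1 / 2) (by norm_num)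
  refine this.congr (Filter.Eventually.of_forall fun x => ?_)
  simp only; congr 1; ring

theorem integral_exp_neg_sq_half : ∫ x : ℝ, Real.exp (-(x ^ 2 / 2)) = √(2 * Real.pi) := by
  have := integral_gaussian (1 / 2)
  rw [show Real.pi / (1 / 2) = 2 * Real.pi by ring] at this
  rw [← this]
  congr 1; ext x; congr 1; ring

theorem integral_gaussian_mul_cexp (t : ℝ) :
    ∫ s : ℝ, ((Real.exp (-(s ^ 2 / 2)) : ℝ) : ℂ) * Complex.exp (Complex.I * (t * s)) =
      ((√(2 * Real.pi) * Real.exp (-(t ^ 2 / 2)) : ℝ) : ℂ) := by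
  have h := fourierIntegral_gaussian (b := 1 / 2) (by norm_num) (t : ℂ)
  have e : ∀ s : ℝ, ((Real.exp (-(s ^ 2 / 2)) : ℝ) : ℂ) * Complex.exp (Complex.I * (t * s)) =
      Complex.exp (Complex.I * t * s) * Complex.exp (-(1 / 2) * (s : ℂ) ^ 2) := by
    intro s
    rw [mul_comm, Complex.ofReal_exp]
    congr 2 <;> (push_cast; ring)
  simp_rw [e]
  rw [h]
  push_cast
  congr 1
  · rw [show (Real.pi / (1 / 2) : ℂ) = ((2 * Real.pi : ℝ) : ℂ) by push_cast; ring,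
      show (1 / 2 : ℂ) = ((1 / 2 : ℝ) : ℂ) by push_cast; ring,
      ← Complex.ofReal_cpow (by positivity), Real.sqrt_eq_rpow]
  · congr 1; ring

/-- The Lorentzian is the Fourier transform of a multiple of e^{-|x|} and a Gaussian transforms to a
Gaussian, so by Fubini the transform of their product is a convolution. Its integrand is positive,
unlike the oscillating one, and can be bounded pointwise. -/
theorem integral_lorentz_gaussian_cos (y : ℝ) :
    ∫ s : ℝ, 1 / Real.pi * (1 / (1 + s ^ 2)) * Real.exp (-((1 + s ^ 2) / 2)) * Real.cos (s * y) =
      Real.exp (-(1 / 2)) / √(2 * Real.pi) *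
        ∫ x : ℝ, Real.exp (-|x|) * Real.exp (-((y - x) ^ 2 / 2)) := by
  have key : ∫ s : ℝ, (2 / (1 + (s : ℂ) ^ 2)) * (((Real.exp (-(s ^ 2 / 2)) : ℝ) : ℂ) *
        Complex.exp (Complex.I * (y * s))) =
      ((√(2 * Real.pi) * ∫ x : ℝ, Real.exp (-|x|) * Real.exp (-((y - x) ^ 2 / 2)) : ℝ) : ℂ) := by
    have hint : Integrable (fun z : ℝ × ℝ => ((Real.exp (-|z.2|) : ℝ) : ℂ) *
        Complex.exp (-(Complex.I * (z.2 * z.1))) * (((Real.exp (-(z.1 ^ 2 / 2)) : ℝ) : ℂ) *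
        Complex.exp (Complex.I * (y * z.1)))) (volume.prod volume) := by
      have h0 := integrable_exp_neg_sq_half.mul_prod integrable_exp_neg_abs
      refine h0.mono (by fun_prop) (Filter.Eventually.of_forall fun z => ?_)
      have e1 : ‖Complex.exp (-(Complex.I * (z.2 * z.1)))‖ = 1 := by
        rw [show -(Complex.I * (z.2 * z.1 : ℂ)) = ((-(z.2 * z.1) : ℝ) : ℂ) * Complex.I by
          push_cast; ring, Complex.norm_exp_ofReal_mul_I]
      have e2 : ‖Complex.exp (Complex.I * (y * z.1))‖ = 1 := by
        rw [show (Complex.I * (y * z.1 : ℂ)) = ((y * z.1 : ℝ) : ℂ) * Complex.I by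
          push_cast; ring, Complex.norm_exp_ofReal_mul_I]
      rw [norm_mul, norm_mul, norm_mul, e1, e2, Complex.norm_real, Complex.norm_real, norm_mul]
      apply le_of_eq; ring
    calc _ = ∫ s : ℝ, ∫ x : ℝ, ((Real.exp (-|x|) : ℝ) : ℂ) *
        Complex.exp (-(Complex.I * (x * s))) * (((Real.exp (-(s ^ 2 / 2)) : ℝ) : ℂ) *
        Complex.exp (Complex.I * (y * s))) := by
          congr 1; ext s
          rw [integral_mul_const, integral_exp_neg_abs_mul_cexp]
      _ = ∫ x : ℝ, ∫ s : ℝ, ((Real.exp (-|x|) : ℝ) : ℂ) *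
        Complex.exp (-(Complex.I * (x * s))) * (((Real.exp (-(s ^ 2 / 2)) : ℝ) : ℂ) *
        Complex.exp (Complex.I * (y * s))) := integral_integral_swap hint
      _ = ∫ x : ℝ, ((√(2 * Real.pi) * (Real.exp (-|x|) * Real.exp (-((y - x) ^ 2 / 2))) : ℝ) : ℂ) := by
          congr 1; ext x
          have := integral_gaussian_mul_cexp (y - x)
          rw [mul_left_comm, Complex.ofReal_mul, ← this, ← integral_const_mul]
          congr 1; ext s
          have : Complex.exp (Complex.I * (((y - x : ℝ) : ℂ) * s)) =
              Complex.exp (-(Complex.I * (x * s))) * Complex.exp (Complex.I * (y * s)) := by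
            rw [← Complex.exp_add]; congr 1; push_cast; ring
          rw [this]; ring
      _ = _ := by rw [integral_complex_ofReal, integral_const_mul]
  have hre := congrArg Complex.re key
  rw [Complex.ofReal_re, ← RCLike.re_to_complex, ← integral_re] at hre
  · have e : ∀ s : ℝ, 1 / Real.pi * (1 / (1 + s ^ 2)) * Real.exp (-((1 + s ^ 2) / 2)) *
        Real.cos (s * y) = (Real.exp (-(1 / 2)) / (2 * Real.pi)) *
        RCLike.re ((2 / (1 + (s : ℂ) ^ 2)) * (((Real.exp (-(s ^ 2 / 2)) : ℝ) : ℂ) *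
        Complex.exp (Complex.I * (y * s)))) := by
      intro s
      have : (2 / (1 + (s : ℂ) ^ 2)) * (((Real.exp (-(s ^ 2 / 2)) : ℝ) : ℂ) *
        Complex.exp (Complex.I * (y * s))) = ((2 / (1 + s ^ 2) * Real.exp (-(s ^ 2 / 2)) : ℝ) : ℂ) *
          Complex.exp (((s * y : ℝ) : ℂ) * Complex.I) := by
        push_cast
        rw [mul_assoc]; congr 3; ring
      rw [this, RCLike.re_to_complex, Complex.re_ofReal_mul, Complex.exp_ofReal_mul_I_re,
        show -((1 + s ^ 2) / 2) = -(1 / 2) + -(s ^ 2 / 2) by ring, Real.exp_add]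
      have : (1 + s ^ 2) ≠ 0 := by positivity
      field_simp
    simp_rw [e]
    rw [integral_const_mul, hre]
    have h2 : √(2 * Real.pi) ^ 2 = 2 * Real.pi := Real.sq_sqrt (by positivity)
    have h3 : √(2 * Real.pi) ≠ 0 := by positivity
    rw [← mul_assoc]
    congr 1
    field_simp
    linarith
  · have h0 := integrable_exp_neg_sq_half.const_mul 2
    refine h0.mono ?_ (Filter.Eventually.of_forall fun s => ?_)
    · refine Measurable.aestronglyMeasurable ?_
      fun_prop
    · have e2 : ‖Complex.exp (Complex.I * (y * s))‖ = 1 := by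
        rw [show (Complex.I * (y * s : ℂ)) = ((y * s : ℝ) : ℂ) * Complex.I by
          push_cast; ring, Complex.norm_exp_ofReal_mul_I]
      have e3 : (2 / (1 + (s : ℂ) ^ 2)) = ((2 / (1 + s ^ 2) : ℝ) : ℂ) := by push_cast; rfl
      rw [norm_mul, norm_mul, e2, e3, Complex.norm_real, Complex.norm_real, norm_mul, mul_one]
      refine mul_le_mul_of_nonneg_right ?_ (norm_nonneg _)
      rw [Real.norm_of_nonneg (by positivity), Real.norm_of_nonneg (by positivity)]
      exact div_le_self (by norm_num) (by nlinarith [sq_nonneg s])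

theorem integrable_exp_neg_abs_mul_gaussian (y : ℝ) :
    Integrable fun x : ℝ => Real.exp (-|x|) * Real.exp (-((y - x) ^ 2 / 2)) := by
  refine integrable_exp_neg_abs.mono (by fun_prop) (Filter.Eventually.of_forall fun x => ?_)
  rw [norm_mul]
  refine mul_le_of_le_one_right (norm_nonneg _) ?_
  rw [Real.norm_of_nonneg (by positivity), Real.exp_le_one_iff]
  have := sq_nonneg (y - x); linarith

/-- From |x| ≥ y - |y - x|, the factor e^{-|x|} is at most e^{-y}(e^{y-x} + e^{-(y-x)}). Completing
the square turns each summand into e^{1/2} times a Gaussian centred at y ± 1, and e^{1/2} cancels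
the prefactor e^{-1/2}. -/
theorem integral_lorentz_gaussian_cos_le {y : ℝ} :
    ∫ s : ℝ, 1 / Real.pi * (1 / (1 + s ^ 2)) * Real.exp (-((1 + s ^ 2) / 2)) * Real.cos (s * y) ≤
      2 * Real.exp (-y) := by
  rw [integral_lorentz_gaussian_cos]
  have hs : 0 < √(2 * Real.pi) := by positivity
  have ip : ∀ c : ℝ, Integrable fun x : ℝ => Real.exp (-((x - c) ^ 2 / 2)) := fun c =>
    integrable_exp_neg_sq_half.comp_sub_right c
  have iv : ∀ c : ℝ, ∫ x : ℝ, Real.exp (-((x - c) ^ 2 / 2)) = √(2 * Real.pi) := fun c => by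
    rw [integral_sub_right_eq_self (fun x => Real.exp (-(x ^ 2 / 2))) c, integral_exp_neg_sq_half]
  have hb : ∫ x : ℝ, Real.exp (-|x|) * Real.exp (-((y - x) ^ 2 / 2)) ≤
      ∫ x : ℝ, Real.exp (-y) * Real.exp (1 / 2) * (Real.exp (-((x - (y + 1)) ^ 2 / 2)) +
        Real.exp (-((x - (y - 1)) ^ 2 / 2))) := by
    refine integral_mono (integrable_exp_neg_abs_mul_gaussian y)
      (((ip _).add (ip _)).const_mul _) fun x => ?_
    have h1 : -|x| ≤ -y + |y - x| := by
      have := le_abs_self x; have := le_abs_self (y - x); linarith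
    have h2 : Real.exp (-|x|) ≤ Real.exp (-y) * (Real.exp (y - x) + Real.exp (-(y - x))) := by
      refine (Real.exp_le_exp.mpr h1).trans ?_
      rw [Real.exp_add]
      exact mul_le_mul_of_nonneg_left (Real.exp_abs_le _) (by positivity)
    refine (mul_le_mul_of_nonneg_right h2 (by positivity)).trans (le_of_eq ?_)
    simp only [mul_add, add_mul, ← Real.exp_add]
    rw [add_comm]
    congr 2 <;> ring
  rw [integral_const_mul, integral_add (ip _) (ip _), iv, iv] at hb
  calc _ ≤ Real.exp (-(1 / 2)) / √(2 * Real.pi) * (Real.exp (-y) * Real.exp (1 / 2) *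
        (√(2 * Real.pi) + √(2 * Real.pi))) := mul_le_mul_of_nonneg_left hb (by positivity)
    _ = (Real.exp (-(1 / 2)) * Real.exp (1 / 2)) * 2 * Real.exp (-y) := by field_simp; ring
    _ = _ := by rw [← Real.exp_add]; norm_num

/-- Here |x| ≤ y + |x - y| and |x - y| ≤ (1 + (x - y)²)/2 bound the integrand below by e^{-y-1/2}
e^{-(x-y)²}. The exponent 3/2 collects three halves: the prefactor, this e^{-1/2}, and √π/√(2π) ≥
e^{-1/2}. -/
theorem le_integral_lorentz_gaussian_cos {y : ℝ} (hy : 0 ≤ y) :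
    Real.exp (-(3 / 2)) * Real.exp (-y) ≤
    ∫ s : ℝ, 1 / Real.pi * (1 / (1 + s ^ 2)) * Real.exp (-((1 + s ^ 2) / 2)) * Real.cos (s * y) := by
  rw [integral_lorentz_gaussian_cos]
  have hs : 0 < √(2 * Real.pi) := by positivity
  have ip : Integrable fun x : ℝ => Real.exp (-1 * (x - y) ^ 2) :=
    (integrable_exp_neg_mul_sq (b := 1) one_pos).comp_sub_right y
  have iv : ∫ x : ℝ, Real.exp (-1 * (x - y) ^ 2) = √Real.pi := by
    rw [integral_sub_right_eq_self (fun x => Real.exp (-1 * x ^ 2)) y, integral_gaussian, div_one]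
  have hb : ∫ x : ℝ, Real.exp (-y) * Real.exp (-(1 / 2)) * Real.exp (-1 * (x - y) ^ 2) ≤
      ∫ x : ℝ, Real.exp (-|x|) * Real.exp (-((y - x) ^ 2 / 2)) := by
    refine integral_mono (ip.const_mul _) (integrable_exp_neg_abs_mul_gaussian y) fun x => ?_
    simp only [← Real.exp_add]
    apply Real.exp_le_exp.mpr
    have h1 : |x| ≤ y + |x - y| := by
      have := abs_add_le y (x - y); rw [abs_of_nonneg hy] at this
      simpa using this
    have h2 : |x - y| ≤ (1 + (x - y) ^ 2) / 2 := by
      have := sq_abs (x - y); nlinarith [sq_nonneg (|x - y| - 1)]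
    nlinarith
  rw [integral_const_mul, iv] at hb
  have h2 : Real.exp (-(1 / 2)) ≤ √Real.pi / √(2 * Real.pi) := by
    rw [← Real.sqrt_div (by positivity), div_mul_cancel_right₀ Real.pi_ne_zero]
    apply Real.le_sqrt_of_sq_le
    rw [sq, ← Real.exp_add, show (-(1 / 2) + -(1 / 2) : ℝ) = -1 by norm_num, Real.exp_neg]
    have := Real.exp_one_gt_d9
    exact inv_anti₀ (by norm_num) (by linarith)
  calc _ = Real.exp (-(1 / 2)) * (Real.exp (-y) * Real.exp (-(1 / 2))) * Real.exp (-(1 / 2)) := by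
        simp only [← Real.exp_add]; congr 1; ring
    _ ≤ Real.exp (-(1 / 2)) * (Real.exp (-y) * Real.exp (-(1 / 2))) * (√Real.pi / √(2 * Real.pi)) :=
        mul_le_mul_of_nonneg_left h2 (by positivity)
    _ = Real.exp (-(1 / 2)) / √(2 * Real.pi) * (Real.exp (-y) * Real.exp (-(1 / 2)) * √Real.pi) := by
        ring
    _ ≤ _ := mul_le_mul_of_nonneg_left hb (by positivity)

end
end QCMC

namespace QCMC
noncomputable section

/-! ### The weight g, its mass and its truncated cosine transform -/

theorem integrable_lorentz {β : ℝ} (hβ : 0 < β) :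
    Integrable fun t : ℝ => 1 / Real.pi * (β / (β ^ 2 + t ^ 2)) := by
  have h := (integrable_inv_one_add_sq.comp_div hβ.ne').const_mul (1 / Real.pi / β)
  refine h.congr (Filter.Eventually.of_forall fun t => ?_)
  have : β ^ 2 + t ^ 2 ≠ 0 := by positivity
  have : 1 + (t / β) ^ 2 ≠ 0 := by positivity
  field_simp

theorem integral_lorentz {β : ℝ} (hβ : 0 < β) :
    ∫ t : ℝ, 1 / Real.pi * (β / (β ^ 2 + t ^ 2)) = 1 := by
  have e : ∀ t : ℝ, 1 / Real.pi * (β / (β ^ 2 + t ^ 2)) =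
      1 / Real.pi / β * (1 + (t / β) ^ 2)⁻¹ := fun t => by
    have : β ^ 2 + t ^ 2 ≠ 0 := by positivity
    have : 1 + (t / β) ^ 2 ≠ 0 := by positivity
    field_simp
  simp_rw [e]
  rw [integral_const_mul, Measure.integral_comp_div (fun x : ℝ => (1 + x ^ 2)⁻¹) β,
    integral_univ_inv_one_add_sq, abs_of_pos hβ, smul_eq_mul]
  have := Real.pi_ne_zero
  field_simp

namespace Round

variable (r : Round)

theorem g_pos (hβ : 0 < r.β) (t : ℝ) : 0 < r.g t := by
  unfold Round.g; positivity

theorem continuous_g (hβ : 0 < r.β) : Continuous r.g := by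
  unfold Round.g
  have : ∀ t : ℝ, r.β ^ 2 + t ^ 2 ≠ 0 := fun t => by positivity
  fun_prop (disch := assumption)

theorem g_le_lorentz (hβ : 0 < r.β) (t : ℝ) :
    r.g t ≤ 1 / Real.pi * (r.β / (r.β ^ 2 + t ^ 2)) := by
  unfold Round.g
  refine mul_le_of_le_one_right (by positivity) ?_
  rw [Real.exp_le_one_iff, neg_nonpos]
  positivity

theorem integrable_g (hβ : 0 < r.β) : Integrable r.g :=
  (integrable_lorentz hβ).mono' (r.continuous_g hβ).aestronglyMeasurable
    (Filter.Eventually.of_forall fun t => by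
      rw [Real.norm_of_nonneg (r.g_pos hβ t).le]; exact r.g_le_lorentz hβ t)

theorem integral_g_le_one (hβ : 0 < r.β) (hT : 0 ≤ r.T) :
    ∫ t in (-r.T)..r.T, r.g t ≤ 1 := by
  rw [intervalIntegral.integral_of_le (by linarith), ← integral_lorentz hβ]
  calc _ ≤ ∫ t, r.g t := setIntegral_le_integral (r.integrable_g hβ)
        (Filter.Eventually.of_forall fun t => (r.g_pos hβ t).le)
    _ ≤ _ := integral_mono (r.integrable_g hβ) (integrable_lorentz hβ) (r.g_le_lorentz hβ)

/-- The truncated cosine transform of `g`. It is the function of the shifted Hamiltonian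
`H - E₀` that the simulation applies to the initial state. -/
def gT (ω : ℝ) : ℝ := ∫ t in (-r.T)..r.T, r.g t * Real.cos (ω * t)

theorem integrable_g_mul_cos (hβ : 0 < r.β) (ω : ℝ) :
    Integrable fun t => r.g t * Real.cos (ω * t) := by
  have hc := r.continuous_g hβ
  refine (r.integrable_g hβ).mono (by fun_prop) (Filter.Eventually.of_forall fun t => ?_)
  rw [norm_mul]
  exact mul_le_of_le_one_right (norm_nonneg _) (Real.abs_cos_le_one _)

/-- Beyond T the Gaussian factor of g is at most e^{-T²/(2β²)}, and the remaining Lorentzian has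
total mass 1. -/
theorem abs_gT_sub_le (hβ : 0 < r.β) (hτ : r.τ = r.β) (hT : 0 ≤ r.T) (ω : ℝ) :
    |r.gT ω - ∫ t, r.g t * Real.cos (ω * t)| ≤ Real.exp (-(r.T ^ 2 / (2 * r.β ^ 2))) := by
  have hi := r.integrable_g_mul_cos hβ ω
  rw [gT, intervalIntegral.integral_of_le (by linarith), abs_sub_comm, ← Real.norm_eq_abs,
    ← setIntegral_compl measurableSet_Ioc hi]
  have hL := (integrable_lorentz hβ).mul_const (Real.exp (-(r.T ^ 2 / (2 * r.β ^ 2))))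
  calc _ ≤ ∫ t in (Set.Ioc (-r.T) r.T)ᶜ, 1 / Real.pi * (r.β / (r.β ^ 2 + t ^ 2)) *
        Real.exp (-(r.T ^ 2 / (2 * r.β ^ 2))) := by
        refine norm_integral_le_of_norm_le hL.restrict
          ((ae_restrict_iff' measurableSet_Ioc.compl).mpr (Filter.Eventually.of_forall fun t ht => ?_))
        rw [norm_mul, Real.norm_of_nonneg (r.g_pos hβ t).le]
        refine (mul_le_of_le_one_right (r.g_pos hβ t).le (Real.abs_cos_le_one _)).trans ?_
        unfold Round.g
        refine mul_le_mul_of_nonneg_left (Real.exp_le_exp.mpr (neg_le_neg ?_)) (by positivity)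
        rw [hτ]
        refine div_le_div_of_nonneg_right ?_ (by positivity)
        have : r.T ^ 2 ≤ t ^ 2 := by
          rw [Set.mem_compl_iff, Set.mem_Ioc, not_and_or, not_lt, not_le] at ht
          rcases ht with h | h <;> nlinarith
        nlinarith [sq_nonneg r.β]
    _ ≤ ∫ t, 1 / Real.pi * (r.β / (r.β ^ 2 + t ^ 2)) *
        Real.exp (-(r.T ^ 2 / (2 * r.β ^ 2))) :=
        setIntegral_le_integral hL (Filter.Eventually.of_forall fun t => by
          have := hβ; simp only [Pi.zero_apply]; positivity)
    _ = _ := by rw [integral_mul_const, integral_lorentz hβ, one_mul]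

/-- Substitution t = βs. The choice τ = β makes g a rescaling of one fixed function, so its
transform depends on βω only. -/
theorem integral_g_mul_cos (hβ : 0 < r.β) (hτ : r.τ = r.β) (ω : ℝ) :
    ∫ t, r.g t * Real.cos (ω * t) =
      ∫ s : ℝ, 1 / Real.pi * (1 / (1 + s ^ 2)) * Real.exp (-((1 + s ^ 2) / 2)) *
        Real.cos (s * (r.β * ω)) := by
  have h := Measure.integral_comp_mul_left
    (fun t => r.g t * Real.cos (ω * t)) r.β
  rw [abs_of_pos (inv_pos.mpr hβ), smul_eq_mul] at h
  rw [← mul_right_inj' (inv_pos.mpr hβ).ne', ← h, ← integral_const_mul]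
  congr 1; ext s
  unfold Round.g
  rw [hτ, show ω * (r.β * s) = s * (r.β * ω) by ring,
    show -((r.β ^ 2 + (r.β * s) ^ 2) / (2 * r.β ^ 2)) = -((1 + s ^ 2) / 2) by field_simp]
  have h1 : r.β ^ 2 + (r.β * s) ^ 2 ≠ 0 := by positivity
  have h2 : 1 + s ^ 2 ≠ 0 := by positivity
  field_simp

theorem abs_gT_le (hβ : 0 < r.β) (hτ : r.τ = r.β) (hT : 0 ≤ r.T) {ω : ℝ} (hω : 0 ≤ ω) :
    |r.gT ω| ≤ 2 * Real.exp (-(r.β * ω)) + Real.exp (-(r.T ^ 2 / (2 * r.β ^ 2))) := by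
  have h1 := r.abs_gT_sub_le hβ hτ hT ω
  rw [r.integral_g_mul_cos hβ hτ] at h1
  have h2 := integral_lorentz_gaussian_cos_le (y := r.β * ω)
  have h3 := le_integral_lorentz_gaussian_cos (y := r.β * ω) (by positivity)
  have h4 : 0 < Real.exp (-(3 / 2)) * Real.exp (-(r.β * ω)) := by positivity
  rw [abs_le] at h1 ⊢
  constructor <;> linarith [Real.exp_pos (-(r.β * ω))]

/-- With `abs_gT_le`, this says that gT agrees with e^{-βω} up to constant factors and the
truncation error. No closer approximation is needed, because common factors cancel in the energy
ratio. -/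
theorem le_gT (hβ : 0 < r.β) (hτ : r.τ = r.β) (hT : 0 ≤ r.T) {ω : ℝ} (hω : 0 ≤ ω) :
    Real.exp (-(3 / 2)) * Real.exp (-(r.β * ω)) - Real.exp (-(r.T ^ 2 / (2 * r.β ^ 2))) ≤
      r.gT ω := by
  have h1 := r.abs_gT_sub_le hβ hτ hT ω
  rw [r.integral_g_mul_cos hβ hτ] at h1
  have h3 := le_integral_lorentz_gaussian_cos (y := r.β * ω) (by positivity)
  rw [abs_le] at h1
  linarith

/-- `g` is even, so its truncated Fourier transform is real. -/
theorem integral_g_mul_cexp (hβ : 0 < r.β) (ω : ℝ) :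
    ∫ t in (-r.T)..r.T, (r.g t : ℂ) * Complex.exp (-(Complex.I * (ω * t : ℝ))) = r.gT ω := by
  have hc := r.continuous_g hβ
  have hsin : ∫ t in (-r.T)..r.T, r.g t * Real.sin (ω * t) = 0 := by
    have h := intervalIntegral.integral_comp_neg (a := -r.T) (b := r.T)
      (fun t => r.g t * Real.sin (ω * t))
    rw [neg_neg] at h
    have e : ∀ t, r.g (-t) * Real.sin (ω * -t) = -(r.g t * Real.sin (ω * t)) := fun t => by
      rw [mul_neg, Real.sin_neg, Round.g, Round.g, neg_sq]; ring
    simp_rw [e] at h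
    rw [intervalIntegral.integral_neg] at h
    linarith
  have e : ∀ t : ℝ, (r.g t : ℂ) * Complex.exp (-(Complex.I * (ω * t : ℝ))) =
      ((r.g t * Real.cos (ω * t) : ℝ) : ℂ) - Complex.I * ((r.g t * Real.sin (ω * t) : ℝ) : ℂ) := by
    intro t
    rw [show -(Complex.I * ((ω * t : ℝ) : ℂ)) = ((-(ω * t) : ℝ) : ℂ) * Complex.I by
      push_cast; ring, Complex.exp_mul_I, ← Complex.ofReal_cos, ← Complex.ofReal_sin,
      Real.cos_neg, Real.sin_neg]
    push_cast; ring
  simp_rw [e]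
  rw [intervalIntegral.integral_sub (Continuous.intervalIntegrable (by fun_prop) _ _)
    (Continuous.intervalIntegrable (by fun_prop) _ _), intervalIntegral.integral_const_mul,
    intervalIntegral.integral_ofReal, intervalIntegral.integral_ofReal, hsin, gT]
  simp

end Round

end
end QCMC

namespace QCMC
noncomputable section

/-! ### Ordered products of absolutely convergent sums -/

/-- Absolute convergence allows the N-th power of a sum of noncommuting terms to be expanded over
N-tuples. The induction peels off the first letter, which is the rightmost factor. It is used for
the Taylor terms of one step and for the weights and operators of a whole path. -/
theorem hasSum_ofFn_reverse_prod {R α : Type*} [NormedRing R] [CompleteSpace R] {F : α → R} {a : R}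
    (hF : HasSum F a) (hn : Summable fun s => ‖F s‖) (N : ℕ) :
    HasSum (fun S : Fin N → α => (List.ofFn fun l => F (S l)).reverse.prod) (a ^ N) ∧
      Summable fun S : Fin N → α => ‖(List.ofFn fun l => F (S l)).reverse.prod‖ := by
  induction N with
  | zero =>
    constructor
    · simp
    · exact (hasSum_unique _).summable
  | succ N ih =>
    have e : ∀ x : α × (Fin N → α), (List.ofFn fun l =>
        F ((Fin.consEquiv (fun _ : Fin (N + 1) => α)) x l)).reverse.prod =
        (List.ofFn fun l => F (x.2 l)).reverse.prod * F x.1 := by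
      intro x
      simp [List.ofFn_succ, Fin.consEquiv]
    have h1 := ih.2.mul_norm hn
    constructor
    · rw [← (Fin.consEquiv (fun _ : Fin (N + 1) => α)).hasSum_iff,
        ← (Equiv.prodComm _ _).hasSum_iff, pow_succ]
      refine (ih.1.mul hF h1.of_norm).congr_fun fun x => ?_
      exact e _
    · rw [← (Fin.consEquiv (fun _ : Fin (N + 1) => α)).summable_iff,
        ← (Equiv.prodComm _ _).summable_iff]
      refine h1.congr fun x => ?_
      exact (congrArg norm (e (x.2, x.1))).symm

theorem ofFn_smul_reverse_prod {R A : Type*} [CommSemiring R] [Semiring A] [Algebra R A] {N : ℕ}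
    (c : Fin N → R) (X : Fin N → A) :
    (List.ofFn fun l => c l • X l).reverse.prod = (∏ l, c l) • (List.ofFn X).reverse.prod := by
  induction N with
  | zero => simp
  | succ N ih =>
    have := ih (fun l => c l.succ) (fun l => X l.succ)
    simp only [List.ofFn_succ, List.reverse_cons, List.prod_append, List.prod_singleton,
      Fin.prod_univ_succ, this]
    rw [smul_mul_smul_comm, mul_comm]

theorem ofFn_reverse_prod_mem {A : Type*} [Monoid A] (P : Submonoid A) {N : ℕ} {X : Fin N → A}
    (h : ∀ l, X l ∈ P) : (List.ofFn X).reverse.prod ∈ P := by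
  refine list_prod_mem fun x hx => ?_
  rw [List.mem_reverse, List.mem_ofFn] at hx
  obtain ⟨l, rfl⟩ := hx
  exact h l

/-! ### Pauli operators -/

theorem Pauli.conjTranspose_mat (p : Pauli) : p.mat.conjTranspose = p.mat := by
  cases p
  · simp [Pauli.mat]
  all_goals
    ext i j
    fin_cases i <;> fin_cases j <;> simp [Pauli.mat, Matrix.conjTranspose_apply]

theorem Pauli.mat_mul_mat (p : Pauli) : p.mat * p.mat = 1 := by
  cases p
  · simp [Pauli.mat]
  all_goals
    ext i j
    fin_cases i <;> fin_cases j <;> simp [Pauli.mat, Matrix.mul_apply]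

theorem isHermitian_pauliOp {n : ℕ} (p : Fin n → Pauli) : (pauliOp p).IsHermitian := by
  ext x y
  simp only [pauliOp, Matrix.conjTranspose_apply, Matrix.of_apply, star_prod]
  refine Finset.prod_congr rfl fun q _ => ?_
  rw [← Matrix.conjTranspose_apply, Pauli.conjTranspose_mat]

theorem pauliOp_mul_pauliOp {n : ℕ} (p : Fin n → Pauli) : pauliOp p * pauliOp p = 1 := by
  ext x y
  simp only [pauliOp, Matrix.mul_apply, Matrix.of_apply, ← Finset.prod_mul_distrib]
  rw [← Fintype.prod_sum (fun q z => (p q).mat (x q) z * (p q).mat z (y q))]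
  simp_rw [← Matrix.mul_apply, Pauli.mat_mul_mat, Matrix.one_apply]
  by_cases h : x = y
  · simp [h]
  · rw [if_neg h]
    obtain ⟨q, hq⟩ := Function.ne_iff.mp h
    exact Finset.prod_eq_zero (Finset.mem_univ q) (if_neg hq)

theorem pauliOp_I {n : ℕ} : pauliOp (fun _ : Fin n => Pauli.I) = 1 := by
  ext x y
  simp only [pauliOp, Matrix.of_apply, Pauli.mat, Matrix.one_apply]
  by_cases h : x = y
  · simp [h]
  · rw [if_neg h]
    obtain ⟨q, hq⟩ := Function.ne_iff.mp h
    exact Finset.prod_eq_zero (Finset.mem_univ q) (if_neg hq)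

theorem pauliOp_mem_unitaryGroup {n : ℕ} (p : Fin n → Pauli) :
    pauliOp p ∈ Matrix.unitaryGroup (Fin n → Fin 2) ℂ := by
  rw [Matrix.mem_unitaryGroup_iff', Matrix.star_eq_conjTranspose, (isHermitian_pauliOp p).eq,
    pauliOp_mul_pauliOp]

/-! ### The leading-order-rotation formula -/

open scoped Matrix.Norms.L2Operator

theorem exp_I_smul_of_mul_self_eq_one {n : ℕ} {σ : Op n} (hσ : σ * σ = 1) (a : ℝ) :
    NormedSpace.exp ((-(Complex.I * a)) • σ) =
      (Real.cos a : ℂ) • (1 : Op n) - (Complex.I * Real.sin a) • σ := by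
  have hs := NormedSpace.exp_series_hasSum_exp' (𝕂 := ℂ) ((-(Complex.I * a)) • σ)
  have heven : ∀ k, σ ^ (2 * k) = 1 := fun k => by rw [pow_mul, sq, hσ, one_pow]
  have hodd : ∀ k, σ ^ (2 * k + 1) = σ := fun k => by rw [pow_succ, heven, one_mul]
  have h1 := (Complex.hasSum_cos' (-a : ℂ)).smul_const (1 : Op n)
  have h2 := ((Complex.hasSum_sin' (-a : ℂ)).mul_left Complex.I).smul_const σ
  have := HasSum.even_add_odd (f := fun n : ℕ => ((n.factorial : ℂ)⁻¹ • ((-(Complex.I * a)) • σ) ^ n))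
    (h1.congr_fun fun k => by
      rw [smul_pow, heven, smul_smul]; congr 1; rw [div_eq_inv_mul]; congr 2; ring)
    (h2.congr_fun fun k => by
      rw [smul_pow, hodd, smul_smul, mul_div_cancel₀ _ Complex.I_ne_zero]
      congr 1; rw [div_eq_inv_mul]; congr 2; ring)
  rw [hs.unique this, Complex.cos_neg, Complex.sin_neg, ← Complex.ofReal_cos, ← Complex.ofReal_sin,
    mul_neg, neg_smul, sub_eq_add_neg]

theorem exp_I_smul_mem_unitaryGroup {n : ℕ} {σ : Op n} (hσ : σ * σ = 1) (hh : σ.IsHermitian)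
    (a : ℝ) : NormedSpace.exp ((-(Complex.I * a)) • σ) ∈ Matrix.unitaryGroup (Fin n → Fin 2) ℂ := by
  rw [exp_I_smul_of_mul_self_eq_one hσ, Matrix.mem_unitaryGroup_iff', Matrix.star_eq_conjTranspose,
    Matrix.conjTranspose_sub, Matrix.conjTranspose_smul, Matrix.conjTranspose_smul, hh.eq,
    Matrix.conjTranspose_one]
  simp only [star_mul', Complex.star_def, Complex.conj_ofReal, Complex.conj_I, mul_sub, sub_mul,
    smul_mul_smul_comm, hσ, mul_one, one_mul]
  rw [sub_sub_eq_add_sub]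
  have h := congrArg (fun x : ℝ => (x : ℂ)) (Real.sin_sq_add_cos_sq a)
  push_cast at h
  have e : ((Real.cos a : ℂ) * (Complex.I * Real.sin a)) • σ =
      -(((-Complex.I * Real.sin a) * Real.cos a) • σ) := by
    rw [← neg_smul]; congr 1; ring
  have hX : ((Real.cos a : ℂ) * Real.cos a) • (1 : Op n) +
      (-Complex.I * Real.sin a * (Complex.I * Real.sin a)) • (1 : Op n) = 1 := by
    rw [← add_smul]
    convert one_smul ℂ (1 : Op n) using 2
    push_cast
    linear_combination h - Complex.sin a ^ 2 * Complex.I_sq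
  rw [e]
  refine Eq.trans ?_ hX
  abel

variable {n : ℕ}

theorem PauliSum.term_mul_term (H : PauliSum n) (j : Fin H.numTerms) : H.term j * H.term j = 1 :=
  pauliOp_mul_pauliOp _

theorem PauliSum.isHermitian_term (H : PauliSum n) (j : Fin H.numTerms) :
    (H.term j).IsHermitian := isHermitian_pauliOp _

theorem PauliSum.isHermitian_op (H : PauliSum n) : H.op.IsHermitian := by
  unfold Matrix.IsHermitian PauliSum.op
  rw [Matrix.conjTranspose_sum]
  refine Finset.sum_congr rfl fun j _ => ?_
  rw [Matrix.conjTranspose_smul, (H.isHermitian_term j).eq, Complex.star_def, Complex.conj_ofReal]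

theorem stepOp_mem_unitaryGroup (H : PauliSum n) (t : ℝ) (s : Step H.numTerms) :
    stepOp H t s ∈ Matrix.unitaryGroup (Fin n → Fin 2) ℂ := by
  cases s with
  | rot j => exact exp_I_smul_mem_unitaryGroup (H.term_mul_term j) (H.isHermitian_term j) _
  | word k js => exact ofFn_reverse_prod_mem _ fun _ => pauliOp_mem_unitaryGroup _

theorem pathOp_mem_unitaryGroup {Nt : ℕ} (H : PauliSum n) (p : Path H.numTerms Nt) :
    pathOp H p ∈ Matrix.unitaryGroup (Fin n → Fin 2) ℂ :=
  ofFn_reverse_prod_mem _ fun _ => stepOp_mem_unitaryGroup H _ _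

theorem stepWeight_nonneg (H : PauliSum n) (t : ℝ) (s : Step H.numTerms) :
    0 ≤ stepWeight H t s := by
  have : 0 ≤ H.norm1 := Finset.sum_nonneg fun j _ => abs_nonneg _
  cases s with
  | rot j => unfold stepWeight; positivity
  | word k js =>
    exact div_nonneg (Finset.prod_nonneg fun a _ => abs_nonneg _) (by positivity)

/-- The labels of a step, as a disjoint union. -/
def stepEquiv (M : ℕ) : Fin M ⊕ (Σ k : ℕ, Fin (k + 2) → Fin M) ≃ Step M where
  toFun
    | .inl j => .rot j
    | .inr ⟨k, js⟩ => .word k js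
  invFun
    | .rot j => .inl j
    | .word k js => .inr ⟨k, js⟩
  left_inv := by rintro (j | ⟨k, js⟩) <;> rfl
  right_inv := by rintro (j | ⟨k, js⟩) <;> rfl

instance (M : ℕ) : Countable (Step M) := (stepEquiv M).symm.injective.countable

theorem hasSum_step {E : Type*} [NormedAddCommGroup E] [CompleteSpace E] {M : ℕ} {f : Step M → E}
    {g : ℕ → E} {b : E} (hg : HasSum g b)
    (hf : ∀ k, HasSum (fun js : Fin (k + 2) → Fin M => f (.word k js)) (g k))
    (hs : Summable fun x : Σ k : ℕ, Fin (k + 2) → Fin M => f (.word x.1 x.2)) :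
    HasSum f ((∑ j, f (.rot j)) + b) := by
  rw [← (stepEquiv M).hasSum_iff]
  refine HasSum.sum (hasSum_fintype _) ?_
  exact HasSum.sigma_of_hasSum hg hf hs

/-- Words of length k contribute (h|t|)^k / k! by expanding a power of the sum of all |h_j t|; with
k ≥ 2 this is the exponential series without its first two terms. The rotations contribute the
square root, because the |h_j|/h sum to 1. -/
theorem hasSum_stepWeight (H : PauliSum n) (hH : 0 < H.norm1) (t : ℝ) :
    HasSum (stepWeight H t) (weightSum H t) := by
  have e : ∀ k : ℕ, ∑ js : Fin (k + 2) → Fin H.numTerms, stepWeight H t (.word k js) =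
      (H.norm1 * |t|) ^ (k + 2) / ((k + 2).factorial : ℝ) := by
    intro k
    simp only [stepWeight]
    rw [← Finset.sum_div, ← Fintype.sum_pow (fun j => |H.coeff j * t|)]
    simp_rw [abs_mul]
    rw [← Finset.sum_mul]; rfl
  have hexp : HasSum (fun k : ℕ => (H.norm1 * |t|) ^ (k + 2) / ((k + 2).factorial : ℝ))
      (Real.exp (H.norm1 * |t|) - (1 + H.norm1 * |t|)) := by
    have h := NormedSpace.exp_series_hasSum_exp' (𝕂 := ℝ) (H.norm1 * |t|)
    rw [← congrFun Real.exp_eq_exp_ℝ, ← hasSum_nat_add_iff' 2] at h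
    simpa [Finset.sum_range_succ, div_eq_inv_mul] using h
  have hs : Summable fun x : Σ k : ℕ, Fin (k + 2) → Fin H.numTerms =>
      stepWeight H t (.word x.1 x.2) := by
    rw [summable_sigma_of_nonneg fun x => stepWeight_nonneg H t _]
    refine ⟨fun k => (hasSum_fintype _).summable, ?_⟩
    simp_rw [tsum_fintype, e]
    exact hexp.summable
  have h := hasSum_step hexp (fun k => by rw [← e]; exact hasSum_fintype _) hs
  have e2 : weightSum H t = (∑ j, stepWeight H t (.rot j)) +
      (Real.exp (H.norm1 * |t|) - (1 + H.norm1 * |t|)) := by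
    simp only [stepWeight, weightSum]
    rw [← Finset.sum_mul, ← Finset.sum_div, ← PauliSum.norm1, div_self hH.ne']
    ring
  rw [e2]; exact h

theorem norm_le_one_of_mem_unitaryGroup {A : Op n}
    (hA : A ∈ Matrix.unitaryGroup (Fin n → Fin 2) ℂ) : ‖A‖ ≤ 1 :=
  (CStarRing.norm_of_mem_unitary hA).le

theorem norm_I_mul_sign_le (x : ℝ) : ‖(-Complex.I * (Real.sign x : ℝ) : ℂ)‖ ≤ 1 := by
  rcases Real.sign_apply_eq x with h | h | h <;> simp [h]

theorem norm_stepPhase_le (H : PauliSum n) (t : ℝ) (s : Step H.numTerms) :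
    ‖stepPhase H t s‖ ≤ 1 := by
  cases s with
  | rot j => simp [stepPhase]
  | word k js =>
    simp only [stepPhase, norm_prod]
    exact Finset.prod_le_one (fun _ _ => norm_nonneg _) fun _ _ => norm_I_mul_sign_le _

theorem norm_stepTerm_le (H : PauliSum n) (t : ℝ) (s : Step H.numTerms) :
    ‖((stepWeight H t s : ℂ) * stepPhase H t s) • stepOp H t s‖ ≤ stepWeight H t s := by
  rw [norm_smul, norm_mul, Complex.norm_real, Real.norm_of_nonneg (stepWeight_nonneg H t s),
    mul_assoc]
  exact mul_le_of_le_one_right (stepWeight_nonneg H t s) (mul_le_one₀ (norm_stepPhase_le H t s)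
    (norm_nonneg _) (norm_le_one_of_mem_unitaryGroup (stepOp_mem_unitaryGroup H t s)))

/-- The angle has tangent h|t|, so its cosine is 1/√(1 + h²t²) and its sine is h|t|/√(1 + h²t²). The
weight cancels the root, leaving (|h_j|/h)·1 - i h_j t σ_j: the rotations produce exactly the Taylor
terms of degree 0 and 1. -/
theorem sum_rot_terms (H : PauliSum n) (hH : 0 < H.norm1) (t : ℝ) :
    ∑ j, ((stepWeight H t (.rot j) : ℂ) * stepPhase H t (.rot j)) • stepOp H t (.rot j) =
      1 + (-(Complex.I * t)) • H.op := by
  have hsq : 0 < √(1 + (H.norm1 * |t|) ^ 2) := by positivity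
  have e : ∀ j, ((stepWeight H t (.rot j) : ℂ) * stepPhase H t (.rot j)) • stepOp H t (.rot j) =
      ((|H.coeff j| / H.norm1 : ℝ) : ℂ) • (1 : Op n) +
        (-(Complex.I * t)) • ((H.coeff j : ℂ) • H.term j) := by
    intro j
    simp only [stepWeight, stepPhase, stepOp, mul_one]
    rw [exp_I_smul_of_mul_self_eq_one (H.term_mul_term j), smul_sub, smul_smul, smul_smul,
      smul_smul, rotAngle]
    rcases lt_trichotomy (H.coeff j * t) 0 with h | h | h
    · rw [Real.sign_of_neg h, neg_one_mul, Real.cos_neg, Real.sin_neg, Real.cos_arctan,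
        Real.sin_arctan, sub_eq_add_neg, ← neg_smul]
      have ha : |H.coeff j| * |t| = -(H.coeff j * t) := by rw [← abs_mul, abs_of_neg h]
      congr 2
      · rw [← Complex.ofReal_mul]; congr 1; field_simp
      · have : |H.coeff j| / H.norm1 * √(1 + (H.norm1 * |t|) ^ 2) *
            (-(H.norm1 * |t| / √(1 + (H.norm1 * |t|) ^ 2))) = H.coeff j * t := by
          field_simp; linarith
        have := congrArg (fun x : ℝ => (x : ℂ)) this
        push_cast at this ⊢
        linear_combination (-Complex.I) * this
    -- `Real.sign 0 = 0` makes the rotation the identity here, which is consistent both for t = 0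
    -- and for a vanishing coefficient.
    · have ht : |H.coeff j| * |t| = 0 := by rw [← abs_mul, h, abs_zero]
      rcases mul_eq_zero.mp h with h0 | h0 <;> simp [h0]
    · rw [Real.sign_of_pos h, one_mul, Real.cos_arctan,
        Real.sin_arctan, sub_eq_add_neg, ← neg_smul]
      have ha : |H.coeff j| * |t| = H.coeff j * t := by rw [← abs_mul, abs_of_pos h]
      congr 2
      · rw [← Complex.ofReal_mul]; congr 1; field_simp
      · have : |H.coeff j| / H.norm1 * √(1 + (H.norm1 * |t|) ^ 2) *
            (H.norm1 * |t| / √(1 + (H.norm1 * |t|) ^ 2)) = H.coeff j * t := by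
          field_simp; linarith
        have := congrArg (fun x : ℝ => (x : ℂ)) this
        push_cast at this ⊢
        linear_combination (-Complex.I) * this
  simp_rw [e]
  rw [Finset.sum_add_distrib, ← Finset.sum_smul, ← Finset.smul_sum, ← Complex.ofReal_sum,
    ← Finset.sum_div, ← PauliSum.norm1, div_self hH.ne', Complex.ofReal_one, one_smul]
  rfl

/-- Weight times phase restores the scalar -i h_j t of each letter, even where it vanishes and the
phase is set to 0. -/
theorem stepTerm_word (H : PauliSum n) (t : ℝ) (k : ℕ) (js : Fin (k + 2) → Fin H.numTerms) :
    ((stepWeight H t (.word k js) : ℂ) * stepPhase H t (.word k js)) • stepOp H t (.word k js) =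
      ((k + 2).factorial : ℂ)⁻¹ • (List.ofFn fun l =>
        (-(Complex.I * t)) • ((H.coeff (js l) : ℂ) • H.term (js l))).reverse.prod := by
  simp only [stepWeight, stepPhase, stepOp, smul_smul]
  rw [ofFn_smul_reverse_prod (fun l => -(Complex.I * t) * (H.coeff (js l) : ℂ))
    (fun l => H.term (js l)), smul_smul]
  congr 1
  push_cast
  rw [div_eq_inv_mul, mul_assoc, ← Finset.prod_mul_distrib]
  congr 1
  refine Finset.prod_congr rfl fun l _ => ?_
  have : |H.coeff (js l) * t| * Real.sign (H.coeff (js l) * t) = H.coeff (js l) * t := by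
    rcases lt_trichotomy (H.coeff (js l) * t) 0 with h | h | h
    · rw [Real.sign_of_neg h, abs_of_neg h]; ring
    · simp [h]
    · rw [Real.sign_of_pos h, abs_of_pos h]; ring
  have := congrArg (fun x : ℝ => (x : ℂ)) this
  push_cast at this ⊢
  linear_combination (-Complex.I) * this

/-- The rotations give degrees 0 and 1 of the exponential series and the words of length k + 2 give
degree k + 2. Hence the formula has no Trotter error. -/
theorem hasSum_stepTerm (H : PauliSum n) (hH : 0 < H.norm1) (t : ℝ) :
    HasSum (fun s => ((stepWeight H t s : ℂ) * stepPhase H t s) • stepOp H t s)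
      (NormedSpace.exp ((-(Complex.I * t)) • H.op)) := by
  have hs : Summable fun s => ((stepWeight H t s : ℂ) * stepPhase H t s) • stepOp H t s :=
    (hasSum_stepWeight H hH t).summable.of_norm_bounded (norm_stepTerm_le H t)
  have hexp := NormedSpace.exp_series_hasSum_exp' (𝕂 := ℂ) ((-(Complex.I * t)) • H.op)
  rw [← hasSum_nat_add_iff' 2] at hexp
  have hinj : Function.Injective fun x : Σ k : ℕ, Fin (k + 2) → Fin H.numTerms =>
      Step.word x.1 x.2 := by
    rintro ⟨k, js⟩ ⟨k', js'⟩ h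
    simp only [Step.word.injEq] at h
    obtain ⟨rfl, h⟩ := h
    rw [eq_of_heq h]
  have h := hasSum_step (f := fun s => ((stepWeight H t s : ℂ) * stepPhase H t s) • stepOp H t s)
    hexp (fun k => by
      simp only [stepTerm_word]
      have hX : HasSum (fun j => (-(Complex.I * t)) • ((H.coeff j : ℂ) • H.term j))
          ((-(Complex.I * t)) • H.op) := by
        rw [PauliSum.op, Finset.smul_sum]; exact hasSum_fintype _
      exact (hasSum_ofFn_reverse_prod hX (hasSum_fintype _).summable (k + 2)).1.const_smul _)
    (hs.comp_injective hinj)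
  rw [sum_rot_terms H hH] at h
  simpa [Finset.sum_range_succ] using h

theorem hasSum_pathWeight {Nt : ℕ} (H : PauliSum n) (hH : 0 < H.norm1) (t : ℝ) :
    HasSum (fun S : Fin Nt → Step H.numTerms => pathWeight H (t, S))
      (weightSum H (t / Nt) ^ Nt) := by
  have h := hasSum_stepWeight H hH (t / Nt)
  have h2 := (hasSum_ofFn_reverse_prod h (h.summable.congr fun s =>
    (Real.norm_of_nonneg (stepWeight_nonneg H _ s)).symm) Nt).1
  refine h2.congr_fun fun S => ?_
  rw [List.prod_reverse, List.prod_ofFn]; rfl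

/-- Exact steps compose to the exact evolution, for every positive `Nt`. The step number therefore
never enters the bias; it only controls the normalisation C_T and hence the statistical error. -/
theorem hasSum_pathTerm {Nt : ℕ} (hNt : 0 < Nt) (H : PauliSum n) (hH : 0 < H.norm1) (t : ℝ) :
    HasSum (fun S : Fin Nt → Step H.numTerms =>
      ((pathWeight H (t, S) : ℂ) * pathPhase H (t, S)) • pathOp H (t, S))
      (NormedSpace.exp ((-(Complex.I * t)) • H.op)) := by
  have h := hasSum_stepTerm H hH (t / Nt)
  have hn : Summable fun s => ‖((stepWeight H (t / Nt) s : ℂ) * stepPhase H (t / Nt) s) •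
      stepOp H (t / Nt) s‖ :=
    Summable.of_nonneg_of_le (fun _ => norm_nonneg _) (norm_stepTerm_le H _)
      (hasSum_stepWeight H hH _).summable
  have h2 := (hasSum_ofFn_reverse_prod h hn Nt).1
  rw [← Matrix.exp_nsmul, ← Nat.cast_smul_eq_nsmul ℂ, smul_smul] at h2
  have e : (Nt : ℂ) * (-(Complex.I * ((t / Nt : ℝ) : ℂ))) = -(Complex.I * t) := by
    have : (Nt : ℂ) ≠ 0 := Nat.cast_ne_zero.mpr hNt.ne'
    push_cast; field_simp
  rw [e] at h2
  refine h2.congr_fun fun S => ?_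
  rw [ofFn_smul_reverse_prod, Finset.prod_mul_distrib]
  simp [pathWeight, pathPhase, pathOp]

end
end QCMC

namespace QCMC
noncomputable section
open scoped Matrix.Norms.L2Operator
variable {n : ℕ}

/-! ### Operators acting on states -/

/-- The action on a fixed state, as a linear map in the operator. -/
def actLin (ψ : State n) : Op n →ₗ[ℂ] State n :=
  (LinearMap.applyₗ ψ).comp (Matrix.toEuclideanLin (𝕜 := ℂ)).toLinearMap

theorem actLin_apply (A : Op n) (ψ : State n) : actLin ψ A = act A ψ := rfl

theorem continuous_act (ψ : State n) : Continuous fun A : Op n => act A ψ :=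
  (actLin ψ).continuous_of_finiteDimensional

theorem act_mul (A B : Op n) (ψ : State n) : act (A * B) ψ = act A (act B ψ) := by
  simp [act, Matrix.toLpLin_apply, Matrix.mulVec_mulVec]

theorem act_one (ψ : State n) : act (1 : Op n) ψ = ψ := by
  simp [act]

theorem act_smul (c : ℂ) (A : Op n) (ψ : State n) : act (c • A) ψ = c • act A ψ :=
  (actLin ψ).map_smul c A

theorem act_sum {ι : Type*} (s : Finset ι) (A : ι → Op n) (ψ : State n) :
    act (∑ i ∈ s, A i) ψ = ∑ i ∈ s, act (A i) ψ :=
  map_sum (actLin ψ) A s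

theorem act_smul_right (c : ℂ) (A : Op n) (ψ : State n) : act A (c • ψ) = c • act A ψ :=
  (Matrix.toEuclideanLin A).map_smul c ψ

theorem inner_act (A : Op n) (φ ψ : State n) :
    inner ℂ φ (act A ψ) = inner ℂ (act A.conjTranspose φ) ψ := by
  rw [act, act, Matrix.toEuclideanLin_conjTranspose_eq_adjoint, LinearMap.adjoint_inner_left]

theorem norm_act_of_mem_unitaryGroup {A : Op n} (hA : A ∈ Matrix.unitaryGroup (Fin n → Fin 2) ℂ)
    (ψ : State n) : ‖act A ψ‖ = ‖ψ‖ := by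
  rw [Matrix.mem_unitaryGroup_iff', Matrix.star_eq_conjTranspose] at hA
  have h : inner ℂ (act A ψ) (act A ψ) = inner ℂ ψ ψ := by
    rw [inner_act, ← act_mul, hA, act_one]
  rw [@norm_eq_sqrt_re_inner ℂ, @norm_eq_sqrt_re_inner ℂ, h]

theorem act_exp_of_act_eq_smul {X : Op n} {μ : ℂ} {v : State n} (h : act X v = μ • v) :
    act (NormedSpace.exp X) v = Complex.exp μ • v := by
  have hp : ∀ k : ℕ, act (X ^ k) v = μ ^ k • v := by
    intro k
    induction k with
    | zero => simp [act_one]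
    | succ k ih => rw [pow_succ, act_mul, h, act_smul_right, ih, smul_smul, pow_succ']
  have h1 := (NormedSpace.exp_series_hasSum_exp' (𝕂 := ℂ) X).mapL
    ((actLin v).toContinuousLinearMap)
  have h2 := (NormedSpace.exp_series_hasSum_exp' (𝕂 := ℂ) μ).smul_const v
  rw [← congrFun Complex.exp_eq_exp_ℂ] at h2
  refine h1.unique (h2.congr_fun fun k => ?_)
  change actLin v _ = _
  rw [actLin_apply, act_smul, hp, smul_smul, smul_eq_mul]

/-! ### The Hadamard test -/

theorem probX_eq {φ₀ φ₁ : State n} (h₀ : ‖φ₀‖ = 1) (h₁ : ‖φ₁‖ = 1) (b : Bool) :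
    probX φ₀ φ₁ b = (1 + outcome b * (inner ℂ φ₀ φ₁ : ℂ).re) / 2 := by
  have ho : ‖(outcome b : ℂ)‖ = 1 := by cases b <;> simp [outcome]
  rw [probX, norm_smul, mul_pow, @norm_add_sq ℂ, norm_smul, h₀, h₁, ho, inner_smul_right,
    RCLike.re_to_complex, Complex.re_ofReal_mul]
  norm_num
  ring

theorem probY_eq {φ₀ φ₁ : State n} (h₀ : ‖φ₀‖ = 1) (h₁ : ‖φ₁‖ = 1) (b : Bool) :
    probY φ₀ φ₁ b = (1 + outcome b * (inner ℂ φ₀ φ₁ : ℂ).im) / 2 := by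
  have ho : ‖(outcome b : ℂ)‖ = 1 := by cases b <;> simp [outcome]
  rw [probY, norm_smul, mul_pow, @norm_sub_sq ℂ, norm_smul, norm_mul, h₀, h₁, ho,
    inner_smul_right, RCLike.re_to_complex, mul_assoc, Complex.re_ofReal_mul]
  norm_num
  ring

theorem probX_nonneg (φ₀ φ₁ : State n) (b : Bool) : 0 ≤ probX φ₀ φ₁ b := sq_nonneg _

theorem probY_nonneg (φ₀ φ₁ : State n) (b : Bool) : 0 ≤ probY φ₀ φ₁ b := sq_nonneg _

theorem sum_hadamard {φ₀ φ₁ : State n} (h₀ : ‖φ₀‖ = 1) (h₁ : ‖φ₁‖ = 1) :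
    ∑ b, ∑ b', probX φ₀ φ₁ b * probY φ₀ φ₁ b' = 1 := by
  simp [probX_eq h₀ h₁, probY_eq h₀ h₁, outcome]
  ring

theorem sum_hadamard_mul_outcome {φ₀ φ₁ : State n} (h₀ : ‖φ₀‖ = 1) (h₁ : ‖φ₁‖ = 1) :
    ∑ b, ∑ b', ((probX φ₀ φ₁ b * probY φ₀ φ₁ b' : ℝ) : ℂ) *
      ((outcome b : ℂ) + Complex.I * (outcome b' : ℂ)) = inner ℂ φ₀ φ₁ := by
  simp [probX_eq h₀ h₁, probY_eq h₀ h₁, outcome]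
  conv_rhs => rw [← Complex.re_add_im (inner ℂ φ₀ φ₁)]
  ring

theorem prob_le_one {φ₀ φ₁ : State n} (h₀ : ‖φ₀‖ = 1) (h₁ : ‖φ₁‖ = 1) (b b' : Bool) :
    probX φ₀ φ₁ b * probY φ₀ φ₁ b' ≤ 1 := by
  rw [← sum_hadamard h₀ h₁]
  have hn : ∀ b b', 0 ≤ probX φ₀ φ₁ b * probY φ₀ φ₁ b' := fun b b' =>
    mul_nonneg (probX_nonneg _ _ _) (probY_nonneg _ _ _)
  refine (Finset.single_le_sum (fun i _ => hn b i) (Finset.mem_univ b')).trans ?_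
  exact Finset.single_le_sum (f := fun b => ∑ b', probX φ₀ φ₁ b * probY φ₀ φ₁ b')
    (fun i _ => Finset.sum_nonneg fun j _ => hn i j) (Finset.mem_univ b)

/-! ### Measurability in the sampled evolution -/

theorem measurable_sign : Measurable Real.sign := by
  unfold Real.sign
  exact Measurable.ite measurableSet_Iio measurable_const
    (Measurable.ite measurableSet_Ioi measurable_const measurable_const)

theorem stronglyMeasurable_stepOp (H : PauliSum n) (s : Step H.numTerms) :
    StronglyMeasurable fun t => stepOp H t s := by
  cases s with
  | rot j =>
    have hc : Continuous fun a : ℝ => NormedSpace.exp ((-(Complex.I * (a : ℂ))) • H.term j) := by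
      simp_rw [exp_I_smul_of_mul_self_eq_one (H.term_mul_term j)]
      fun_prop
    refine hc.comp_stronglyMeasurable (Measurable.stronglyMeasurable ?_)
    have := measurable_sign
    unfold rotAngle
    exact (this.comp (measurable_const_mul _)).mul (by fun_prop)
  | word k js => exact stronglyMeasurable_const

theorem measurable_stepWeight (H : PauliSum n) (s : Step H.numTerms) :
    Measurable fun t => stepWeight H t s := by
  cases s with
  | rot j => simp only [stepWeight]; fun_prop
  | word k js => simp only [stepWeight]; fun_prop

theorem measurable_stepPhase (H : PauliSum n) (s : Step H.numTerms) :
    Measurable fun t => stepPhase H t s := by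
  cases s with
  | rot j => exact measurable_const
  | word k js =>
    simp only [stepPhase]
    refine Finset.measurable_prod _ fun a _ => ?_
    have h : Measurable fun t => Real.sign (H.coeff (js a) * t) :=
      measurable_sign.comp (measurable_const_mul _)
    exact measurable_const.mul (Complex.measurable_ofReal.comp h)

variable {Nt : ℕ}

/-- There are countably many label sequences, so measurability in t for each fixed one suffices. -/
theorem measurable_pathWeight (H : PauliSum n) :
    Measurable fun p : Path H.numTerms Nt => pathWeight H p := by
  refine measurable_from_prod_countable_left fun S => ?_
  simp only [pathWeight]
  exact Finset.measurable_prod _ fun l _ =>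
    (measurable_stepWeight H (S l)).comp (measurable_id.div_const _)

theorem measurable_pathPhase (H : PauliSum n) :
    Measurable fun p : Path H.numTerms Nt => pathPhase H p := by
  refine measurable_from_prod_countable_left fun S => ?_
  simp only [pathPhase]
  exact Finset.measurable_prod _ fun l _ =>
    (measurable_stepPhase H (S l)).comp (measurable_id.div_const _)

theorem measurable_act_pathOp (H : PauliSum n) (ψ : State n) :
    Measurable fun p : Path H.numTerms Nt => act (pathOp H p) ψ := by
  refine measurable_from_prod_countable_left fun S => ?_
  refine ((continuous_act ψ).comp_stronglyMeasurable ?_).measurable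
  simp only [pathOp]
  have h := List.stronglyMeasurable_prod
    (List.ofFn fun l : Fin Nt => fun t : ℝ => stepOp H (t / Nt) (S l)).reverse (fun f hf => by
      rw [List.mem_reverse, List.mem_ofFn] at hf
      obtain ⟨l, rfl⟩ := hf
      exact (stronglyMeasurable_stepOp H (S l)).comp_measurable (measurable_id.div_const _))
  convert h using 1
  ext1 t
  rw [Pi.list_prod_apply, List.map_reverse, List.map_ofFn]
  rfl

theorem norm_pathPhase_le (H : PauliSum n) (p : Path H.numTerms Nt) : ‖pathPhase H p‖ ≤ 1 := by
  simp only [pathPhase, norm_prod]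
  exact Finset.prod_le_one (fun _ _ => norm_nonneg _) fun _ _ => norm_stepPhase_le _ _ _

theorem pathWeight_nonneg (H : PauliSum n) (p : Path H.numTerms Nt) : 0 ≤ pathWeight H p :=
  Finset.prod_nonneg fun _ _ => stepWeight_nonneg _ _ _

theorem one_le_weightSum (H : PauliSum n) (t : ℝ) : 1 ≤ weightSum H t := by
  have h1 : 1 ≤ √(1 + (H.norm1 * |t|) ^ 2) := by
    rw [Real.one_le_sqrt]; linarith [sq_nonneg (H.norm1 * |t|)]
  have h2 := Real.add_one_le_exp (H.norm1 * |t|)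
  unfold weightSum; linarith

theorem continuous_weightSum (H : PauliSum n) : Continuous (weightSum H) := by
  unfold weightSum; fun_prop

end
end QCMC

namespace QCMC
noncomputable section
open scoped Matrix.Norms.L2Operator
variable {n : ℕ}

/-! ### Integration over sampled evolutions -/

theorem integral_count_of_summable {α E : Type*} [MeasurableSpace α] [MeasurableSingletonClass α]
    [Countable α] [NormedAddCommGroup E] [NormedSpace ℝ E] [CompleteSpace E] {f : α → E}
    (hf : Summable fun x => ‖f x‖) : ∫ x, f x ∂Measure.count = ∑' x, f x := by
  rw [integral_countable (integrable_count_iff.mpr hf)]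
  simp [measureReal_def]

/-- The parameters of a round are meaningful and its Gaussian width equals its imaginary time. -/
structure Round.Admissible (r : Round) : Prop where
  β_pos : 0 < r.β
  τ_eq : r.τ = r.β
  T_pos : 0 < r.T
  Nt_pos : 0 < r.Nt
  Ns_pos : 0 < r.Ns

/-- The density of a sampled evolution, up to the normalisation `C_T`. -/
def pathDensity (r : Round) (H : PauliSum n) (p : Path H.numTerms r.Nt) : ℝ :=
  r.g p.1 * pathWeight H p

/-- The contribution `g(t) e^{i E₀ t} w_S(t) e^{i θ_S(t)} U_S(t) ψ` of a sampled evolution. -/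
def pathState (r : Round) (H : PauliSum n) (E₀ : ℝ) (ψ : State n) (p : Path H.numTerms r.Nt) :
    State n :=
  ((pathDensity r H p : ℂ) * Complex.exp (Complex.I * (E₀ * p.1 : ℝ)) * pathPhase H p) •
    act (pathOp H p) ψ

variable {r : Round}

theorem pathDensity_nonneg (hr : r.Admissible) (H : PauliSum n) (p : Path H.numTerms r.Nt) :
    0 ≤ pathDensity r H p :=
  mul_nonneg (r.g_pos hr.β_pos _).le (pathWeight_nonneg H p)

theorem measurable_pathDensity (hr : r.Admissible) (H : PauliSum n) :
    Measurable (pathDensity r H) :=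
  ((r.continuous_g hr.β_pos).measurable.comp measurable_fst).mul (measurable_pathWeight H)

theorem hasSum_pathDensity (H : PauliSum n) (hH : 0 < H.norm1) (t : ℝ) :
    HasSum (fun S => pathDensity r H (t, S)) (r.g t * weightSum H (t / r.Nt) ^ r.Nt) :=
  (hasSum_pathWeight H hH t).mul_left (r.g t)

theorem integral_count_pathDensity (hr : r.Admissible) (H : PauliSum n) (hH : 0 < H.norm1)
    (t : ℝ) : ∫ S, pathDensity r H (t, S) ∂Measure.count =
      r.g t * weightSum H (t / r.Nt) ^ r.Nt := by
  have h := hasSum_pathDensity (r := r) H hH t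
  rw [integral_count_of_summable, h.tsum_eq]
  exact h.summable.congr fun S => (Real.norm_of_nonneg (pathDensity_nonneg hr H _)).symm

theorem continuous_g_mul_weightSum (hr : r.Admissible) (H : PauliSum n) :
    Continuous fun t => r.g t * weightSum H (t / r.Nt) ^ r.Nt := by
  have h1 := r.continuous_g hr.β_pos
  have h2 := continuous_weightSum H
  fun_prop

theorem integrable_pathDensity (hr : r.Admissible) (H : PauliSum n) (hH : 0 < H.norm1) :
    Integrable (pathDensity r H) (pathBase H.numTerms r.Nt r.T) := by
  rw [pathBase, integrable_prod_iff (measurable_pathDensity hr H).aestronglyMeasurable]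
  have hn : ∀ p, ‖pathDensity r H p‖ = pathDensity r H p := fun p =>
    Real.norm_of_nonneg (pathDensity_nonneg hr H p)
  constructor
  · refine Filter.Eventually.of_forall fun t => ?_
    rw [integrable_count_iff]
    simp_rw [hn]
    exact (hasSum_pathDensity H hH t).summable
  · simp_rw [hn, integral_count_pathDensity hr H hH]
    exact (continuous_g_mul_weightSum hr H).continuousOn.integrableOn_compact isCompact_Icc

theorem integral_pathDensity (hr : r.Admissible) (H : PauliSum n) (hH : 0 < H.norm1) :
    ∫ p, pathDensity r H p ∂pathBase H.numTerms r.Nt r.T = r.CT H := by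
  have hi := integrable_pathDensity hr H hH
  rw [pathBase] at hi ⊢
  rw [integral_prod _ hi]
  simp_rw [integral_count_pathDensity hr H hH]
  rw [integral_Icc_eq_integral_Ioc, Round.CT, intervalIntegral.integral_of_le
    (by linarith [hr.T_pos])]

theorem CT_pos (hr : r.Admissible) (H : PauliSum n) : 0 < r.CT H := by
  rw [Round.CT]
  refine intervalIntegral.intervalIntegral_pos_of_pos
    ((continuous_g_mul_weightSum hr H).intervalIntegrable _ _) (fun t => ?_)
    (by linarith [hr.T_pos])
  exact mul_pos (r.g_pos hr.β_pos t) (pow_pos (one_pos.trans_le (one_le_weightSum H _)) _)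

theorem measurable_pathState (hr : r.Admissible) (H : PauliSum n) (E₀ : ℝ) (ψ : State n) :
    Measurable (pathState r H E₀ ψ) := by
  have h1 := measurable_pathDensity hr H
  have h2 := measurable_pathPhase (Nt := r.Nt) H
  have h3 := measurable_act_pathOp (Nt := r.Nt) H ψ
  unfold pathState
  fun_prop

theorem norm_cexp_I_mul (x : ℝ) : ‖Complex.exp (Complex.I * (x : ℂ))‖ = 1 := by
  rw [mul_comm, Complex.norm_exp_ofReal_mul_I]

theorem norm_pathState_le (hr : r.Admissible) (H : PauliSum n) (E₀ : ℝ) {ψ : State n}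
    (hψ : ‖ψ‖ = 1) (p : Path H.numTerms r.Nt) : ‖pathState r H E₀ ψ p‖ ≤ pathDensity r H p := by
  rw [pathState, norm_smul, norm_act_of_mem_unitaryGroup (pathOp_mem_unitaryGroup H p), hψ,
    norm_mul, norm_mul, norm_cexp_I_mul, Complex.norm_real,
    Real.norm_of_nonneg (pathDensity_nonneg hr H p), mul_one, mul_one]
  exact mul_le_of_le_one_right (pathDensity_nonneg hr H p) (norm_pathPhase_le H p)

theorem integrable_pathState (hr : r.Admissible) (H : PauliSum n) (hH : 0 < H.norm1) (E₀ : ℝ)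
    {ψ : State n} (hψ : ‖ψ‖ = 1) :
    Integrable (pathState r H E₀ ψ) (pathBase H.numTerms r.Nt r.T) :=
  (integrable_pathDensity hr H hH).mono' (measurable_pathState hr H E₀ ψ).aestronglyMeasurable
    (Filter.Eventually.of_forall (norm_pathState_le hr H E₀ hψ))

/-- The state `∫_{-T}^T g(t) e^{i E₀ t} e^{-i H t} ψ dt`. -/
def evolvedState (r : Round) (H : PauliSum n) (E₀ : ℝ) (ψ : State n) : State n :=
  ∫ p, pathState r H E₀ ψ p ∂pathBase H.numTerms r.Nt r.T

theorem act_op_eigenvectorBasis (H : PauliSum n) (k : Fin n → Fin 2) :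
    act H.op (H.isHermitian_op.eigenvectorBasis k) =
      (H.isHermitian_op.eigenvalues k : ℂ) • H.isHermitian_op.eigenvectorBasis k := by
  rw [act, Matrix.toLpLin_apply, H.isHermitian_op.mulVec_eigenvectorBasis]
  ext i
  simp

theorem inner_act_exp (H : PauliSum n) (t : ℝ) {v : State n} {E : ℝ}
    (hv : act H.op v = (E : ℂ) • v) (ψ : State n) :
    inner ℂ v (act (NormedSpace.exp ((-(Complex.I * t)) • H.op)) ψ) =
      Complex.exp (-(Complex.I * (E * t : ℝ))) * inner ℂ v ψ := by
  have h : act ((Complex.I * t) • H.op) v = (Complex.I * t * E) • v := by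
    rw [act_smul, hv, smul_smul]
  rw [inner_act, ← Matrix.exp_conjTranspose, Matrix.conjTranspose_smul, H.isHermitian_op.eq]
  have e : star (-(Complex.I * t)) = Complex.I * t := by simp
  rw [e, act_exp_of_act_eq_smul h, inner_smul_left, ← Complex.exp_conj]
  congr 2
  simp
  ring

/-- This is the identity A = gT(H - E₀)ψ, read off on an eigenvector. The sum over labels collapses
to e^{-iHt} by `hasSum_pathTerm`, the eigenvector turns that into the phase e^{-iEt}, and the
remaining integral over t is the transform of g at E - E₀. -/
theorem inner_evolvedState (hr : r.Admissible) (H : PauliSum n) (hH : 0 < H.norm1) (E₀ : ℝ)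
    {ψ : State n} (hψ : ‖ψ‖ = 1) {v : State n} {E : ℝ} (hv : act H.op v = (E : ℂ) • v) :
    inner ℂ v (evolvedState r H E₀ ψ) = (r.gT (E - E₀) : ℂ) * inner ℂ v ψ := by
  have hi := (integrable_pathState hr H hH E₀ hψ).const_inner v (𝕜 := ℂ)
  rw [evolvedState, ← integral_inner (integrable_pathState hr H hH E₀ hψ)]
  rw [pathBase] at hi ⊢
  rw [integral_prod _ hi]
  have e : ∀ t : ℝ, ∫ S, inner ℂ v (pathState r H E₀ ψ (t, S)) ∂Measure.count =
      (r.g t : ℂ) * Complex.exp (-(Complex.I * ((E - E₀) * t : ℝ))) * inner ℂ v ψ := by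
    intro t
    have h1 := hasSum_pathTerm hr.Nt_pos H hH t
    have h2 := (h1.mapL (actLin ψ).toContinuousLinearMap).mapL (innerSL ℂ v)
    have h3 := h2.mul_left ((r.g t : ℂ) * Complex.exp (Complex.I * (E₀ * t : ℝ)))
    rw [integral_count_of_summable]
    · refine (HasSum.tsum_eq (h3.congr_fun fun S => ?_)).trans ?_
      · change _ = _ * inner ℂ v (actLin ψ _)
        rw [actLin_apply, act_smul, inner_smul_right, pathState, inner_smul_right, pathDensity]
        push_cast
        ring
      · change _ * inner ℂ v (actLin ψ _) = _
        rw [actLin_apply, inner_act_exp H t hv, ← mul_assoc]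
        congr 1
        rw [mul_assoc, ← Complex.exp_add]
        congr 2
        push_cast
        ring
    · refine Summable.of_nonneg_of_le (fun _ => norm_nonneg _) (fun S => ?_)
        ((hasSum_pathDensity (r := r) H hH t).summable.mul_left ‖v‖)
      exact (norm_inner_le_norm _ _).trans (mul_le_mul_of_nonneg_left
        (norm_pathState_le hr H E₀ hψ _) (norm_nonneg _))
  simp_rw [e]
  rw [integral_mul_const, integral_Icc_eq_integral_Ioc, ← intervalIntegral.integral_of_le
    (by linarith [hr.T_pos]), r.integral_g_mul_cexp hr.β_pos]

end
end QCMC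

namespace QCMC
noncomputable section
open scoped Matrix.Norms.L2Operator
variable {n : ℕ}

/-! ### The law of one sample -/

/-- The reference measure of one sample. -/
def sampleBase (M Nt K : ℕ) (T : ℝ) : Measure (Sample M Nt K) :=
  (pathBase M Nt T).prod ((pathBase M Nt T).prod
    (Measure.count.prod (Measure.count.prod Measure.count)))

instance (M Nt : ℕ) (T : ℝ) : SigmaFinite (pathBase M Nt T) := by
  unfold pathBase; infer_instance

instance (M Nt K : ℕ) (T : ℝ) : SigmaFinite (sampleBase M Nt K T) := by
  unfold sampleBase; infer_instance

theorem sampleLaw_eq (r : Round) (H O : PauliSum n) (ψ : State n) :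
    sampleLaw r H O ψ = (sampleBase H.numTerms r.Nt O.numTerms r.T).withDensity
      fun x => ENNReal.ofReal (sampleDensity r H O ψ x) := rfl

theorem measurable_sample {M Nt K : ℕ} {γ : Type*} [MeasurableSpace γ] {f : Sample M Nt K → γ}
    (hf : ∀ y, Measurable fun q : Path M Nt × Path M Nt => f (q.1, q.2, y)) : Measurable f := by
  have h : Measurable fun z : (Path M Nt × Path M Nt) × (Fin K × Bool × Bool) =>
      f (z.1.1, z.1.2, z.2) := measurable_from_prod_countable_left hf
  have e : Measurable fun x : Sample M Nt K => ((x.1, x.2.1), x.2.2) := by fun_prop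
  exact h.comp e

theorem integral_sampleBase {M Nt K : ℕ} {T : ℝ} {f : Sample M Nt K → ℂ}
    (hf : Integrable f (sampleBase M Nt K T)) :
    ∫ x, f x ∂sampleBase M Nt K T = ∫ p, ∫ p', ∑ j, ∑ b, ∑ b', f (p, p', j, b, b')
      ∂pathBase M Nt T ∂pathBase M Nt T := by
  rw [sampleBase] at hf ⊢
  rw [integral_prod _ hf]
  refine integral_congr_ae ?_
  filter_upwards [hf.prod_right_ae] with p hp
  rw [integral_prod _ hp]
  congr 1; ext p'
  rw [integral_prod _ Integrable.of_finite, integral_count]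
  refine Finset.sum_congr rfl fun j _ => ?_
  rw [integral_prod _ Integrable.of_finite, integral_count]
  simp_rw [integral_count]

/-- The contribution of one sample to the estimator. -/
def sampleValue (r : Round) (H O : PauliSum n) (E₀ : ℝ) (x : Sample H.numTerms r.Nt O.numTerms) :
    ℂ :=
  match x with
  | (p, p', j, b, b') =>
    (Real.sign (O.coeff j) : ℂ) * Complex.exp (Complex.I * (E₀ * (p.1 - p'.1) : ℝ)) *
      pathPhase H p * (starRingEnd ℂ) (pathPhase H p') *
      ((outcome b : ℂ) + Complex.I * (outcome b' : ℂ))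

theorem correlation_eq (r : Round) (H O : PauliSum n) (E₀ : ℝ)
    (x : Fin r.Ns → Sample H.numTerms r.Nt O.numTerms) :
    correlation r H O E₀ x =
      (O.norm1 * r.CT H ^ 2 / r.Ns : ℝ) * ∑ l, sampleValue r H O E₀ (x l) := rfl

theorem norm_sampleValue_le (r : Round) (H O : PauliSum n) (E₀ : ℝ)
    (x : Sample H.numTerms r.Nt O.numTerms) : ‖sampleValue r H O E₀ x‖ ≤ 2 := by
  obtain ⟨p, p', j, b, b'⟩ := x
  have h1 : ‖(Real.sign (O.coeff j) : ℂ)‖ ≤ 1 := by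
    rcases Real.sign_apply_eq (O.coeff j) with h | h | h <;> simp [h]
  have h2 : ‖(outcome b : ℂ) + Complex.I * (outcome b' : ℂ)‖ ≤ 2 := by
    refine (norm_add_le _ _).trans ?_
    cases b <;> cases b' <;> norm_num [outcome]
  simp only [sampleValue, norm_mul, norm_cexp_I_mul, RCLike.norm_conj, mul_one]
  have h3 := norm_pathPhase_le H p
  have h4 := norm_pathPhase_le H p'
  have h5 := mul_le_one₀ (mul_le_one₀ h1 (norm_nonneg _) h3) (norm_nonneg _) h4
  calc _ ≤ 1 * ‖(outcome b : ℂ) + Complex.I * (outcome b' : ℂ)‖ :=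
        mul_le_mul_of_nonneg_right h5 (norm_nonneg _)
    _ ≤ 2 := by rwa [one_mul]

theorem measurable_prod_sample {M Nt K : ℕ} {γ : Type*} [MeasurableSpace γ]
    {f : ℝ → Sample M Nt K → γ}
    (hf : ∀ y, Measurable fun q : ℝ × Path M Nt × Path M Nt => f q.1 (q.2.1, q.2.2, y)) :
    Measurable fun z : ℝ × Sample M Nt K => f z.1 z.2 := by
  have h : Measurable fun z : (ℝ × Path M Nt × Path M Nt) × (Fin K × Bool × Bool) =>
      f z.1.1 (z.1.2.1, z.1.2.2, z.2) := measurable_from_prod_countable_left hf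
  have e : Measurable fun z : ℝ × Sample M Nt K => ((z.1, z.2.1, z.2.2.1), z.2.2.2) := by fun_prop
  exact h.comp e

/-- Joint measurability in the energy shift is needed, because the shift of a round is itself a
function of earlier random data. -/
theorem measurable_sampleValue_uncurry (r : Round) (H O : PauliSum n) :
    Measurable fun z : ℝ × Sample H.numTerms r.Nt O.numTerms => sampleValue r H O z.1 z.2 := by
  refine measurable_prod_sample fun y => ?_
  obtain ⟨j, b, b'⟩ := y
  simp only [sampleValue]
  have h2 : Measurable fun z : ℝ × Path H.numTerms r.Nt × Path H.numTerms r.Nt =>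
      pathPhase H z.2.1 := (measurable_pathPhase H).comp (measurable_fst.comp measurable_snd)
  have h3 : Measurable fun z : ℝ × Path H.numTerms r.Nt × Path H.numTerms r.Nt =>
      (starRingEnd ℂ) (pathPhase H z.2.2) :=
    RCLike.continuous_conj.measurable.comp
      ((measurable_pathPhase H).comp (measurable_snd.comp measurable_snd))
  have h4 : Measurable fun z : ℝ × Path H.numTerms r.Nt × Path H.numTerms r.Nt =>
      Complex.exp (Complex.I * (z.1 * (z.2.1.1 - z.2.2.1) : ℝ)) := by fun_prop
  exact (((h4.const_mul _).mul h2).mul h3).mul_const _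

theorem measurable_sampleValue (r : Round) (H O : PauliSum n) (E₀ : ℝ) :
    Measurable fun x => sampleValue r H O E₀ x := by
  have h := measurable_sampleValue_uncurry r H O
  generalize sampleValue r H O = f at h ⊢
  exact h.comp measurable_prodMk_left

variable {r : Round}

theorem continuous_act_right (A : Op n) : Continuous (act A) :=
  (Matrix.toEuclideanLin A).continuous_of_finiteDimensional

theorem measurable_sampleDensity (hr : r.Admissible) (H O : PauliSum n) (ψ : State n) :
    Measurable (sampleDensity r H O ψ) := by
  refine measurable_sample fun y => ?_
  obtain ⟨j, b, b'⟩ := y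
  have h1 := r.continuous_g hr.β_pos
  have h2 := measurable_pathWeight (Nt := r.Nt) H
  have h3 : Measurable fun q : Path H.numTerms r.Nt × Path H.numTerms r.Nt =>
    act (pathOp H q.2) ψ := (measurable_act_pathOp H ψ).comp measurable_snd
  have h4 : Measurable fun q : Path H.numTerms r.Nt × Path H.numTerms r.Nt =>
      act (O.term j * pathOp H q.1) ψ := by
    simp_rw [act_mul]
    exact (continuous_act_right _).measurable.comp
      ((measurable_act_pathOp H ψ).comp measurable_fst)
  simp only [sampleDensity, probX, probY]
  fun_prop

theorem norm_act_pathOp (H : PauliSum n) {ψ : State n} (hψ : ‖ψ‖ = 1) {Nt : ℕ}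
    (p : Path H.numTerms Nt) : ‖act (pathOp H p) ψ‖ = 1 := by
  rw [norm_act_of_mem_unitaryGroup (pathOp_mem_unitaryGroup H p), hψ]

theorem norm_act_term_mul_pathOp (H O : PauliSum n) {ψ : State n} (hψ : ‖ψ‖ = 1) {Nt : ℕ}
    (j : Fin O.numTerms) (p : Path H.numTerms Nt) : ‖act (O.term j * pathOp H p) ψ‖ = 1 := by
  rw [act_mul, norm_act_of_mem_unitaryGroup (A := O.term j) (pauliOp_mem_unitaryGroup _), norm_act_pathOp H hψ]

theorem sampleDensity_eq (H O : PauliSum n) (ψ : State n) (p p' : Path H.numTerms r.Nt)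
    (j : Fin O.numTerms) (b b' : Bool) : sampleDensity r H O ψ (p, p', j, b, b') =
      (r.CT H ^ 2)⁻¹ * (pathDensity r H p * pathDensity r H p') * (|O.coeff j| / O.norm1) *
        (probX (act (pathOp H p') ψ) (act (O.term j * pathOp H p) ψ) b *
          probY (act (pathOp H p') ψ) (act (O.term j * pathOp H p) ψ) b') := by
  simp only [sampleDensity, pathDensity]; ring

theorem PauliSum.norm1_nonneg (O : PauliSum n) : 0 ≤ O.norm1 :=
  Finset.sum_nonneg fun _ _ => abs_nonneg _

theorem sampleDensity_nonneg (hr : r.Admissible) (H O : PauliSum n) (ψ : State n)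
    (x : Sample H.numTerms r.Nt O.numTerms) : 0 ≤ sampleDensity r H O ψ x := by
  obtain ⟨p, p', j, b, b'⟩ := x
  rw [sampleDensity_eq]
  have h1 := pathDensity_nonneg hr H p
  have h2 := pathDensity_nonneg hr H p'
  have h3 := O.norm1_nonneg
  have h4 := probX_nonneg (act (pathOp H p') ψ) (act (O.term j * pathOp H p) ψ) b
  have h5 := probY_nonneg (act (pathOp H p') ψ) (act (O.term j * pathOp H p) ψ) b'
  positivity

theorem integrable_sampleDensity (hr : r.Admissible) (H O : PauliSum n) (hH : 0 < H.norm1)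
    {ψ : State n} (hψ : ‖ψ‖ = 1) :
    Integrable (sampleDensity r H O ψ) (sampleBase H.numTerms r.Nt O.numTerms r.T) := by
  have hG := integrable_pathDensity hr H hH
  have h1 : Integrable (fun _ : Fin O.numTerms × Bool × Bool => (1 : ℝ))
      (Measure.count.prod (Measure.count.prod Measure.count)) := Integrable.of_finite
  have h2 := (hG.mul_prod (hG.mul_prod h1)).const_mul (r.CT H ^ 2)⁻¹
  refine h2.mono' (measurable_sampleDensity hr H O ψ).aestronglyMeasurable
    (Filter.Eventually.of_forall fun x => ?_)
  rw [Real.norm_of_nonneg (sampleDensity_nonneg hr H O ψ x)]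
  obtain ⟨p, p', j, b, b'⟩ := x
  rw [sampleDensity_eq, mul_assoc ((r.CT H ^ 2)⁻¹ * _)]
  have h3 : |O.coeff j| / O.norm1 ≤ 1 :=
    div_le_one_of_le₀ (Finset.single_le_sum (f := fun j => |O.coeff j|)
      (fun _ _ => abs_nonneg _) (Finset.mem_univ j)) O.norm1_nonneg
  have h4 := prob_le_one (norm_act_pathOp H hψ p') (norm_act_term_mul_pathOp H O hψ j p) b b'
  have h5 := pathDensity_nonneg hr H p
  have h6 := pathDensity_nonneg hr H p'
  refine (mul_le_of_le_one_right (by positivity) (mul_le_one₀ h3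
    (mul_nonneg (probX_nonneg _ _ _) (probY_nonneg _ _ _)) h4)).trans (le_of_eq ?_)
  simp only [mul_one]

theorem integrable_sampleDensity_mul (hr : r.Admissible) (H O : PauliSum n) (hH : 0 < H.norm1)
    {ψ : State n} (hψ : ‖ψ‖ = 1) (E₀ : ℝ) :
    Integrable (fun x => (sampleDensity r H O ψ x : ℂ) * sampleValue r H O E₀ x)
      (sampleBase H.numTerms r.Nt O.numTerms r.T) :=
  (integrable_sampleDensity hr H O hH hψ).ofReal.mul_bdd
    (measurable_sampleValue r H O E₀).aestronglyMeasurable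
    (Filter.Eventually.of_forall (norm_sampleValue_le r H O E₀))

theorem integral_sampleDensity (hr : r.Admissible) (H O : PauliSum n) (hH : 0 < H.norm1)
    (hO : 0 < O.norm1) {ψ : State n} (hψ : ‖ψ‖ = 1) :
    ∫ x, sampleDensity r H O ψ x ∂sampleBase H.numTerms r.Nt O.numTerms r.T = 1 := by
  have hi : Integrable (fun x => (sampleDensity r H O ψ x : ℂ))
      (sampleBase H.numTerms r.Nt O.numTerms r.T) :=
    (integrable_sampleDensity hr H O hH hψ).ofReal
  have h := integral_sampleBase hi
  have e : ∀ p p', ∑ j, ∑ b, ∑ b', (sampleDensity r H O ψ (p, p', j, b, b') : ℂ) =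
      ((r.CT H ^ 2)⁻¹ : ℝ) * (pathDensity r H p : ℂ) * (pathDensity r H p' : ℂ) := by
    intro p p'
    norm_cast
    have e1 : ∀ j, ∑ b, ∑ b', sampleDensity r H O ψ (p, p', j, b, b') =
        (r.CT H ^ 2)⁻¹ * (pathDensity r H p * pathDensity r H p') *
          (|O.coeff j| / O.norm1) := by
      intro j
      have h1 := sum_hadamard (norm_act_pathOp H hψ p') (norm_act_term_mul_pathOp H O hψ j p)
      rw [← mul_one ((r.CT H ^ 2)⁻¹ * _ * _), ← h1]
      simp_rw [sampleDensity_eq, Finset.mul_sum]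
    simp_rw [e1]
    rw [← Finset.mul_sum, ← Finset.sum_div, ← PauliSum.norm1, div_self hO.ne']
    ring
  simp_rw [e] at h
  rw [integral_complex_ofReal] at h
  simp_rw [integral_const_mul, integral_complex_ofReal, integral_pathDensity hr H hH,
    integral_mul_const, integral_const_mul, integral_complex_ofReal,
    integral_pathDensity hr H hH] at h
  norm_cast at h
  rw [h]
  have := (CT_pos hr H).ne'
  field_simp

theorem isProbabilityMeasure_sampleLaw (hr : r.Admissible) (H O : PauliSum n) (hH : 0 < H.norm1)
    (hO : 0 < O.norm1) {ψ : State n} (hψ : ‖ψ‖ = 1) :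
    IsProbabilityMeasure (sampleLaw r H O ψ) := by
  constructor
  rw [sampleLaw_eq, withDensity_apply _ MeasurableSet.univ, Measure.restrict_univ,
    ← ofReal_integral_eq_lintegral_ofReal (integrable_sampleDensity hr H O hH hψ)
      (Filter.Eventually.of_forall (sampleDensity_nonneg hr H O ψ)),
    integral_sampleDensity hr H O hH hO hψ, ENNReal.ofReal_one]

/-- For fixed paths, the Hadamard test averages to the matrix element of O_j, and |a_j| sgn(a_j) =
a_j rebuilds the operator. The result is sesquilinear in one vector per path, so the double integral
over paths will factorise. -/
theorem sum_sampleDensity_mul (H O : PauliSum n) {ψ : State n}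
    (hψ : ‖ψ‖ = 1) (E₀ : ℝ) (p p' : Path H.numTerms r.Nt) :
    ∑ j, ∑ b, ∑ b', (sampleDensity r H O ψ (p, p', j, b, b') : ℂ) *
        sampleValue r H O E₀ (p, p', j, b, b') =
      ((O.norm1 * r.CT H ^ 2 : ℝ) : ℂ)⁻¹ *
        inner ℂ (pathState r H E₀ ψ p') (act O.op (pathState r H E₀ ψ p)) := by
  have hs : ∀ a : ℝ, |a| * Real.sign a = a := fun a => by
    rcases lt_trichotomy a 0 with h | h | h
    · rw [Real.sign_of_neg h, abs_of_neg h]; ring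
    · simp [h]
    · rw [Real.sign_of_pos h, abs_of_pos h]; ring
  have e1 : ∀ j b b', (sampleDensity r H O ψ (p, p', j, b, b') : ℂ) *
        sampleValue r H O E₀ (p, p', j, b, b') =
      (((O.norm1 * r.CT H ^ 2 : ℝ) : ℂ)⁻¹ * (pathDensity r H p * pathDensity r H p') *
        Complex.exp (Complex.I * (E₀ * (p.1 - p'.1) : ℝ)) *
        pathPhase H p * (starRingEnd ℂ) (pathPhase H p') * O.coeff j) *
      (((probX (act (pathOp H p') ψ) (act (O.term j * pathOp H p) ψ) b *
          probY (act (pathOp H p') ψ) (act (O.term j * pathOp H p) ψ) b' : ℝ) : ℂ) *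
        ((outcome b : ℂ) + Complex.I * (outcome b' : ℂ))) := by
    intro j b b'
    rw [sampleDensity_eq]
    conv_rhs => rw [← hs (O.coeff j)]
    simp only [sampleValue]
    push_cast
    rw [mul_inv]
    ring
  simp_rw [e1, ← Finset.mul_sum, sum_hadamard_mul_outcome (norm_act_pathOp H hψ p')
    (norm_act_term_mul_pathOp H O hψ _ p)]
  rw [PauliSum.op, act_sum]
  simp only [act_smul]
  simp only [inner_sum, pathState, act_smul_right, inner_smul_right, inner_smul_left,
    map_mul, Complex.conj_ofReal, ← act_mul]
  rw [Finset.mul_sum]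
  refine Finset.sum_congr rfl fun j _ => ?_
  have e2 : Complex.exp (Complex.I * (E₀ * (p.1 - p'.1) : ℝ)) =
      (starRingEnd ℂ) (Complex.exp (Complex.I * (E₀ * p'.1 : ℝ))) *
        Complex.exp (Complex.I * (E₀ * p.1 : ℝ)) := by
    rw [← Complex.exp_conj, ← Complex.exp_add]
    congr 1
    simp only [map_mul, Complex.conj_I, Complex.conj_ofReal]
    push_cast
    ring
  rw [e2]
  ring

/-- Unbiasedness: both path integrals move inside the inner product, and the factor a_O C_T² in the
estimator cancels the normalisation. -/
theorem integral_sampleValue (hr : r.Admissible) (H O : PauliSum n) (hH : 0 < H.norm1)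
    {ψ : State n} (hψ : ‖ψ‖ = 1) (E₀ : ℝ) :
    ∫ x, sampleValue r H O E₀ x ∂sampleLaw r H O ψ =
      ((O.norm1 * r.CT H ^ 2 : ℝ) : ℂ)⁻¹ *
        inner ℂ (evolvedState r H E₀ ψ) (act O.op (evolvedState r H E₀ ψ)) := by
  rw [sampleLaw_eq, integral_withDensity_eq_integral_toReal_smul
    (measurable_sampleDensity hr H O ψ).ennreal_ofReal
    (Filter.Eventually.of_forall fun _ => ENNReal.ofReal_lt_top)]
  simp_rw [ENNReal.toReal_ofReal (sampleDensity_nonneg hr H O ψ _), Complex.real_smul]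
  rw [integral_sampleBase (integrable_sampleDensity_mul hr H O hH hψ E₀)]
  simp_rw [sum_sampleDensity_mul H O hψ]
  have hi := integrable_pathState hr H hH E₀ hψ
  have hO' := ((Matrix.toEuclideanLin O.op).toContinuousLinearMap).integrable_comp hi
  have h1 : ∀ w : State n, ∫ p', inner ℂ (pathState r H E₀ ψ p') w
      ∂pathBase H.numTerms r.Nt r.T = inner ℂ (evolvedState r H E₀ ψ) w := by
    intro w
    simp_rw [← inner_conj_symm _ w]
    rw [integral_conj, integral_inner hi]
    rfl
  simp_rw [integral_const_mul, h1]
  congr 1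
  refine (integral_inner hO' _).trans ?_
  rw [ContinuousLinearMap.integral_comp_comm _ hi]
  rfl

end
end QCMC

namespace QCMC
noncomputable section
open scoped Matrix.Norms.L2Operator
variable {n : ℕ}

/-! ### Statistical error of the estimators -/

/-- Chebyshev's inequality: variances of independent coordinates add and each is at most B². This is
the origin of the 1/κ in the sample count. -/
theorem measureReal_pi_abs_sum_sub_ge_le {α : Type*} [MeasurableSpace α] {μ : Measure α}
    [IsProbabilityMeasure μ] {X : α → ℝ} (hX : Measurable X) {B : ℝ} (hB : ∀ x, |X x| ≤ B)
    {N : ℕ} {c : ℝ} (hc : 0 < c) :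
    (Measure.pi fun _ : Fin N => μ).real {x | c ≤ |∑ l, X (x l) - N * ∫ y, X y ∂μ|} ≤
      N * B ^ 2 / c ^ 2 := by
  have hmem : MemLp X 2 μ := MemLp.of_bound hX.aestronglyMeasurable B
    (Filter.Eventually.of_forall hB)
  have hcoord : ∀ l : Fin N, MemLp (fun x : Fin N → α => X (x l)) 2 (Measure.pi fun _ => μ) :=
    fun l => hmem.comp_measurePreserving (measurePreserving_eval (fun _ => μ) l)
  have hsum : MemLp (fun x : Fin N → α => ∑ l, X (x l)) 2 (Measure.pi fun _ => μ) :=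
    memLp_finsetSum _ fun l _ => hcoord l
  have hmean : ∫ x, ∑ l, X (x l) ∂(Measure.pi fun _ : Fin N => μ) = N * ∫ y, X y ∂μ := by
    rw [integral_finsetSum _ fun l _ => (hcoord l).integrable (by norm_num)]
    have : ∀ l : Fin N, ∫ x, X (x l) ∂(Measure.pi fun _ : Fin N => μ) = ∫ y, X y ∂μ := fun l =>
      integral_comp_eval (μ := fun _ => μ) (i := l) hX.aestronglyMeasurable
    simp [this]
  have hvar : ProbabilityTheory.variance (fun x : Fin N → α => ∑ l, X (x l))
      (Measure.pi fun _ => μ) ≤ N * B ^ 2 := by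
    have h := ProbabilityTheory.variance_sum_pi (μ := fun _ : Fin N => μ) (X := fun _ => X)
      fun _ => hmem
    have e : (∑ i : Fin N, fun ω : Fin N → α => X (ω i)) = fun x => ∑ l, X (x l) := by
      ext x; simp
    rw [e] at h
    rw [h]
    have hv : ProbabilityTheory.variance X μ ≤ B ^ 2 := by
      refine (ProbabilityTheory.variance_le_expectation_sq hX.aestronglyMeasurable).trans ?_
      have : ∫ x, (X ^ 2) x ∂μ ≤ ∫ _, B ^ 2 ∂μ := by
        refine integral_mono hmem.integrable_sq (integrable_const _) fun x => ?_
        have h1 := hB x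
        have h2 : |B| = B := abs_of_nonneg ((abs_nonneg _).trans h1)
        exact sq_le_sq.mpr (by rwa [h2])
      simpa using this
    calc _ ≤ ∑ _ : Fin N, B ^ 2 := Finset.sum_le_sum fun _ _ => hv
      _ = _ := by simp
  have h := ProbabilityTheory.meas_ge_le_variance_div_sq hsum hc
  rw [hmean] at h
  have h2 := ENNReal.toReal_mono ENNReal.ofReal_ne_top h
  rw [ENNReal.toReal_ofReal (div_nonneg (ProbabilityTheory.variance_nonneg _ _)
    (by positivity))] at h2
  exact h2.trans (div_le_div_of_nonneg_right hvar (by positivity))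

/-- A deviation of modulus c forces the real or the imaginary part to deviate by c/2. Each event
costs a factor 4, hence 8. -/
theorem measureReal_pi_norm_sum_sub_ge_le {α : Type*} [MeasurableSpace α] {μ : Measure α}
    [IsProbabilityMeasure μ] {Y : α → ℂ} (hY : Measurable Y) {B : ℝ} (hB : ∀ x, ‖Y x‖ ≤ B)
    {N : ℕ} {c : ℝ} (hc : 0 < c) :
    (Measure.pi fun _ : Fin N => μ).real {x | c ≤ ‖∑ l, Y (x l) - N * ∫ y, Y y ∂μ‖} ≤
      8 * N * B ^ 2 / c ^ 2 := by
  have hi : Integrable Y μ := Integrable.of_bound hY.aestronglyMeasurable B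
    (Filter.Eventually.of_forall hB)
  have h1 := measureReal_pi_abs_sum_sub_ge_le (μ := μ) (N := N) (Complex.measurable_re.comp hY)
    (fun x => (Complex.abs_re_le_norm _).trans (hB x)) (half_pos hc)
  have h2 := measureReal_pi_abs_sum_sub_ge_le (μ := μ) (N := N) (Complex.measurable_im.comp hY)
    (fun x => (Complex.abs_im_le_norm _).trans (hB x)) (half_pos hc)
  have hre : ∫ y, (Complex.re ∘ Y) y ∂μ = (∫ y, Y y ∂μ).re := integral_re hi
  have him : ∫ y, (Complex.im ∘ Y) y ∂μ = (∫ y, Y y ∂μ).im := integral_im hi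
  rw [hre] at h1
  rw [him] at h2
  have hsub : {x : Fin N → α | c ≤ ‖∑ l, Y (x l) - N * ∫ y, Y y ∂μ‖} ⊆
      {x | c / 2 ≤ |∑ l, (Complex.re ∘ Y) (x l) - N * (∫ y, Y y ∂μ).re|} ∪
      {x | c / 2 ≤ |∑ l, (Complex.im ∘ Y) (x l) - N * (∫ y, Y y ∂μ).im|} := by
    intro x hx
    by_contra hcon
    simp only [Set.mem_union, Set.mem_ofPred_eq, not_or, not_le, Function.comp_apply] at hcon hx
    have h3 := Complex.norm_le_abs_re_add_abs_im (∑ l, Y (x l) - N * ∫ y, Y y ∂μ)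
    simp only [Complex.sub_re, Complex.sub_im, Complex.re_sum, Complex.im_sum,
      Complex.mul_re, Complex.mul_im, Complex.natCast_re, Complex.natCast_im, zero_mul, sub_zero,
      add_zero] at h3
    linarith [hcon.1, hcon.2]
  calc _ ≤ _ := measureReal_mono hsub
    _ ≤ _ := measureReal_union_le _ _
    _ ≤ _ := add_le_add h1 h2
    _ = _ := by field_simp; ring

variable {r : Round}

theorem measureReal_correlation_sub_ge_le (hr : r.Admissible) (H O : PauliSum n)
    (hH : 0 < H.norm1) (hO : 0 < O.norm1) {ψ : State n} (hψ : ‖ψ‖ = 1) (E₀ : ℝ) {ρ : ℝ}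
    (hρ : 0 < ρ) :
    (Measure.pi fun _ : Fin r.Ns => sampleLaw r H O ψ).real {x | ρ ≤ ‖correlation r H O E₀ x -
        inner ℂ (evolvedState r H E₀ ψ) (act O.op (evolvedState r H E₀ ψ))‖} ≤
      32 * O.norm1 ^ 2 * r.CT H ^ 4 / (r.Ns * ρ ^ 2) := by
  have := isProbabilityMeasure_sampleLaw hr H O hH hO hψ
  have hN : (0 : ℝ) < r.Ns := Nat.cast_pos.mpr hr.Ns_pos
  have hC := CT_pos hr H
  set K := O.norm1 * r.CT H ^ 2 with hK
  have hK0 : 0 < K := by positivity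
  -- The estimator is K/Ns times the sum of the sample values, so the deviation ρ is rescaled
  -- accordingly. Sample values have modulus at most 2, and 8 · 2² = 32.
  have h := measureReal_pi_norm_sum_sub_ge_le (μ := sampleLaw r H O ψ) (N := r.Ns)
    (measurable_sampleValue r H O E₀) (norm_sampleValue_le r H O E₀)
    (c := r.Ns * ρ / K) (by positivity)
  have e : ∀ x : Fin r.Ns → Sample H.numTerms r.Nt O.numTerms,
      correlation r H O E₀ x -
        inner ℂ (evolvedState r H E₀ ψ) (act O.op (evolvedState r H E₀ ψ)) =
      ((K / r.Ns : ℝ) : ℂ) * (∑ l, sampleValue r H O E₀ (x l) -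
        r.Ns * ∫ y, sampleValue r H O E₀ y ∂sampleLaw r H O ψ) := by
    intro x
    rw [integral_sampleValue hr H O hH hψ, correlation_eq, ← hK, mul_sub]
    congr 1
    have h1 : (K : ℂ) ≠ 0 := Complex.ofReal_ne_zero.mpr hK0.ne'
    have h2 : (r.Ns : ℂ) ≠ 0 := Nat.cast_ne_zero.mpr hr.Ns_pos.ne'
    push_cast
    field_simp
  have hset : {x | ρ ≤ ‖correlation r H O E₀ x -
        inner ℂ (evolvedState r H E₀ ψ) (act O.op (evolvedState r H E₀ ψ))‖} =
      {x | r.Ns * ρ / K ≤ ‖∑ l, sampleValue r H O E₀ (x l) -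
        r.Ns * ∫ y, sampleValue r H O E₀ y ∂sampleLaw r H O ψ‖} := by
    ext x
    simp only [Set.mem_ofPred_eq]
    rw [e, norm_mul, Complex.norm_real, Real.norm_of_nonneg (by positivity), div_le_iff₀ hK0,
      div_mul_eq_mul_div, le_div_iff₀ hN, mul_comm ρ, mul_comm K]
  rw [hset]
  refine h.trans (le_of_eq ?_)
  rw [hK]
  field_simp
  ring

theorem PauliSum.norm1_ident : (PauliSum.ident n).norm1 = 1 := by
  change ∑ _ : Fin 1, |(1 : ℝ)| = 1
  simp

theorem PauliSum.op_ident : (PauliSum.ident n).op = 1 := by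
  change ∑ j : Fin 1, ((1 : ℝ) : ℂ) • pauliOp (fun _ : Fin n => Pauli.I) = 1
  simp [pauliOp_I]

theorem isProbabilityMeasure_roundLaw (hr : r.Admissible) (H : PauliSum n)
    (hH : 0 < H.norm1) {ψ : State n} (hψ : ‖ψ‖ = 1) : IsProbabilityMeasure (roundLaw r H ψ) := by
  have := isProbabilityMeasure_sampleLaw hr H H hH hH hψ
  have := isProbabilityMeasure_sampleLaw hr H (PauliSum.ident n) hH
    (by rw [PauliSum.norm1_ident]; exact one_pos) hψ
  unfold roundLaw
  infer_instance

/-- The tolerance ρ/h for the denominator makes its failure bound equal to that of the numerator. It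
is also the natural one, since |Eg| ≤ h converts a denominator error ρ/h into an energy-weighted
error ρ. -/
theorem measureReal_roundLaw_le (hr : r.Admissible) (H : PauliSum n)
    (hH : 0 < H.norm1) {ψ : State n} (hψ : ‖ψ‖ = 1) (E₀ : ℝ) {ρ : ℝ} (hρ : 0 < ρ) :
    (roundLaw r H ψ).real {x | ρ ≤ ‖correlation r H H E₀ x.1 -
        inner ℂ (evolvedState r H E₀ ψ) (act H.op (evolvedState r H E₀ ψ))‖ ∨
        ρ / H.norm1 ≤ ‖correlation r H (PauliSum.ident n) E₀ x.2 -
        inner ℂ (evolvedState r H E₀ ψ) (evolvedState r H E₀ ψ)‖} ≤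
      64 * H.norm1 ^ 2 * r.CT H ^ 4 / (r.Ns * ρ ^ 2) := by
  have hI : 0 < (PauliSum.ident n).norm1 := by rw [PauliSum.norm1_ident]; exact one_pos
  have := isProbabilityMeasure_sampleLaw hr H H hH hH hψ
  have := isProbabilityMeasure_sampleLaw hr H (PauliSum.ident n) hH hI hψ
  have h1 := measureReal_correlation_sub_ge_le hr H H hH hH hψ E₀ hρ
  have h2 := measureReal_correlation_sub_ge_le hr H (PauliSum.ident n) hH hI hψ E₀
    (div_pos hρ hH)
  rw [PauliSum.norm1_ident, PauliSum.op_ident, act_one] at h2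
  have hN : (0 : ℝ) < r.Ns := Nat.cast_pos.mpr hr.Ns_pos
  set A := {x | ρ ≤ ‖correlation r H H E₀ x -
        inner ℂ (evolvedState r H E₀ ψ) (act H.op (evolvedState r H E₀ ψ))‖} with hA
  set B := {x | ρ / H.norm1 ≤ ‖correlation r H (PauliSum.ident n) E₀ x -
        inner ℂ (evolvedState r H E₀ ψ) (evolvedState r H E₀ ψ)‖} with hB
  calc _ ≤ (roundLaw r H ψ).real (A ×ˢ Set.univ ∪ Set.univ ×ˢ B) := by
        have := isProbabilityMeasure_roundLaw hr H hH hψ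
        refine measureReal_mono (fun x hx => ?_)
        rcases hx with hx | hx
        · exact Or.inl ⟨hx, Set.mem_univ _⟩
        · exact Or.inr ⟨Set.mem_univ _, hx⟩
    _ ≤ _ := measureReal_union_le _ _
    _ = (Measure.pi fun _ => sampleLaw r H H ψ).real A +
          (Measure.pi fun _ => sampleLaw r H (PauliSum.ident n) ψ).real B := by
        unfold roundLaw
        rw [measureReal_prod_prod, measureReal_prod_prod, probReal_univ, probReal_univ, mul_one,
          one_mul]
    _ ≤ _ := add_le_add h1 h2
    _ = _ := by field_simp; ring

theorem measurable_correlation_uncurry (r : Round) (H O : PauliSum n) :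
    Measurable fun z : ℝ × (Fin r.Ns → Sample H.numTerms r.Nt O.numTerms) =>
      correlation r H O z.1 z.2 := by
  simp only [correlation_eq]
  refine measurable_const.mul (Finset.measurable_sum _ fun l _ => ?_)
  have h := measurable_sampleValue_uncurry r H O
  generalize sampleValue r H O = f at h ⊢
  exact h.comp (measurable_fst.prodMk ((measurable_pi_apply l).comp measurable_snd))

theorem measurable_simulate_uncurry (r : Round) (H : PauliSum n) :
    Measurable fun z : ℝ × RoundData r H => simulate r H z.1 z.2 := by
  have h1 := measurable_correlation_uncurry r H H
  have h2 := measurable_correlation_uncurry r H (PauliSum.ident n)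
  simp only [simulate]
  generalize correlation r H H = f at h1 ⊢
  generalize correlation r H (PauliSum.ident n) = g at h2 ⊢
  exact (h1.comp (measurable_fst.prodMk (measurable_fst.comp measurable_snd))).div
    (h2.comp (measurable_fst.prodMk (measurable_snd.comp measurable_snd)))

end
end QCMC

namespace QCMC
noncomputable section
variable {n : ℕ}

/-! ### Adaptive use of independent rounds -/

open scoped ENNReal in
-- Fubini with coordinate k integrated first: a bound that is uniform in the frozen other
-- coordinates bounds the whole. It replaces conditioning on the history of the run.
theorem measure_pi_le_of_forall_update {ι : Type*} [Fintype ι] [DecidableEq ι] {X : ι → Type*}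
    [∀ i, MeasurableSpace (X i)] (μ : ∀ i, Measure (X i)) [∀ i, IsProbabilityMeasure (μ i)]
    (k : ι) {B : Set (∀ i, X i)} (hB : MeasurableSet B) {η : ℝ≥0∞}
    (h : ∀ ω, μ k {x | Function.update ω k x ∈ B} ≤ η) : Measure.pi μ B ≤ η := by
  have hne : Nonempty (∀ i, X i) := ⟨fun i => (nonempty_of_isProbabilityMeasure (μ i)).some⟩
  obtain ⟨ω₀⟩ := hne
  have hf : Measurable (B.indicator (fun _ => (1 : ℝ≥0∞))) := measurable_const.indicator hB
  rw [← lintegral_indicator_one hB]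
  change ∫⁻ ω, B.indicator (fun _ => (1 : ℝ≥0∞)) ω ∂Measure.pi μ ≤ η
  rw [lintegral_eq_lmarginal_univ ω₀, lmarginal_erase' _ hf (Finset.mem_univ k)]
  refine (lmarginal_mono (g := fun _ => η) (fun ω => ?_) ω₀).trans ?_
  · refine le_trans (le_of_eq ?_) (h ω)
    exact lintegral_indicator_one (hB.preimage (measurable_update ω))
  · simp [lmarginal]

namespace Schedule

theorem estimate_succ (S : Schedule) (H : PauliSum n) (ω : S.Run H) {k : ℕ}
    (hk : k < S.numRounds) : S.estimate H ω (k + 1) =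
      simulate (S.round ⟨k, hk⟩) H ((S.estimate H ω k).re - (S.round ⟨k, hk⟩).δE -
        1 / (S.round ⟨k, hk⟩).β) (ω ⟨k, hk⟩) := by
  rw [Schedule.estimate, dif_pos hk]

theorem estimate_update (S : Schedule) (H : PauliSum n) (ω : S.Run H) (k : Fin S.numRounds)
    (x : RoundData (S.round k) H) {j : ℕ} (hj : j ≤ k) :
    S.estimate H (Function.update ω k x) j = S.estimate H ω j := by
  induction j with
  | zero => rfl
  | succ j ih =>
    have hjk : j < (k : ℕ) := hj
    rw [S.estimate_succ H _ (hjk.trans k.2), S.estimate_succ H _ (hjk.trans k.2), ih hjk.le,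
      Function.update_of_ne]
    intro h
    rw [← h] at hjk
    exact lt_irrefl _ hjk

theorem measurable_estimate (S : Schedule) (H : PauliSum n) {k : ℕ} (hk : k ≤ S.numRounds) :
    Measurable fun ω : S.Run H => S.estimate H ω k := by
  induction k with
  | zero => exact measurable_const
  | succ k ih =>
    simp_rw [S.estimate_succ H _ hk]
    have h := measurable_simulate_uncurry (S.round ⟨k, hk⟩) H
    have h2 := ih (Nat.le_of_succ_le hk)
    generalize simulate (S.round ⟨k, hk⟩) H = f at h ⊢
    exact h.comp ((((Complex.measurable_re.comp h2).sub_const _).sub_const _).prodMk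
      (measurable_pi_apply _))

/-- Union bound over the rounds. The estimate before round k does not involve the data of round k,
so with the other rounds frozen the energy shift is a constant to which `hround` applies. -/
theorem measureReal_estimate_le (S : Schedule) (H : PauliSum n) {ψ : State n}
    (hprob : ∀ i, IsProbabilityMeasure (roundLaw (S.round i) H ψ)) {Eg η : ℝ} (hη : 0 ≤ η)
    {d : ℕ → ℝ} (hd : |Eg| ≤ d 0)
    (hround : ∀ i : Fin S.numRounds, ∀ E : ℝ, |E - Eg| ≤ d i →
      (roundLaw (S.round i) H ψ).real {x | d (i + 1) < ‖simulate (S.round i) H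
        (E - (S.round i).δE - 1 / (S.round i).β) x - (Eg : ℂ)‖} ≤ η)
    {k : ℕ} (hk : k ≤ S.numRounds) :
    (S.runLaw H ψ).real {ω | d k < ‖S.estimate H ω k - (Eg : ℂ)‖} ≤ k * η := by
  have : IsProbabilityMeasure (S.runLaw H ψ) := by unfold runLaw; infer_instance
  induction k with
  | zero =>
    have : {ω : S.Run H | d 0 < ‖S.estimate H ω 0 - (Eg : ℂ)‖} = ∅ := by
      ext ω
      simp only [Set.mem_ofPred_eq, Set.mem_empty_iff_false, iff_false, not_lt]
      rw [Schedule.estimate, zero_sub, norm_neg, Complex.norm_real]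
      exact hd
    rw [this]; simp
  | succ k ih =>
    have hk' : k < S.numRounds := hk
    set i : Fin S.numRounds := ⟨k, hk'⟩ with hi
    -- The loss of accuracy in round k itself: good before, bad after. When the frozen data are
    -- already bad before round k, the slice of this event is empty.
    set B : Set (S.Run H) := {ω | ‖S.estimate H ω k - (Eg : ℂ)‖ ≤ d k ∧
      d (k + 1) < ‖S.estimate H ω (k + 1) - (Eg : ℂ)‖} with hB
    have hBm : MeasurableSet B := by
      have h1 := S.measurable_estimate H hk'.le
      have h2 := S.measurable_estimate H hk
      exact (measurableSet_le (h1.sub_const _).norm measurable_const).inter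
        (measurableSet_lt measurable_const (h2.sub_const _).norm)
    have hBle : (S.runLaw H ψ).real B ≤ η := by
      refine ENNReal.toReal_le_of_le_ofReal hη ?_
      unfold runLaw
      refine measure_pi_le_of_forall_update _ i hBm fun ω => ?_
      by_cases hω : ‖S.estimate H ω k - (Eg : ℂ)‖ ≤ d k
      · have hE : |(S.estimate H ω k).re - Eg| ≤ d i := by
          refine le_trans ?_ hω
          have := Complex.abs_re_le_norm (S.estimate H ω k - (Eg : ℂ))
          simpa using this
        rw [← ENNReal.toReal_le_toReal (measure_ne_top _ _) ENNReal.ofReal_ne_top,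
          ENNReal.toReal_ofReal hη]
        refine le_trans (measureReal_mono fun x hx => ?_) (hround i _ hE)
        have hx2 := hx.2
        rw [S.estimate_succ H _ hk', S.estimate_update H ω i x le_rfl, Function.update_self] at hx2
        exact hx2
      · have : {x | Function.update ω i x ∈ B} = ∅ := by
          ext x
          simp only [Set.mem_ofPred_eq, Set.mem_empty_iff_false, iff_false]
          intro hx
          have hx1 := hx.1
          rw [S.estimate_update H ω i x le_rfl] at hx1
          exact hω hx1
        rw [this]; simp
    calc _ ≤ (S.runLaw H ψ).real ({ω | d k < ‖S.estimate H ω k - (Eg : ℂ)‖} ∪ B) := by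
          refine measureReal_mono fun ω hω => ?_
          by_cases h : ‖S.estimate H ω k - (Eg : ℂ)‖ ≤ d k
          · exact Or.inr ⟨h, hω⟩
          · exact Or.inl (not_le.mp h)
      _ ≤ _ := measureReal_union_le _ _
      _ ≤ k * η + η := add_le_add (ih hk'.le) hBle
      _ = _ := by push_cast; ring

end Schedule
end
end QCMC

namespace QCMC
noncomputable section
open scoped Matrix.Norms.L2Operator
variable {n : ℕ}

/-! ### Spectral bounds -/

theorem norm_act_op_le (H : PauliSum n) (v : State n) : ‖act H.op v‖ ≤ H.norm1 * ‖v‖ := by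
  rw [PauliSum.op, act_sum, PauliSum.norm1, Finset.sum_mul]
  refine (norm_sum_le _ _).trans (Finset.sum_le_sum fun j _ => le_of_eq ?_)
  rw [act_smul, norm_smul, Complex.norm_real, Real.norm_eq_abs,
    norm_act_of_mem_unitaryGroup (A := H.term j) (pauliOp_mem_unitaryGroup _)]

theorem mem_energies_of_act_eq_smul (H : PauliSum n) {E : ℝ} {v : State n} (hv : v ≠ 0)
    (h : act H.op v = (E : ℂ) • v) : E ∈ H.energies :=
  Module.End.hasEigenvalue_of_hasEigenvector
    (Module.End.hasEigenvector_iff.mpr ⟨Module.End.mem_eigenspace_iff.mpr h, hv⟩)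

theorem abs_le_norm1_of_mem_energies (H : PauliSum n) {E : ℝ} (hE : E ∈ H.energies) :
    |E| ≤ H.norm1 := by
  obtain ⟨v, hv⟩ := Module.End.HasEigenvalue.exists_hasEigenvector hE
  have h1 : act H.op v = (E : ℂ) • v := hv.apply_eq_smul
  have h2 := norm_act_op_le H v
  rw [h1, norm_smul, Complex.norm_real, Real.norm_eq_abs] at h2
  exact le_of_mul_le_mul_right h2 (norm_pos_iff.mpr hv.2)

theorem eigenvalues_mem_energies (H : PauliSum n) (k : Fin n → Fin 2) :
    H.isHermitian_op.eigenvalues k ∈ H.energies := by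
  refine mem_energies_of_act_eq_smul H ?_ (act_op_eigenvectorBasis H k)
  exact H.isHermitian_op.eigenvectorBasis.orthonormal.ne_zero k

variable {r : Round}

/-- The population of an energy level of `H` in a state. -/
def population (H : PauliSum n) (ψ : State n) (k : Fin n → Fin 2) : ℝ :=
  ‖inner ℂ (H.isHermitian_op.eigenvectorBasis k) ψ‖ ^ 2

theorem sum_population (H : PauliSum n) (ψ : State n) : ∑ k, population H ψ k = ‖ψ‖ ^ 2 :=
  H.isHermitian_op.eigenvectorBasis.sum_sq_norm_inner_right ψ

theorem population_evolvedState (hr : r.Admissible) (H : PauliSum n) (hH : 0 < H.norm1) (E₀ : ℝ)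
    {ψ : State n} (hψ : ‖ψ‖ = 1) (k : Fin n → Fin 2) :
    population H (evolvedState r H E₀ ψ) k =
      r.gT (H.isHermitian_op.eigenvalues k - E₀) ^ 2 * population H ψ k := by
  rw [population, inner_evolvedState hr H hH E₀ hψ (act_op_eigenvectorBasis H k), norm_mul,
    mul_pow, Complex.norm_real, Real.norm_eq_abs, sq_abs, population]

theorem inner_act_op_self (H : PauliSum n) (φ : State n) :
    inner ℂ φ (act H.op φ) =
      ((∑ k, H.isHermitian_op.eigenvalues k * population H φ k : ℝ) : ℂ) := by
  rw [← H.isHermitian_op.eigenvectorBasis.sum_inner_mul_inner, Complex.ofReal_sum]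
  refine Finset.sum_congr rfl fun k _ => ?_
  rw [inner_act, H.isHermitian_op.eq, act_op_eigenvectorBasis, inner_smul_left,
    Complex.conj_ofReal, population, ← inner_conj_symm, mul_left_comm, ← Complex.normSq_eq_conj_mul_self,
    Complex.normSq_eq_norm_sq, Complex.ofReal_mul]

theorem inner_self_eq (φ : State n) : inner ℂ φ φ = ((‖φ‖ ^ 2 : ℝ) : ℂ) := by
  rw [inner_self_eq_norm_sq_to_K]; push_cast; rfl

/-! ### Bounds for one round -/

/-- With y = h|t|/Nt, the linear terms of one step cancel: √(1 + y²) ≤ 1 + y² and e^y - 1 - y ≤ y²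
for y ≤ 1, so the step weight is at most e^{2y²}. Over `Nt` steps the exponent is 2 Nt y² ≤ 2, which
is why `Nt` has to grow like (hT)². -/
theorem weightSum_pow_le (hr : r.Admissible) (H : PauliSum n)
    (hNt : (H.norm1 * r.T) ^ 2 ≤ r.Nt) {t : ℝ} (ht : |t| ≤ r.T) :
    weightSum H (t / r.Nt) ^ r.Nt ≤ Real.exp 2 := by
  have hN : (1 : ℝ) ≤ r.Nt := Nat.one_le_cast.mpr hr.Nt_pos
  have hN0 : (0 : ℝ) < r.Nt := by linarith
  have hh := H.norm1_nonneg
  set y := H.norm1 * |t / r.Nt| with hy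
  have hy0 : 0 ≤ y := by positivity
  have hyN : y * r.Nt ≤ H.norm1 * r.T := by
    rw [hy, abs_div, abs_of_pos hN0, mul_assoc, div_mul_cancel₀ _ hN0.ne']
    exact mul_le_mul_of_nonneg_left ht hh
  have hsq : (y * r.Nt) ^ 2 ≤ r.Nt :=
    (pow_le_pow_left₀ (by positivity) hyN 2).trans hNt
  have hyy : y ^ 2 * r.Nt ≤ 1 := by
    rw [mul_pow, sq (r.Nt : ℝ), ← mul_assoc] at hsq
    have := le_of_mul_le_mul_right (hsq.trans (one_mul _).symm.le) hN0
    exact this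
  have hy1 : y ≤ 1 := by
    have : y ^ 2 ≤ 1 := by nlinarith [sq_nonneg y]
    nlinarith
  have h1 : √(1 + y ^ 2) ≤ 1 + y ^ 2 := by
    rw [Real.sqrt_le_left (by positivity)]; nlinarith [sq_nonneg y]
  have h2 : Real.exp y - 1 - y ≤ y ^ 2 :=
    (le_abs_self _).trans (Real.abs_exp_sub_one_sub_id_le (by rwa [abs_of_nonneg hy0]))
  have h3 : weightSum H (t / r.Nt) ≤ Real.exp (2 * y ^ 2) := by
    have := Real.add_one_le_exp (2 * y ^ 2)
    rw [weightSum, ← hy]; linarith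
  calc _ ≤ Real.exp (2 * y ^ 2) ^ r.Nt :=
        pow_le_pow_left₀ (zero_le_one.trans (one_le_weightSum H _)) h3 _
    _ = Real.exp (r.Nt * (2 * y ^ 2)) := by rw [Real.exp_nat_mul]
    _ ≤ _ := Real.exp_le_exp.mpr (by linarith)

theorem CT_le (hr : r.Admissible) (H : PauliSum n) (hNt : (H.norm1 * r.T) ^ 2 ≤ r.Nt) :
    r.CT H ≤ Real.exp 2 := by
  have hT := hr.T_pos
  calc r.CT H ≤ ∫ t in (-r.T)..r.T, r.g t * Real.exp 2 := by
        refine intervalIntegral.integral_mono_on (by linarith)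
          ((continuous_g_mul_weightSum hr H).intervalIntegrable _ _)
          (((r.continuous_g hr.β_pos).mul continuous_const).intervalIntegrable _ _)
          fun t ht => ?_
        exact mul_le_mul_of_nonneg_left (weightSum_pow_le hr H hNt (abs_le.mpr ht))
          (r.g_pos hr.β_pos t).le
    _ = (∫ t in (-r.T)..r.T, r.g t) * Real.exp 2 := intervalIntegral.integral_mul_const _ _
    _ ≤ 1 * Real.exp 2 := mul_le_mul_of_nonneg_right (r.integral_g_le_one hr.β_pos hT.le)
        (Real.exp_pos _).le
    _ = _ := one_mul _

/-- The factor by which the imaginary time exceeds the inverse energy scale. -/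
def scaleConst (pb : ℝ) : ℝ := 256 * Real.exp 3 / pb

/-- The relative accuracy of the time truncation. -/
def tailConst (pb : ℝ) : ℝ := pb * Real.exp (-(2 + (2 * scaleConst pb + 1))) / 12

/-- A lower bound on the exact denominator of the energy estimate. -/
def denomConst (pb : ℝ) : ℝ := pb * Real.exp (-(3 + 2 * (2 * scaleConst pb + 1))) / 4

/-- The sample size for unit relative accuracy and unit failure probability. -/
def sampleConst (pb : ℝ) : ℝ := 16384 * Real.exp 8 / denomConst pb ^ 2

theorem scaleConst_pos {pb : ℝ} (hpb : 0 < pb) : 0 < scaleConst pb := by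
  unfold scaleConst; positivity

theorem tailConst_pos {pb : ℝ} (hpb : 0 < pb) : 0 < tailConst pb := by
  unfold tailConst; positivity

theorem denomConst_pos {pb : ℝ} (hpb : 0 < pb) : 0 < denomConst pb := by
  unfold denomConst; positivity

theorem sampleConst_pos {pb : ℝ} (hpb : 0 < pb) : 0 < sampleConst pb := by
  have := denomConst_pos hpb
  unfold sampleConst; positivity

theorem norm_sq_evolvedState_ge (hr : r.Admissible) (H : PauliSum n) (hH : 0 < H.norm1)
    {ψ φg : State n} {Eg E₀ pb : ℝ} (hψ : ‖ψ‖ = 1) (hg : H.IsGroundState Eg φg)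
    (hov : pb ≤ ‖inner ℂ φg ψ‖ ^ 2) :
    pb * r.gT (Eg - E₀) ^ 2 ≤ ‖evolvedState r H E₀ ψ‖ ^ 2 := by
  have h1 := norm_inner_le_norm (𝕜 := ℂ) φg (evolvedState r H E₀ ψ)
  rw [inner_evolvedState hr H hH E₀ hψ hg.2, norm_mul, Complex.norm_real, hg.1, one_mul] at h1
  have h2 := pow_le_pow_left₀ (by positivity) h1 2
  rw [mul_pow, Real.norm_eq_abs, sq_abs] at h2
  nlinarith [sq_nonneg (r.gT (Eg - E₀))]

/-- Deterministic part of the analysis of one round: the denominator is bounded below, and the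
exact ratio is close to the ground-state energy. -/
theorem projection_bounds (hr : r.Admissible) (H : PauliSum n) {ψ φg : State n}
    {Eg E₀ pb : ℝ} (hpb : 0 < pb) (hpb1 : pb ≤ 1) (hψ : ‖ψ‖ = 1) (hE : H.IsGroundEnergy Eg)
    (hg : H.IsGroundState Eg φg) (hov : pb ≤ ‖inner ℂ φg ψ‖ ^ 2)
    (hδ : 0 < r.δE) (hδh : r.δE ≤ H.norm1) (hω : 0 ≤ Eg - E₀)
    (hβω : r.β * (Eg - E₀) ≤ 2 * scaleConst pb + 1)
    (hexc : ∀ E ∈ H.energies,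
      (E - Eg) * Real.exp (-(2 * r.β * (E - Eg))) ≤ r.δE / scaleConst pb)
    (htail : Real.exp (-(r.T ^ 2 / (2 * r.β ^ 2))) ≤ tailConst pb * (r.δE / H.norm1)) :
    denomConst pb ≤ ‖evolvedState r H E₀ ψ‖ ^ 2 ∧
      0 ≤ ∑ k, (H.isHermitian_op.eigenvalues k - Eg) * population H (evolvedState r H E₀ ψ) k ∧
      ∑ k, (H.isHermitian_op.eigenvalues k - Eg) * population H (evolvedState r H E₀ ψ) k ≤
        r.δE / 4 * ‖evolvedState r H E₀ ψ‖ ^ 2 := by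
  have hH : 0 < H.norm1 := hδ.trans_le hδh
  have hK := scaleConst_pos hpb
  set K := scaleConst pb with hKdef
  set ε := Real.exp (-(r.T ^ 2 / (2 * r.β ^ 2))) with hε
  have hε0 : 0 < ε := Real.exp_pos _
  set ω₀ := Eg - E₀ with hω₀
  set a := Real.exp (-(r.β * ω₀)) with ha
  have ha0 : 0 < a := Real.exp_pos _
  have hak : Real.exp (-(2 * K + 1)) ≤ a := Real.exp_le_exp.mpr (neg_le_neg hβω)
  have hrat : r.δE / H.norm1 ≤ 1 := div_le_one_of_le₀ hδh hH.le
  have hrat0 : 0 < r.δE / H.norm1 := by positivity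
  -- The truncation error must be small relative to a = e^{-β(Eg - E₀)}. The last exponential in
  -- `tailConst` is the lower bound e^{-(2K+1)} for a.
  have htc : tailConst pb ≤ pb * Real.exp (-2) * a / 12 := by
    rw [tailConst, ← hKdef, neg_add, Real.exp_add, ← mul_assoc]
    exact div_le_div_of_nonneg_right (mul_le_mul_of_nonneg_left hak (by positivity)) (by norm_num)
  have hεa : ε ≤ pb * Real.exp (-2) * a / 12 * (r.δE / H.norm1) :=
    htail.trans (mul_le_mul_of_nonneg_right htc hrat0.le)
  have hexp2 : Real.exp (-2) ≤ Real.exp (-(3 / 2)) := Real.exp_le_exp.mpr (by norm_num)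
  -- Truncation removes at most half of the lower bound for gT at the ground energy.
  have hεa1 : ε ≤ Real.exp (-(3 / 2)) * a / 2 := by
    calc ε ≤ pb * Real.exp (-2) * a / 12 * (r.δE / H.norm1) := hεa
      _ ≤ pb * Real.exp (-2) * a / 12 * 1 := mul_le_mul_of_nonneg_left hrat (by positivity)
      _ ≤ 1 * Real.exp (-(3 / 2)) * a / 12 * 1 := by gcongr
      _ ≤ _ := by nlinarith [mul_pos (Real.exp_pos (-(3 / 2))) ha0]
  have hF := r.le_gT hr.β_pos hr.τ_eq hr.T_pos.le hω
  have hF0 : Real.exp (-(3 / 2)) * a / 2 ≤ r.gT ω₀ := by linarith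
  have hF2 : Real.exp (-3) * a ^ 2 / 4 ≤ r.gT ω₀ ^ 2 := by
    have h := pow_le_pow_left₀ (by positivity) hF0 2
    have e : (Real.exp (-(3 / 2)) * a / 2) ^ 2 = Real.exp (-3) * a ^ 2 / 4 := by
      rw [div_pow, mul_pow, ← Real.exp_nat_mul]; norm_num
    rwa [e] at h
  have hD := norm_sq_evolvedState_ge (E₀ := E₀) hr H hH hψ hg hov
  have hDm : pb * (Real.exp (-3) * a ^ 2 / 4) ≤ ‖evolvedState r H E₀ ψ‖ ^ 2 :=
    (mul_le_mul_of_nonneg_left hF2 hpb.le).trans hD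
  have hEmem := fun k => eigenvalues_mem_energies H k
  have hx0 : ∀ k, 0 ≤ H.isHermitian_op.eigenvalues k - Eg := fun k =>
    sub_nonneg.mpr (hE.2 (hEmem k))
  have hx2 : ∀ k, H.isHermitian_op.eigenvalues k - Eg ≤ 2 * H.norm1 := fun k => by
    have h1 := abs_le.mp (abs_le_norm1_of_mem_energies H (hEmem k))
    have h2 := abs_le.mp (abs_le_norm1_of_mem_energies H hE.1)
    linarith [h1.2, h2.1]
  have hpop : ∀ k, 0 ≤ population H ψ k := fun k => sq_nonneg _
  refine ⟨?_, Finset.sum_nonneg fun k _ => mul_nonneg (hx0 k) (sq_nonneg _), ?_⟩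
  · refine le_trans ?_ hDm
    have h := pow_le_pow_left₀ (Real.exp_pos _).le hak 2
    rw [← Real.exp_nat_mul] at h
    have e : denomConst pb = pb * (Real.exp (-3) * Real.exp ((2 : ℕ) * -(2 * K + 1)) / 4) := by
      rw [denomConst, ← hKdef, ← Real.exp_add, mul_div_assoc]
      congr 3; push_cast; ring
    rw [e]
    gcongr
  -- The populations of ψ sum to 1, so it suffices to bound each level separately by δE/4 times the
  -- lower bound for ‖A‖². The exponential part and the truncation part each use δE/8.
  · have hterm : ∀ k, (H.isHermitian_op.eigenvalues k - Eg) *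
        r.gT (H.isHermitian_op.eigenvalues k - E₀) ^ 2 ≤
        r.δE / 4 * (pb * (Real.exp (-3) * a ^ 2 / 4)) := by
      intro k
      set x := H.isHermitian_op.eigenvalues k - Eg with hx
      have hωk : H.isHermitian_op.eigenvalues k - E₀ = ω₀ + x := by rw [hω₀, hx]; ring
      rw [hωk]
      have hk0 := hx0 k
      have h1 := r.abs_gT_le hr.β_pos hr.τ_eq hr.T_pos.le (add_nonneg hω hk0)
      have h2 := pow_le_pow_left₀ (abs_nonneg _) h1 2
      rw [sq_abs, ← hε] at h2
      have e1 : Real.exp (-(r.β * (ω₀ + x))) = a * Real.exp (-(r.β * x)) := by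
        rw [ha, ← Real.exp_add]; congr 1; ring
      have e2 : Real.exp (-(r.β * x)) ^ 2 = Real.exp (-(2 * r.β * x)) := by
        rw [← Real.exp_nat_mul]; congr 1; push_cast; ring
      have h3 : r.gT (ω₀ + x) ^ 2 ≤ 8 * a ^ 2 * Real.exp (-(2 * r.β * x)) + 2 * ε ^ 2 := by
        rw [e1] at h2
        rw [← e2]
        nlinarith [sq_nonneg (2 * (a * Real.exp (-(r.β * x))) - ε)]
      have h4 : x * Real.exp (-(2 * r.β * x)) ≤ r.δE / K := hexc _ (hEmem k)
      -- The value 256 e³/pb of K makes this an equality after `hexc`: 8/K = pb e^{-3}/32.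
      have h5 : 8 * a ^ 2 * (x * Real.exp (-(2 * r.β * x))) ≤
          r.δE / 8 * (pb * (Real.exp (-3) * a ^ 2 / 4)) := by
        refine (mul_le_mul_of_nonneg_left h4 (by positivity)).trans (le_of_eq ?_)
        rw [hKdef, scaleConst, Real.exp_neg]
        field_simp
        norm_num
      -- Truncation gives no decay in x, only x ≤ 2h. The factor δE/h in the tolerated tail
      -- compensates for this h, and its second power is estimated by 1.
      have h6 : 2 * ε ^ 2 * x ≤ r.δE / 8 * (pb * (Real.exp (-3) * a ^ 2 / 4)) := by
        have h7 : ε ^ 2 ≤ (pb * Real.exp (-2) * a / 12 * (r.δE / H.norm1)) ^ 2 :=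
          pow_le_pow_left₀ hε0.le hεa 2
        have e3 : Real.exp (-2) ^ 2 = Real.exp (-4) := by rw [← Real.exp_nat_mul]; norm_num
        have e4 : Real.exp (-4) ≤ Real.exp (-3) := Real.exp_le_exp.mpr (by norm_num)
        have h8 : ε ^ 2 ≤ pb * Real.exp (-3) * a ^ 2 / 144 * (r.δE / H.norm1) := by
          calc ε ^ 2 ≤ _ := h7
            _ = (pb * pb) * Real.exp (-4) * a ^ 2 / 144 *
                ((r.δE / H.norm1) * (r.δE / H.norm1)) := by rw [← e3]; ring
            _ ≤ (pb * 1) * Real.exp (-3) * a ^ 2 / 144 * ((r.δE / H.norm1) * 1) := by gcongr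
            _ = _ := by ring
        calc 2 * ε ^ 2 * x ≤ 2 * (pb * Real.exp (-3) * a ^ 2 / 144 * (r.δE / H.norm1)) *
              (2 * H.norm1) := by gcongr; exact hx2 k
          _ = pb * Real.exp (-3) * a ^ 2 * r.δE / 36 := by field_simp; norm_num
          _ ≤ pb * Real.exp (-3) * a ^ 2 * r.δE / 32 := by gcongr; norm_num
          _ = _ := by ring
      calc _ ≤ x * (8 * a ^ 2 * Real.exp (-(2 * r.β * x)) + 2 * ε ^ 2) :=
            mul_le_mul_of_nonneg_left h3 hk0
        _ = 8 * a ^ 2 * (x * Real.exp (-(2 * r.β * x))) + 2 * ε ^ 2 * x := by ring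
        _ ≤ _ := add_le_add h5 h6
        _ = _ := by ring
    calc _ = ∑ k, (H.isHermitian_op.eigenvalues k - Eg) *
          r.gT (H.isHermitian_op.eigenvalues k - E₀) ^ 2 * population H ψ k := by
          refine Finset.sum_congr rfl fun k _ => ?_
          rw [population_evolvedState hr H hH E₀ hψ, mul_assoc]
      _ ≤ ∑ k, r.δE / 4 * (pb * (Real.exp (-3) * a ^ 2 / 4)) * population H ψ k :=
          Finset.sum_le_sum fun k _ => mul_le_mul_of_nonneg_right (hterm k) (hpop k)
      _ = r.δE / 4 * (pb * (Real.exp (-3) * a ^ 2 / 4)) := by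
          rw [← Finset.mul_sum, sum_population, hψ, one_pow, mul_one]
      _ ≤ _ := mul_le_mul_of_nonneg_left hDm (by positivity)

/-- Propagation of the statistical errors of the numerator and the denominator to the ratio. -/
theorem norm_div_sub_le {a b : ℂ} {num den E δ h ρ : ℝ} (hδ : 0 < δ) (hδh : δ ≤ h)
    (hE : |E| ≤ h) (hden : 0 < den) (hbias0 : 0 ≤ num - E * den)
    (hbias : num - E * den ≤ δ / 4 * den) (hρ0 : 0 < ρ) (hρ : ρ ≤ den * δ / 16)
    (ha : ‖a - num‖ < ρ) (hb : ‖b - den‖ < ρ / h) :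
    ‖a / b - E‖ ≤ 3 / 4 * δ := by
  have hh : 0 < h := hδ.trans_le hδh
  -- Since δ ≤ h, the denominator loses at most a sixteenth, so b stays above den/2.
  have hρh : ρ / h ≤ den / 16 := by
    rw [div_le_iff₀ hh]
    nlinarith
  have hbn : den / 2 ≤ ‖b‖ := by
    have h1 : ‖(den : ℂ)‖ ≤ ‖b‖ + ‖b - den‖ := by
      have := norm_sub_norm_le (den : ℂ) b
      rw [norm_sub_rev] at this; linarith
    rw [Complex.norm_real, Real.norm_of_nonneg hden.le] at h1
    linarith
  have hb0 : b ≠ 0 := norm_pos_iff.mp (by linarith)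
  have e : a / b - E = ((a - num) - E * (b - den) + ((num - E * den : ℝ) : ℂ)) / b := by
    rw [div_sub' hb0]; congr 1; push_cast; ring
  rw [e, norm_div, div_le_iff₀ (by linarith)]
  have h2 : ‖(E : ℂ) * (b - den)‖ ≤ ρ := by
    rw [norm_mul, Complex.norm_real, Real.norm_eq_abs]
    calc _ ≤ h * (ρ / h) := mul_le_mul hE hb.le (norm_nonneg _) hh.le
      _ = ρ := by field_simp
  calc _ ≤ ‖(a - num) - E * (b - den)‖ + ‖((num - E * den : ℝ) : ℂ)‖ := norm_add_le _ _
    _ ≤ ‖a - num‖ + ‖(E : ℂ) * (b - den)‖ + ‖((num - E * den : ℝ) : ℂ)‖ :=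
        add_le_add_left (norm_sub_le _ _) _
    _ ≤ ρ + ρ + δ / 4 * den := by
        rw [Complex.norm_real, Real.norm_of_nonneg hbias0]; linarith
    -- The budget is used up exactly: 2/16 + 1/4 = 3/8 of δ · den.
    _ ≤ 3 / 4 * δ * (den / 2) := by nlinarith
    _ ≤ _ := mul_le_mul_of_nonneg_left hbn (by positivity)

/-- If the current estimate is within δE, then 1/β ≤ Eg - E₀ ≤ 2δE + 1/β, so β(Eg - E₀) ≤ 2K + 1 and
`projection_bounds` applies. The tolerance ρ is a sixteenth of δE times the lower bound for the
denominator; `sampleConst` is 64 · 16² e^8 over the square of that lower bound, the e^8 being the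
bound for C_T⁴. -/
theorem measureReal_simulate_le (hr : r.Admissible) (H : PauliSum n) {ψ φg : State n}
    {Eg E pb η : ℝ} (hpb : 0 < pb) (hpb1 : pb ≤ 1) (hψ : ‖ψ‖ = 1) (hEg : H.IsGroundEnergy Eg)
    (hg : H.IsGroundState Eg φg) (hov : pb ≤ ‖inner ℂ φg ψ‖ ^ 2)
    (hδ : 0 < r.δE) (hδh : r.δE ≤ H.norm1) (hE : |E - Eg| ≤ r.δE)
    (hβδ : r.β * r.δE ≤ scaleConst pb)
    (hexc : ∀ E ∈ H.energies,
      (E - Eg) * Real.exp (-(2 * r.β * (E - Eg))) ≤ r.δE / scaleConst pb)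
    (htail : Real.exp (-(r.T ^ 2 / (2 * r.β ^ 2))) ≤ tailConst pb * (r.δE / H.norm1))
    (hNt : (H.norm1 * r.T) ^ 2 ≤ r.Nt) (hη : 0 < η)
    (hNs : sampleConst pb * (H.norm1 / r.δE) ^ 2 / η ≤ r.Ns) :
    (roundLaw r H ψ).real {x | 3 / 4 * r.δE <
      ‖simulate r H (E - r.δE - 1 / r.β) x - (Eg : ℂ)‖} ≤ η := by
  have hH : 0 < H.norm1 := hδ.trans_le hδh
  have hβ := hr.β_pos
  set E₀ := E - r.δE - 1 / r.β with hE₀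
  have hEa := abs_le.mp hE
  have hiβ : 0 < 1 / r.β := by positivity
  have hω : 0 ≤ Eg - E₀ := by rw [hE₀]; linarith [hEa.2]
  have hβω : r.β * (Eg - E₀) ≤ 2 * scaleConst pb + 1 := by
    have : r.β * (1 / r.β) = 1 := by field_simp
    calc r.β * (Eg - E₀) ≤ r.β * (2 * r.δE + 1 / r.β) :=
          mul_le_mul_of_nonneg_left (by rw [hE₀]; linarith [hEa.1]) hβ.le
      _ ≤ _ := by rw [mul_add, this]; linarith
  obtain ⟨hden, hb0, hb⟩ := projection_bounds hr H hpb hpb1 hψ hEg hg hov hδ hδh hω hβω hexc htail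
  set A := evolvedState r H E₀ ψ with hA
  have hd0 := denomConst_pos hpb
  have hNs0 : (0 : ℝ) < r.Ns := Nat.cast_pos.mpr hr.Ns_pos
  set ρ := denomConst pb * r.δE / 16 with hρ
  have hρ0 : 0 < ρ := by positivity
  have hsum : ∑ k, (H.isHermitian_op.eigenvalues k - Eg) * population H A k =
      (∑ k, H.isHermitian_op.eigenvalues k * population H A k) - Eg * ‖A‖ ^ 2 := by
    simp_rw [sub_mul]
    rw [Finset.sum_sub_distrib, ← Finset.mul_sum, sum_population]
  rw [hsum] at hb0 hb
  have hprob := isProbabilityMeasure_roundLaw hr H hH hψ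
  have hCT := CT_le hr H hNt
  have hCT0 := CT_pos hr H
  calc _ ≤ _ := measureReal_mono (fun x hx => ?_)
    _ ≤ _ := measureReal_roundLaw_le hr H hH hψ E₀ hρ0
    _ ≤ 64 * H.norm1 ^ 2 * Real.exp 2 ^ 4 / (r.Ns * ρ ^ 2) := by gcongr
    _ = sampleConst pb * (H.norm1 / r.δE) ^ 2 / r.Ns := by
        rw [hρ, sampleConst, ← Real.exp_nat_mul]
        norm_num
        field_simp
        norm_num
    _ ≤ η := by
        rw [div_le_iff₀ hη] at hNs
        rw [div_le_iff₀ hNs0]; linarith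
  by_contra hcon
  rw [Set.mem_ofPred_eq, not_or, not_le, not_le, inner_act_op_self, inner_self_eq, ← hA] at hcon
  have h := norm_div_sub_le hδ hδh (abs_le_norm1_of_mem_energies H hEg.1)
    (hd0.trans_le hden) hb0 hb hρ0 (by rw [hρ]; gcongr) hcon.1 hcon.2
  exact absurd hx (not_lt.mpr h)

end
end QCMC

namespace QCMC
noncomputable section
variable {n : ℕ}

/-! ### Parameters of the solver -/

/-- The imaginary time for a gap bound `Δb` (or `0`) and an energy uncertainty `δ`. -/
def imagTime (pb Δb δ : ℝ) : ℝ :=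
  scaleConst pb / max Δb δ * (1 + Real.log (max Δb δ / δ))

/-- The logarithm of the inverse of the tolerated relative weight of the times beyond the
truncation time. -/
def tailLog (pb h δ : ℝ) : ℝ := Real.log (h / (tailConst pb * δ))

/-- The parameters of a round with energy uncertainty `δ` and failure probability `η`. -/
def solverRound (pb h Δb η δ : ℝ) : Round where
  δE := δ
  β := imagTime pb Δb δ
  τ := imagTime pb Δb δ
  T := imagTime pb Δb δ * √(2 * tailLog pb h δ)
  Nt := ⌈(h * (imagTime pb Δb δ * √(2 * tailLog pb h δ))) ^ 2⌉₊
  Ns := ⌈sampleConst pb * (h / δ) ^ 2 / η⌉₊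

/-- The number of rounds for the relative accuracy `ξ`. -/
def solverRounds (ξ : ℝ) : ℕ := ⌊Real.log (1 / ξ) / Real.log (4 / 3)⌋₊ + 1

/-- The parameters of all rounds. -/
def solverSchedule (pb h Δb ξ κ : ℝ) : Schedule where
  numRounds := solverRounds ξ
  round := fun i => solverRound pb h Δb (κ / (2 * solverRounds ξ)) ((3 / 4 : ℝ) ^ (i : ℕ) * h)

theorem two_div_le_scaleConst {pb : ℝ} (hpb : 0 < pb) : 2 / pb ≤ scaleConst pb := by
  unfold scaleConst
  have := Real.add_one_le_exp (3 : ℝ)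
  gcongr
  linarith

theorem two_le_scaleConst {pb : ℝ} (hpb : 0 < pb) (hpb1 : pb ≤ 1) : 2 ≤ scaleConst pb := by
  refine le_trans ?_ (two_div_le_scaleConst hpb)
  rw [le_div_iff₀ hpb]; linarith

theorem tailConst_lt_one {pb : ℝ} (hpb : 0 < pb) (hpb1 : pb ≤ 1) : tailConst pb < 1 := by
  have h1 : Real.exp (-(2 + (2 * scaleConst pb + 1))) ≤ 1 := by
    rw [Real.exp_le_one_iff]; linarith [scaleConst_pos hpb]
  have h2 := Real.exp_pos (-(2 + (2 * scaleConst pb + 1)))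
  unfold tailConst; nlinarith

theorem log_max_div_nonneg {Δb δ : ℝ} (hδ : 0 < δ) : 0 ≤ Real.log (max Δb δ / δ) :=
  Real.log_nonneg ((one_le_div hδ).mpr (le_max_right _ _))

theorem imagTime_pos {pb Δb δ : ℝ} (hpb : 0 < pb) (hδ : 0 < δ) : 0 < imagTime pb Δb δ := by
  have h1 := log_max_div_nonneg (Δb := Δb) hδ
  have h2 := scaleConst_pos hpb
  have h3 : 0 < max Δb δ := hδ.trans_le (le_max_right _ _)
  unfold imagTime; positivity

theorem imagTime_of_le {pb Δb δ : ℝ} (hδ : 0 < δ) (h : Δb ≤ δ) :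
    imagTime pb Δb δ = scaleConst pb / δ := by
  rw [imagTime, max_eq_right h, div_self hδ.ne', Real.log_one, add_zero, mul_one]

theorem imagTime_mul_gap {pb Δb δ : ℝ} (hδ : 0 < δ) (h : δ ≤ Δb) :
    imagTime pb Δb δ * Δb = scaleConst pb * (1 + Real.log (Δb / δ)) := by
  have : Δb ≠ 0 := (hδ.trans_le h).ne'
  rw [imagTime, max_eq_left h]
  field_simp

/-- With x = max(Δb, δ)/δ this is K(1 + ln x)/x ≤ K. It keeps the damping of the ground state
bounded, even though β carries a logarithm. -/
theorem imagTime_mul_le {pb Δb δ : ℝ} (hpb : 0 < pb) (hδ : 0 < δ) :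
    imagTime pb Δb δ * δ ≤ scaleConst pb := by
  have h3 : 0 < max Δb δ := hδ.trans_le (le_max_right _ _)
  have h4 := Real.log_le_sub_one_of_pos (div_pos h3 hδ)
  have h5 : (1 + Real.log (max Δb δ / δ)) * (δ / max Δb δ) ≤ 1 := by
    calc _ ≤ (max Δb δ / δ) * (δ / max Δb δ) := by gcongr; linarith
      _ = 1 := by field_simp
  calc _ = scaleConst pb * ((1 + Real.log (max Δb δ / δ)) * (δ / max Δb δ)) := by
        rw [imagTime]; ring
    _ ≤ _ := mul_le_of_le_one_right (scaleConst_pos hpb).le h5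

/-- In general y e^{-βy} ≤ 1/β, which is δ/K when Δb ≤ δ. When Δb ≥ δ the exponential is split in
two: one half gives 1/β ≤ Δb/K, and the other, using x ≥ Δb and the logarithm in β, gives δ/Δb. For
Δb = 0 no gap information is used. -/
theorem mul_exp_neg_imagTime_le {pb Δb δ x : ℝ} (hpb : 0 < pb) (hpb1 : pb ≤ 1) (hδ : 0 < δ)
    (hx : x = 0 ∨ (0 ≤ x ∧ Δb ≤ x)) :
    x * Real.exp (-(2 * imagTime pb Δb δ * x)) ≤ δ / scaleConst pb := by
  have hK := scaleConst_pos hpb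
  have hβ := imagTime_pos (Δb := Δb) hpb hδ
  rcases hx with rfl | ⟨hx0, hx⟩
  · rw [zero_mul]; positivity
  have hxβ : ∀ y : ℝ, 0 ≤ y → y * Real.exp (-(imagTime pb Δb δ * y)) ≤ 1 / imagTime pb Δb δ := by
    intro y hy
    rw [le_div_iff₀ hβ, Real.exp_neg]
    have h1 := Real.add_one_le_exp (imagTime pb Δb δ * y)
    have h2 := Real.exp_pos (imagTime pb Δb δ * y)
    rw [mul_right_comm, mul_comm y, ← div_eq_mul_inv, div_le_one h2]
    linarith
  rcases le_total Δb δ with hle | hle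
  · refine le_trans ?_ ((hxβ x hx0).trans (le_of_eq ?_))
    · refine mul_le_mul_of_nonneg_left (Real.exp_le_exp.mpr ?_) hx0
      have : 0 ≤ imagTime pb Δb δ * x := by positivity
      linarith
    · rw [imagTime_of_le hδ hle, one_div_div]
  · have hΔ : 0 < Δb := hδ.trans_le hle
    have hl : 0 ≤ Real.log (Δb / δ) := Real.log_nonneg ((one_le_div hδ).mpr hle)
    have hb := imagTime_mul_gap (pb := pb) hδ hle
    have hK1 := two_le_scaleConst hpb hpb1
    have e : Real.exp (-(2 * imagTime pb Δb δ * x)) =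
        Real.exp (-(imagTime pb Δb δ * x)) * Real.exp (-(imagTime pb Δb δ * x)) := by
      rw [← Real.exp_add]; congr 1; ring
    have h1 : Real.exp (-(imagTime pb Δb δ * x)) ≤ δ / Δb := by
      rw [← Real.exp_log (div_pos hδ hΔ)]
      apply Real.exp_le_exp.mpr
      rw [← inv_div, Real.log_inv]
      have : imagTime pb Δb δ * Δb ≤ imagTime pb Δb δ * x := mul_le_mul_of_nonneg_left hx hβ.le
      nlinarith
    have h2 : 1 / imagTime pb Δb δ ≤ Δb / scaleConst pb := by
      rw [div_le_div_iff₀ hβ hK]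
      nlinarith
    rw [e, ← mul_assoc]
    calc _ ≤ (Δb / scaleConst pb) * (δ / Δb) := by
          gcongr
          exact (hxβ x hx0).trans h2
      _ = _ := by field_simp

theorem log_one_add_le {pb : ℝ} (hpb : 0 < pb) (hpb1 : pb ≤ 1) :
    Real.log (1 + (1 - pb) / (Real.exp 1 * pb)) ≤ scaleConst pb / 2 := by
  have h0 : 0 ≤ (1 - pb) / (Real.exp 1 * pb) := div_nonneg (by linarith) (by positivity)
  have h1 := Real.log_le_sub_one_of_pos (x := 1 + (1 - pb) / (Real.exp 1 * pb)) (by linarith)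
  have h2 := two_div_le_scaleConst hpb
  have h3 : (1 - pb) / (Real.exp 1 * pb) ≤ 1 / pb := by
    have := Real.add_one_le_exp (1 : ℝ)
    rw [div_le_div_iff₀ (by positivity) hpb]
    nlinarith
  have h4 : 2 / pb = 2 * (1 / pb) := by ring
  linarith

/-- This, `gapProjValid_imagTime` and `gapProjBound_imagTime_le` only check that β obeys the
prescribed rule. Accuracy rests on the stronger `mul_exp_neg_imagTime_le`. -/
theorem projBound_imagTime_le {pb Δb δ : ℝ} (hpb : 0 < pb) (hpb1 : pb ≤ 1) (hδ : 0 < δ)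
    (h : Δb ≤ δ) : projBound pb (imagTime pb Δb δ) ≤ δ / 2 := by
  have hK := scaleConst_pos hpb
  rw [projBound, imagTime_of_le hδ h]
  calc _ ≤ 1 / (2 * (scaleConst pb / δ)) * (scaleConst pb / 2) :=
        mul_le_mul_of_nonneg_left (log_one_add_le hpb hpb1) (by positivity)
    _ = δ / 4 := by field_simp; norm_num
    _ ≤ _ := by linarith

theorem gapProjValid_imagTime {pb Δb δ : ℝ} (hpb : 0 < pb) (hpb1 : pb ≤ 1) (hδ : 0 < δ)
    (h : δ ≤ Δb) : GapProjValid pb Δb (imagTime pb Δb δ) := by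
  have hl : 0 ≤ Real.log (Δb / δ) := Real.log_nonneg ((one_le_div hδ).mpr h)
  have h1 := log_one_add_le hpb hpb1
  have h2 := two_le_scaleConst hpb hpb1
  rw [GapProjValid, mul_assoc, imagTime_mul_gap hδ h]
  nlinarith

theorem gapProjBound_imagTime_le {pb Δb δ : ℝ} (hpb : 0 < pb) (hpb1 : pb ≤ 1) (hδ : 0 < δ)
    (h : δ ≤ Δb) : gapProjBound pb Δb (imagTime pb Δb δ) ≤ δ / 2 := by
  have hΔ : 0 < Δb := hδ.trans_le h
  have hl : 0 ≤ Real.log (Δb / δ) := Real.log_nonneg ((one_le_div hδ).mpr h)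
  have hK := two_le_scaleConst hpb hpb1
  have hK2 := two_div_le_scaleConst hpb
  have hK0 := scaleConst_pos hpb
  have hexp : Real.exp (-(2 * imagTime pb Δb δ * Δb)) ≤ pb / 2 * (δ / Δb) := by
    have h1 : -(2 * imagTime pb Δb δ * Δb) ≤ -scaleConst pb + Real.log (δ / Δb) := by
      rw [mul_assoc, imagTime_mul_gap hδ h, ← inv_div Δb δ, Real.log_inv]
      nlinarith
    refine (Real.exp_le_exp.mpr h1).trans ?_
    rw [Real.exp_add, Real.exp_log (div_pos hδ hΔ)]
    refine mul_le_mul_of_nonneg_right ?_ (by positivity)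
    rw [Real.exp_neg]
    have h2 := Real.add_one_le_exp (scaleConst pb)
    rw [← inv_div 2 pb]
    exact inv_anti₀ (by positivity) (by linarith)
  have he := Real.exp_pos (-(2 * imagTime pb Δb δ * Δb))
  rw [gapProjBound]
  have hp1 : 0 ≤ 1 - pb := by linarith
  calc _ ≤ (1 - pb) * Real.exp (-(2 * imagTime pb Δb δ * Δb)) * Δb / pb := by
        gcongr
        have : 0 ≤ (1 - pb) * Real.exp (-(2 * imagTime pb Δb δ * Δb)) := by positivity
        linarith
    _ ≤ 1 * (pb / 2 * (δ / Δb)) * Δb / pb := by gcongr; linarith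
    _ = _ := by field_simp

theorem tailLog_pos {pb h δ : ℝ} (hpb : 0 < pb) (hpb1 : pb ≤ 1) (hδ : 0 < δ) (hδh : δ ≤ h) :
    0 < tailLog pb h δ := by
  have h1 := tailConst_pos hpb
  have h2 := tailConst_lt_one hpb hpb1
  refine Real.log_pos ((one_lt_div (by positivity)).mpr ?_)
  nlinarith

theorem admissible_solverRound {pb h Δb η δ : ℝ} (hpb : 0 < pb) (hpb1 : pb ≤ 1) (hδ : 0 < δ)
    (hδh : δ ≤ h) (hη : 0 < η) : (solverRound pb h Δb η δ).Admissible := by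
  have hβ := imagTime_pos (Δb := Δb) hpb hδ
  have hL := tailLog_pos hpb hpb1 hδ hδh
  have hh : 0 < h := hδ.trans_le hδh
  have hA := sampleConst_pos hpb
  have hT : 0 < imagTime pb Δb δ * √(2 * tailLog pb h δ) := by positivity
  exact ⟨hβ, rfl, hT, Nat.ceil_pos.mpr (by positivity), Nat.ceil_pos.mpr (by positivity)⟩

/-- T is chosen so that the truncation error is exactly the tolerated one. -/
theorem exp_neg_T_sq_solverRound {pb h Δb η δ : ℝ} (hpb : 0 < pb) (hpb1 : pb ≤ 1) (hδ : 0 < δ)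
    (hδh : δ ≤ h) :
    Real.exp (-((solverRound pb h Δb η δ).T ^ 2 / (2 * (solverRound pb h Δb η δ).β ^ 2))) =
      tailConst pb * (δ / h) := by
  have hβ := imagTime_pos (Δb := Δb) hpb hδ
  have hL := tailLog_pos hpb hpb1 hδ hδh
  have hh : 0 < h := hδ.trans_le hδh
  have hc := tailConst_pos hpb
  have e : (imagTime pb Δb δ * √(2 * tailLog pb h δ)) ^ 2 / (2 * imagTime pb Δb δ ^ 2) =
      tailLog pb h δ := by
    rw [mul_pow, Real.sq_sqrt (by positivity)]
    field_simp
  change Real.exp (-((imagTime pb Δb δ * √(2 * tailLog pb h δ)) ^ 2 /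
    (2 * imagTime pb Δb δ ^ 2))) = _
  rw [e, tailLog, Real.exp_neg, Real.exp_log (by positivity)]
  field_simp

/-- Floor plus one, rather than ceiling, makes the inequality strict. For ξ ≥ 1 the floor is 0 and a
single round remains. -/
theorem pow_three_fourths_solverRounds_lt {ξ : ℝ} (hξ : 0 < ξ) :
    (3 / 4 : ℝ) ^ solverRounds ξ < ξ := by
  have hl : 0 < Real.log (4 / 3) := Real.log_pos (by norm_num)
  have h1 : Real.log (1 / ξ) / Real.log (4 / 3) < (solverRounds ξ : ℝ) := by
    rw [solverRounds]; push_cast; exact Nat.lt_floor_add_one _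
  rw [div_lt_iff₀ hl] at h1
  rw [← Real.log_lt_log_iff (by positivity) hξ, Real.log_pow]
  have h2 : Real.log (3 / 4) = -Real.log (4 / 3) := by rw [← Real.log_inv]; norm_num
  rw [one_div, Real.log_inv] at h1
  rw [h2]; linarith

/-- The last round has index equal to the floor, so every round starts with an uncertainty of at
least ξ h. All cost bounds use this worst case. -/
theorem inv_pow_three_fourths_le {ξ : ℝ} (hξ : 0 < ξ) (hξ2 : ξ ≤ 1 / 2) {i : ℕ}
    (hi : i < solverRounds ξ) : ((3 / 4 : ℝ) ^ i)⁻¹ ≤ 1 / ξ := by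
  have hl : 0 < Real.log (4 / 3) := Real.log_pos (by norm_num)
  have hξ1 : 0 ≤ Real.log (1 / ξ) := by
    refine Real.log_nonneg ?_
    rw [le_div_iff₀ hξ]; linarith
  have h1 : (i : ℝ) ≤ Real.log (1 / ξ) / Real.log (4 / 3) :=
    (Nat.cast_le.mpr (Nat.lt_succ_iff.mp hi)).trans (Nat.floor_le (by positivity))
  rw [le_div_iff₀ hl] at h1
  rw [← inv_pow, ← Real.log_le_log_iff (by positivity) (by positivity), Real.log_pow]
  norm_num at h1 ⊢
  linarith

theorem log_two_le_log_inv {ξ : ℝ} (hξ : 0 < ξ) (hξ2 : ξ ≤ 1 / 2) :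
    Real.log 2 ≤ Real.log (1 / ξ) := by
  refine Real.log_le_log (by norm_num) ?_
  rw [le_div_iff₀ hξ]; linarith

theorem solverRounds_le {ξ : ℝ} (hξ : 0 < ξ) (hξ2 : ξ ≤ 1 / 2) :
    (solverRounds ξ : ℝ) ≤ 6 * Real.log (1 / ξ) := by
  have h0 := log_two_le_log_inv hξ hξ2
  have h1 := Real.log_two_gt_d9
  have hl : 1 / 4 ≤ Real.log (4 / 3) := by
    have := Real.one_sub_inv_le_log_of_pos (x := 4 / 3) (by norm_num)
    norm_num at this ⊢; linarith
  have h2 : Real.log (1 / ξ) / Real.log (4 / 3) ≤ 4 * Real.log (1 / ξ) := by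
    rw [div_le_iff₀ (by linarith)]; nlinarith
  have h3 := Nat.floor_le (a := Real.log (1 / ξ) / Real.log (4 / 3))
    (div_nonneg (by linarith) (by linarith))
  rw [solverRounds]; push_cast
  linarith

/-! ### Correctness and cost of the solver -/

section Solver

variable {pb h Δb ξ κ : ℝ}

theorem scale_pos (hh : 0 < h) (i : ℕ) : 0 < (3 / 4 : ℝ) ^ i * h := by positivity

theorem scale_le (hh : 0 < h) (i : ℕ) : (3 / 4 : ℝ) ^ i * h ≤ h :=
  mul_le_of_le_one_left hh.le (pow_le_one₀ (by norm_num) (by norm_num))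

theorem solverRounds_pos : (0 : ℝ) < solverRounds ξ := by
  rw [solverRounds]; positivity

theorem admissible_solverSchedule (hpb : 0 < pb) (hpb1 : pb ≤ 1) (hh : 0 < h) (hκ : 0 < κ)
    (i : Fin (solverRounds ξ)) : ((solverSchedule pb h Δb ξ κ).round i).Admissible :=
  admissible_solverRound hpb hpb1 (scale_pos hh _) (scale_le hh _)
    (div_pos hκ (mul_pos two_pos solverRounds_pos))

theorem isProper_solverSchedule (hpb : 0 < pb) (hpb1 : pb ≤ 1) (hh : 0 < h) (hκ : 0 < κ) :
    (solverSchedule pb h Δb ξ κ).IsProper h := by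
  intro i
  have hr := admissible_solverSchedule (Δb := Δb) (ξ := ξ) hpb hpb1 hh hκ i
  exact ⟨rfl, hr.β_pos, hr.τ_eq ▸ hr.β_pos, hr.T_pos, hr.Nt_pos, hr.Ns_pos⟩

theorem generalRule_solverSchedule (hpb : 0 < pb) (hpb1 : pb ≤ 1) (hh : 0 < h) :
    (solverSchedule pb h 0 ξ κ).GeneralRule pb := fun i =>
  projBound_imagTime_le hpb hpb1 (scale_pos hh i) (scale_pos hh i).le

theorem gapRule_solverSchedule (hpb : 0 < pb) (hpb1 : pb ≤ 1) (hh : 0 < h) :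
    (solverSchedule pb h Δb ξ κ).GapRule pb Δb := fun i => by
  rcases le_total Δb ((3 / 4 : ℝ) ^ (i : ℕ) * h) with hle | hle
  · exact Or.inl (projBound_imagTime_le hpb hpb1 (scale_pos hh i) hle)
  · exact Or.inr ⟨gapProjValid_imagTime hpb hpb1 (scale_pos hh i) hle,
      gapProjBound_imagTime_le hpb hpb1 (scale_pos hh i) hle⟩

theorem success_solverSchedule (hpb : 0 < pb) (hpb1 : pb ≤ 1) (hξ : 0 < ξ) (hκ : 0 < κ)
    (H : PauliSum n) (hH : 0 < H.norm1) {ψ φg : State n} {Eg : ℝ} (hEg : H.IsGroundEnergy Eg)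
    (hg : H.IsGroundState Eg φg) (hψ : ‖ψ‖ = 1) (hov : pb ≤ ‖inner ℂ φg ψ‖ ^ 2)
    (hgap : ∀ E ∈ H.energies, E ≠ Eg → Δb ≤ E - Eg) :
    1 - κ < ((solverSchedule pb H.norm1 Δb ξ κ).runLaw H ψ).real
      {ω | ‖(solverSchedule pb H.norm1 Δb ξ κ).result H ω - (Eg : ℂ)‖ < H.norm1 * ξ} := by
  set S := solverSchedule pb H.norm1 Δb ξ κ with hS
  -- The factor 2 leaves total failure probability κ/2, which gives the strict inequality.
  set η := κ / (2 * solverRounds ξ) with hηdef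
  have hN0 := solverRounds_pos (ξ := ξ)
  have hη : 0 < η := by positivity
  have hadm : ∀ i, (S.round i).Admissible := fun i => admissible_solverSchedule hpb hpb1 hH hκ i
  have hprob : ∀ i, IsProbabilityMeasure (roundLaw (S.round i) H ψ) := fun i =>
    isProbabilityMeasure_roundLaw (hadm i) H hH hψ
  have hrun : IsProbabilityMeasure (S.runLaw H ψ) := by unfold Schedule.runLaw; infer_instance
  have hfail := S.measureReal_estimate_le H hprob (Eg := Eg) hη.le
    (d := fun i => (3 / 4 : ℝ) ^ i * H.norm1)
    (by simpa using abs_le_norm1_of_mem_energies H hEg.1) (fun i E hE => by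
      have hδ := scale_pos hH i
      have h1 := measureReal_simulate_le (hadm i) H hpb hpb1 hψ hEg hg hov hδ (scale_le hH i) hE
        (imagTime_mul_le hpb hδ) (fun E' hE' => ?_)
        (exp_neg_T_sq_solverRound hpb hpb1 hδ (scale_le hH i)).le (Nat.le_ceil _) hη
        (Nat.le_ceil _)
      · have e : (3 / 4 : ℝ) ^ ((i : ℕ) + 1) * H.norm1 = 3 / 4 * (S.round i).δE := by
          change _ = 3 / 4 * ((3 / 4 : ℝ) ^ (i : ℕ) * H.norm1)
          ring
        simp only [e]
        exact h1
      · refine mul_exp_neg_imagTime_le hpb hpb1 hδ ?_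
        by_cases hEE : E' = Eg
        · exact Or.inl (sub_eq_zero.mpr hEE)
        · exact Or.inr ⟨sub_nonneg.mpr (hEg.2 hE'), hgap E' hE' hEE⟩) (k := S.numRounds) le_rfl
  have hfail2 : (S.numRounds : ℝ) * η = κ / 2 := by
    change (solverRounds ξ : ℝ) * η = κ / 2
    rw [hηdef]; field_simp
  rw [hfail2] at hfail
  have hpow := pow_three_fourths_solverRounds_lt hξ
  -- Subadditivity applied to this cover of the whole space bounds the success probability below
  -- without measurability of the events.
  have hcover : (Set.univ : Set (S.Run H)) ⊆ {ω | ‖S.result H ω - (Eg : ℂ)‖ < H.norm1 * ξ} ∪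
      {ω | (3 / 4 : ℝ) ^ S.numRounds * H.norm1 < ‖S.estimate H ω S.numRounds - (Eg : ℂ)‖} := by
    intro ω _
    by_cases hω : (3 / 4 : ℝ) ^ S.numRounds * H.norm1 <
        ‖S.estimate H ω S.numRounds - (Eg : ℂ)‖
    · exact Or.inr hω
    · refine Or.inl ((not_lt.mp hω).trans_lt ?_)
      rw [mul_comm]
      exact mul_lt_mul_of_pos_left hpow hH
  have h1 : (1 : ℝ) ≤ _ := (probReal_univ (μ := S.runLaw H ψ)).symm.le.trans
    ((measureReal_mono hcover).trans (measureReal_union_le _ _))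
  linarith

/-- One logarithm comes from splitting κ over the rounds, the other from bounding every round by the
worst case and multiplying by the number of rounds. The +1 of each ceiling is absorbed using ln(1/ξ)
≥ 1/2. -/
theorem totalSamples_solverSchedule_le (hpb : 0 < pb) (hh : 0 < h) (hξ : 0 < ξ)
    (hκ : 0 < κ) (hξ2 : ξ ≤ 1 / 2) (hκ1 : κ ≤ 1) :
    ((solverSchedule pb h Δb ξ κ).totalSamples : ℝ) ≤
      (72 * sampleConst pb + 12) * (1 / (κ * ξ ^ 2) * Real.log (1 / ξ) ^ 2) := by
  have hA := sampleConst_pos hpb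
  have hN := solverRounds_le hξ hξ2
  have hN0 := solverRounds_pos (ξ := ξ)
  have hl := log_two_le_log_inv hξ hξ2
  have hl2 := Real.log_two_gt_d9
  set l := Real.log (1 / ξ) with hldef
  have hl0 : 0 < l := by linarith
  have hu : 1 ≤ 1 / (κ * ξ ^ 2) := by
    rw [le_div_iff₀ (by positivity), one_mul]
    exact mul_le_one₀ hκ1 (by positivity) (pow_le_one₀ hξ.le (by linarith))
  have hterm : ∀ i : Fin (solverRounds ξ),
      (((solverSchedule pb h Δb ξ κ).round i).Ns : ℝ) ≤
        (12 * sampleConst pb + 2) * (1 / (κ * ξ ^ 2) * l) := by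
    intro i
    change (⌈sampleConst pb * (h / ((3 / 4 : ℝ) ^ (i : ℕ) * h)) ^ 2 /
      (κ / (2 * solverRounds ξ))⌉₊ : ℝ) ≤ _
    have h1 : h / ((3 / 4 : ℝ) ^ (i : ℕ) * h) ≤ 1 / ξ := by
      refine le_trans (le_of_eq ?_) (inv_pow_three_fourths_le hξ hξ2 i.2)
      field_simp
    calc _ ≤ sampleConst pb * (h / ((3 / 4 : ℝ) ^ (i : ℕ) * h)) ^ 2 /
          (κ / (2 * solverRounds ξ)) + 1 := (Nat.ceil_lt_add_one (by positivity)).le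
      _ ≤ sampleConst pb * (1 / ξ) ^ 2 / (κ / (2 * (6 * l))) + (1 / (κ * ξ ^ 2)) * (2 * l) := by
          gcongr
          nlinarith
      _ = _ := by field_simp; ring
  rw [Schedule.totalSamples]
  push_cast
  calc _ ≤ ∑ _ : Fin (solverRounds ξ), (12 * sampleConst pb + 2) * (1 / (κ * ξ ^ 2) * l) :=
        Finset.sum_le_sum fun i _ => hterm i
    _ = solverRounds ξ * ((12 * sampleConst pb + 2) * (1 / (κ * ξ ^ 2) * l)) := by simp
    _ ≤ 6 * l * ((12 * sampleConst pb + 2) * (1 / (κ * ξ ^ 2) * l)) := by gcongr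
    _ = _ := by ring

/-- The ratio of the logarithms of the truncation error and of the accuracy. -/
def tailRatio (pb : ℝ) : ℝ := 2 * Real.log (1 / tailConst pb) + 1

theorem tailRatio_pos (hpb : 0 < pb) (hpb1 : pb ≤ 1) : 0 < tailRatio pb := by
  have h1 := tailConst_pos hpb
  have h2 := tailConst_lt_one hpb hpb1
  have : 0 < Real.log (1 / tailConst pb) := Real.log_pos ((one_lt_div h1).mpr h2)
  unfold tailRatio; positivity

theorem Nt_solverSchedule_le (hpb : 0 < pb) (hpb1 : pb ≤ 1) (hh : 0 < h) (hξ : 0 < ξ)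
    (hξ2 : ξ ≤ 1 / 2) (i : Fin (solverRounds ξ)) :
    (((solverSchedule pb h Δb ξ κ).round i).Nt : ℝ) ≤
      2 * tailRatio pb * (h * imagTime pb Δb ((3 / 4 : ℝ) ^ (i : ℕ) * h)) ^ 2 *
        Real.log (1 / ξ) + 1 := by
  have hl := log_two_le_log_inv hξ hξ2
  have hl2 := Real.log_two_gt_d9
  have hδ := scale_pos hh i
  have hc := tailConst_pos hpb
  have hL := tailLog_pos hpb hpb1 hδ (scale_le hh i)
  have hc1 : 0 < Real.log (1 / tailConst pb) :=
    Real.log_pos ((one_lt_div hc).mpr (tailConst_lt_one hpb hpb1))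
  change (⌈(h * (imagTime pb Δb ((3 / 4 : ℝ) ^ (i : ℕ) * h) *
    √(2 * tailLog pb h ((3 / 4 : ℝ) ^ (i : ℕ) * h)))) ^ 2⌉₊ : ℝ) ≤ _
  refine (Nat.ceil_lt_add_one (by positivity)).le.trans (add_le_add_left ?_ 1)
  -- The logarithm splits into a constant depending on pb and at most ln(1/ξ). The constant is
  -- absorbed by 1 ≤ 2 ln(1/ξ), hence the 2 in `tailRatio`.
  have h1 : tailLog pb h ((3 / 4 : ℝ) ^ (i : ℕ) * h) ≤ tailRatio pb * Real.log (1 / ξ) := by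
    have e : h / (tailConst pb * ((3 / 4 : ℝ) ^ (i : ℕ) * h)) =
        1 / tailConst pb * ((3 / 4 : ℝ) ^ (i : ℕ))⁻¹ := by field_simp
    rw [tailLog, e, Real.log_mul (by positivity) (by positivity), tailRatio]
    have := Real.log_le_log (by positivity) (inv_pow_three_fourths_le hξ hξ2 i.2)
    nlinarith
  rw [← mul_assoc, mul_pow, Real.sq_sqrt (by positivity)]
  calc _ ≤ (h * imagTime pb Δb ((3 / 4 : ℝ) ^ (i : ℕ) * h)) ^ 2 *
        (2 * (tailRatio pb * Real.log (1 / ξ))) := by gcongr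
    _ = _ := by ring

theorem maxTrotter_le_of_forall {S : Schedule} {B : ℝ} (hB : 0 ≤ B)
    (hS : ∀ i, ((S.round i).Nt : ℝ) ≤ B) : (S.maxTrotter : ℝ) ≤ B := by
  refine (Nat.le_floor_iff hB).mp (Finset.sup_le fun i _ => ?_)
  exact Nat.le_floor (hS i)

/-- Here β = K/δ contributes 1/ξ² and T²/β² contributes a single logarithm. The second logarithm is
slack, from ln(1/ξ) ≥ 1/2. -/
theorem maxTrotter_solverSchedule_zero_le (hpb : 0 < pb) (hpb1 : pb ≤ 1) (hh : 0 < h)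
    (hξ : 0 < ξ) (hξ2 : ξ ≤ 1 / 2) :
    ((solverSchedule pb h 0 ξ κ).maxTrotter : ℝ) ≤
      (4 * scaleConst pb ^ 2 * tailRatio pb + 4) * (1 / ξ ^ 2 * Real.log (1 / ξ) ^ 2) := by
  have hl := log_two_le_log_inv hξ hξ2
  have hl2 := Real.log_two_gt_d9
  have hK := scaleConst_pos hpb
  have hQ := tailRatio_pos hpb hpb1
  refine maxTrotter_le_of_forall (by positivity) fun i => ?_
  refine (Nt_solverSchedule_le hpb hpb1 hh hξ hξ2 i).trans ?_
  have hδ := scale_pos hh i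
  rw [imagTime_of_le hδ hδ.le]
  set l := Real.log (1 / ξ) with hldef
  have h1 : h * (scaleConst pb / ((3 / 4 : ℝ) ^ (i : ℕ) * h)) ≤ scaleConst pb * (1 / ξ) := by
    calc _ = scaleConst pb * ((3 / 4 : ℝ) ^ (i : ℕ))⁻¹ := by field_simp
      _ ≤ _ := mul_le_mul_of_nonneg_left (inv_pow_three_fourths_le hξ hξ2 i.2) hK.le
  have hl0 : 0 < l := by linarith
  have h2 : l ≤ 2 * l ^ 2 := by nlinarith
  have h3 : 1 ≤ 4 * (1 / ξ ^ 2 * l ^ 2) := by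
    have : 1 ≤ 1 / ξ ^ 2 := by
      rw [le_div_iff₀ (by positivity), one_mul]; exact pow_le_one₀ hξ.le (by linarith)
    nlinarith
  calc _ ≤ 2 * tailRatio pb * (scaleConst pb * (1 / ξ)) ^ 2 * (2 * l ^ 2) +
        4 * (1 / ξ ^ 2 * l ^ 2) := by gcongr
    _ = _ := by ring

/-- Two logarithms come from β² and one from T²/β²; the fourth is slack. The hypothesis Δb ≤ 2h
bounds Δb/δ by 2/ξ, and it also gives h²/Δb² ≥ 1/4, so that the +1 of the ceiling is absorbed. -/
theorem maxTrotter_solverSchedule_le (hpb : 0 < pb) (hpb1 : pb ≤ 1) (hh : 0 < h)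
    (hξ : 0 < ξ) (hξ2 : ξ ≤ 1 / 2) (hΔ : 0 < Δb) (hΔh : Δb ≤ 2 * h) :
    ((solverSchedule pb h Δb ξ κ).maxTrotter : ℝ) ≤
      (64 * scaleConst pb ^ 2 * tailRatio pb + 64) *
        (h ^ 2 / Δb ^ 2 * Real.log (1 / ξ) ^ 4) := by
  have hl := log_two_le_log_inv hξ hξ2
  have hl2 := Real.log_two_gt_d9
  have hK := scaleConst_pos hpb
  have hQ := tailRatio_pos hpb hpb1
  refine maxTrotter_le_of_forall (by positivity) fun i => ?_
  refine (Nt_solverSchedule_le hpb hpb1 hh hξ hξ2 i).trans ?_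
  have hδ := scale_pos hh i
  have hpow := inv_pow_three_fourths_le hξ hξ2 i.2
  set l := Real.log (1 / ξ) with hldef
  have hl0 : 0 < l := by linarith
  set δ := (3 / 4 : ℝ) ^ (i : ℕ) * h with hδdef
  have hmax : 0 < max Δb δ := hΔ.trans_le (le_max_left _ _)
  have hlog : 1 + Real.log (max Δb δ / δ) ≤ 4 * l := by
    have h1 : max Δb δ / δ ≤ 2 * (1 / ξ) := by
      have h2 : max Δb δ ≤ 2 * h := max_le hΔh (by linarith [scale_le hh i])
      calc _ ≤ 2 * h / δ := by gcongr
        _ = 2 * ((3 / 4 : ℝ) ^ (i : ℕ))⁻¹ := by rw [hδdef]; field_simp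
        _ ≤ _ := by gcongr
    have h3 := Real.log_le_log (div_pos hmax hδ) h1
    rw [Real.log_mul (by norm_num) (by positivity)] at h3
    linarith
  have hlog0 := log_max_div_nonneg (Δb := Δb) hδ
  have h1 : h * imagTime pb Δb δ ≤ scaleConst pb * (h / Δb) * (4 * l) := by
    calc _ = scaleConst pb * (h / max Δb δ) * (1 + Real.log (max Δb δ / δ)) := by
          rw [imagTime]; ring
      _ ≤ _ := by gcongr; exact le_max_left _ _
  have hβ := imagTime_pos (Δb := Δb) hpb hδ
  have h2 : l ^ 3 ≤ 2 * l ^ 4 := by nlinarith [pow_pos hl0 3]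
  have h3 : 1 ≤ 64 * (h ^ 2 / Δb ^ 2 * l ^ 4) := by
    have h4 : 1 / 4 ≤ h ^ 2 / Δb ^ 2 := by
      rw [le_div_iff₀ (by positivity)]; nlinarith
    have h5 : 1 / 4 ≤ l ^ 2 := by nlinarith
    have h6 : 1 / 16 ≤ l ^ 4 := by nlinarith
    nlinarith
  calc _ ≤ 2 * tailRatio pb * (scaleConst pb * (h / Δb) * (4 * l)) ^ 2 * l +
        64 * (h ^ 2 / Δb ^ 2 * l ^ 4) := by gcongr
    _ = 32 * scaleConst pb ^ 2 * tailRatio pb * (h ^ 2 / Δb ^ 2) * l ^ 3 +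
        64 * (h ^ 2 / Δb ^ 2 * l ^ 4) := by rw [mul_pow, mul_pow, div_pow]; ring
    _ ≤ 32 * scaleConst pb ^ 2 * tailRatio pb * (h ^ 2 / Δb ^ 2) * (2 * l ^ 4) +
        64 * (h ^ 2 / Δb ^ 2 * l ^ 4) := by gcongr
    _ = _ := by ring

end Solver
end

end QCMC

/-! ### Assembly of the two cases -/

theorem theorem2 (pb : ℝ) (hpb : 0 < pb) :
    ∃ C : ℝ, 0 < C ∧
      -- (i) the general case
      (∀ hTot ξ κ : ℝ, 0 < hTot → 0 < ξ → 0 < κ →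
        ∃ S : QCMC.Schedule,
          ∀ (n : ℕ) (H : QCMC.PauliSum n) (ψ φg : QCMC.State n) (Eg : ℝ),
            H.norm1 = hTot → H.IsGroundEnergy Eg → H.IsGroundState Eg φg →
            ‖ψ‖ = 1 → pb ≤ ‖inner ℂ φg ψ‖ ^ 2 →
            S.IsProper hTot ∧ S.GeneralRule pb ∧
            1 - κ < (S.runLaw H ψ).real {ω | ‖S.result H ω - (Eg : ℂ)‖ < hTot * ξ} ∧
            (ξ ≤ 1 / 2 → κ ≤ 1 →
              (S.totalSamples : ℝ) ≤ C * (1 / (κ * ξ ^ 2) * Real.log (1 / ξ) ^ 2) ∧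
              (S.maxTrotter : ℝ) ≤ C * (1 / ξ ^ 2 * Real.log (1 / ξ) ^ 2))) ∧
      -- (ii) the case of a known lower bound on the energy gap
      (∀ hTot Δb ξ κ : ℝ, 0 < hTot → 0 < Δb → 0 < ξ → 0 < κ →
        ∃ S : QCMC.Schedule,
          ∀ (n : ℕ) (H : QCMC.PauliSum n) (ψ φg : QCMC.State n) (Eg Δ : ℝ),
            H.norm1 = hTot → H.IsGroundEnergy Eg → H.IsGroundState Eg φg →
            ‖ψ‖ = 1 → pb ≤ ‖inner ℂ φg ψ‖ ^ 2 →
            H.IsGap Eg Δ → Δb ≤ Δ →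
            S.IsProper hTot ∧ S.GapRule pb Δb ∧
            1 - κ < (S.runLaw H ψ).real {ω | ‖S.result H ω - (Eg : ℂ)‖ < hTot * ξ} ∧
            (ξ ≤ 1 / 2 → κ ≤ 1 →
              (S.totalSamples : ℝ) ≤ C * (1 / (κ * ξ ^ 2) * Real.log (1 / ξ) ^ 2) ∧
              (S.maxTrotter : ℝ) ≤ C * (hTot ^ 2 / Δb ^ 2 * Real.log (1 / ξ) ^ 4))) := by
  set C₁ := 72 * QCMC.sampleConst pb + 12
  -- The constant is fixed before any state is given, hence before pb ≤ 1 is known. That bound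
  -- follows only from the overlap, by Cauchy–Schwarz, and positivity of `tailRatio` relies on it;
  -- the absolute value covers the remaining pb.
  set C₂ := 64 * QCMC.scaleConst pb ^ 2 * |QCMC.tailRatio pb| + 64
  have hC₁ : 0 < C₁ := by have := QCMC.sampleConst_pos hpb; positivity
  have hC₂ : 0 < C₂ := by positivity
  have hpb1 : ∀ {n : ℕ} {φ ψ : QCMC.State n}, ‖φ‖ = 1 → ‖ψ‖ = 1 →
      pb ≤ ‖inner ℂ φ ψ‖ ^ 2 → pb ≤ 1 := fun {_ φ ψ} hφ hψ h =>
    h.trans (pow_le_one₀ (norm_nonneg _) (by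
      simpa [hφ, hψ] using norm_inner_le_norm (𝕜 := ℂ) φ ψ))
  refine ⟨C₁ + C₂, by positivity, ?_, ?_⟩
  · intro hTot ξ κ hh hξ hκ
    -- The general case is the gap bound 0, for which the gap hypothesis only says that Eg is the
    -- least energy.
    refine ⟨QCMC.solverSchedule pb hTot 0 ξ κ, ?_⟩
    rintro n H ψ φg Eg rfl hEg hg hψ hov
    have h1 := hpb1 hg.1 hψ hov
    refine ⟨QCMC.isProper_solverSchedule hpb h1 hh hκ, QCMC.generalRule_solverSchedule hpb h1 hh,
      QCMC.success_solverSchedule hpb h1 hξ hκ H hh hEg hg hψ hov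
        fun E hE _ => sub_nonneg.mpr (hEg.2 hE), fun hξ2 hκ1 => ⟨?_, ?_⟩⟩
    · exact (QCMC.totalSamples_solverSchedule_le hpb hh hξ hκ hξ2 hκ1).trans
        (mul_le_mul_of_nonneg_right (by linarith) (by positivity))
    · refine (QCMC.maxTrotter_solverSchedule_zero_le hpb h1 hh hξ hξ2).trans
        (mul_le_mul_of_nonneg_right ?_ (by positivity))
      have h2 : 0 ≤ QCMC.scaleConst pb ^ 2 * QCMC.tailRatio pb :=
        mul_nonneg (sq_nonneg _) (QCMC.tailRatio_pos hpb h1).le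
      have h3 : C₂ = 64 * (QCMC.scaleConst pb ^ 2 * QCMC.tailRatio pb) + 64 := by
        rw [← mul_assoc, ← abs_of_pos (QCMC.tailRatio_pos hpb h1)]
      linarith
  · intro hTot Δb ξ κ hh hΔb hξ hκ
    refine ⟨QCMC.solverSchedule pb hTot Δb ξ κ, ?_⟩
    rintro n H ψ φg Eg Δ rfl hEg hg hψ hov hΔ hle
    have h1 := hpb1 hg.1 hψ hov
    refine ⟨QCMC.isProper_solverSchedule hpb h1 hh hκ, QCMC.gapRule_solverSchedule hpb h1 hh,
      QCMC.success_solverSchedule hpb h1 hξ hκ H hh hEg hg hψ hov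
        fun E hE hne => hle.trans (hΔ.2 ⟨E, hE, hne, rfl⟩), fun hξ2 hκ1 => ⟨?_, ?_⟩⟩
    · exact (QCMC.totalSamples_solverSchedule_le hpb hh hξ hκ hξ2 hκ1).trans
        (mul_le_mul_of_nonneg_right (by linarith) (by positivity))
    -- The gap is a difference of two energies in [-h, h].
    · have hΔh : Δb ≤ 2 * H.norm1 := by
        obtain ⟨E, hE, -, rfl⟩ := hΔ.1
        have h2 := abs_le.mp (QCMC.abs_le_norm1_of_mem_energies H hE)
        have h3 := abs_le.mp (QCMC.abs_le_norm1_of_mem_energies H hEg.1)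
        linarith [h2.2, h3.1]
      refine (QCMC.maxTrotter_solverSchedule_le hpb h1 hh hξ hξ2 hΔb hΔh).trans
        (mul_le_mul_of_nonneg_right ?_ (by positivity))
      rw [← abs_of_pos (QCMC.tailRatio_pos hpb h1)]
      exact le_add_of_nonneg_left hC₁.le
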